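/- For real numbers $\lambda,l$ and an integer $d\ge 1$ let $D(\lambda,d,l)=\{x\in\mathbb R^d : \text{each } x_i=a_i+j_i\lambda \text{ with } a_i,j_i\in\mathbb Z,\ -l\le j_i\le l\}$. For $p\in\mathbb R^d$ and $r>0$ let $A(p,r)=\{y\in\mathbb Z^d:\|y-p\|\le r\}$ be the set of lattice points in the closed Euclidean ball of radius $r$ with center $p$. In the maximum coverage problem with balls, an input consists of real numbers $\lambda,l$, integers $d\ge1$, $m\ge 0$, $0\le k\le m$, centers $p_1,\dots,p_m\in D(\lambda,d,l)$, real radii $r_1,\dots,r_m>0$, and a failure probability $\gamma\in(0,1)$. With $A_i=A(p_i,r_i)$, the task is to select $H\subseteq\{1,\dots,m\}$ with $|H|=k$ such that $|\bigcup_{i\in H}A_i|$ is as large as possible. The model of computation is a randomized random access machine on real numbers with unit costs. Its programs do not depend on the input. They are built by sequencing, branching and while loops from the following elementary steps on real registers and arrays of reals: loading an integer constant, copying, $+,-,\times,\div$, $\lfloor\cdot\rfloor$, reading or writing the array entry whose address is the integer part of a register, comparing two registers ($\le$, $<$), and drawing a uniformly random element of $\{0,\dots,\lfloor x\rfloor-1\}$,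 where $x$ is the content of a register. The numbers $d,m,k,\lambda,l,\gamma$, the radii and the coordinates of the centers are given in memory. **Theorem.** There are a program of this machine and a constant $C$ such that, on every input as above, with $$T=C\,\bigl(|\lambda|+d+|l|+k+m+\log(1/\gamma)+1\bigr)^{C},$$ 1. every run of the program halts after at most $T$ steps; 2. every number stored during a run has absolute value at most $(2+\sum_{i}(r_i+\sum_j|p_{i,j}|))^{T}$; 3. with probability at least $1-\gamma$ the output is a set $H\subseteq\{1,\dots,m\}$ with $|H|=k$ and $$\Bigl|\bigcup_{i\in H}A_i\Bigr|\ \ge\ \Bigl(1-\frac1e\Bigr)\max_{J\subseteq\{1,\dots,m\},\,|J|=k}\Bigl|\bigcup_{i\in J}A_i\Bigr|.$$ In particular, for each fixed $\gamma$ this is a randomized $(1-\frac1e)$-approximation algorithm for maximum coverage with balls, with running time $\mathrm{poly}(|\lambda|,d,|l|,k,m)$. -/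

import Mathlib

noncomputable section

namespace BallCoverage

/-! ### Balls and maximum coverage -/

/-- `D(lam, d, l)`: the points of `ℝ^d` all of whose coordinates have the form `a + j * lam`
with `a` an arbitrary integer and `j` an integer in `[-l, l]`. -/
def centerSet (lam : ℝ) (d : ℕ) (l : ℝ) : Set (EuclideanSpace ℝ (Fin d)) :=
  {x | ∀ i, ∃ a j : ℤ, -l ≤ (j : ℝ) ∧ (j : ℝ) ≤ l ∧ x i = (a : ℝ) + (j : ℝ) * lam}

/-- The lattice points of the closed Euclidean ball of radius `r` with center `p`. -/
def latticeBall {d : ℕ} (p : EuclideanSpace ℝ (Fin d)) (r : ℝ) : Set (Fin d → ℤ) :=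
  {y | dist (WithLp.toLp 2 (fun i => (y i : ℝ)) : EuclideanSpace ℝ (Fin d)) p ≤ r}

/-- A ball contains only finitely many lattice points, so that `Set.ncard` below is the
true number of elements. -/
theorem latticeBall_finite {d : ℕ} (p : EuclideanSpace ℝ (Fin d)) (r : ℝ) :
    (latticeBall p r).Finite := by
  refine (Set.finite_Icc (fun i => ⌊p i - r⌋) (fun i => ⌈p i + r⌉)).subset ?_
  intro y hy
  have key : ∀ i, |(y i : ℝ) - p i| ≤ r := fun i => by
    have h := PiLp.norm_apply_le
      ((WithLp.toLp 2 (fun i => (y i : ℝ)) : EuclideanSpace ℝ (Fin d)) - p) i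
    have hy' : dist (WithLp.toLp 2 (fun i => (y i : ℝ)) : EuclideanSpace ℝ (Fin d)) p ≤ r := hy
    rw [dist_eq_norm] at hy'
    simpa [Real.norm_eq_abs] using h.trans hy'
  refine ⟨fun i => ?_, fun i => ?_⟩
  · have h := abs_le.1 (key i)
    have h1 := Int.floor_le (p i - r)
    have : ((⌊p i - r⌋ : ℤ) : ℝ) ≤ (y i : ℝ) := by linarith
    exact_mod_cast this
  · have h := abs_le.1 (key i)
    have h1 := Int.le_ceil (p i + r)
    have : (y i : ℝ) ≤ ((⌈p i + r⌉ : ℤ) : ℝ) := by linarith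
    exact_mod_cast this

/-- An input: a list of `m` balls in `ℝ^d`, the number `k` of sets to select, the parameters
`lam` and `l` of the set of admissible centers, and the permitted failure probability. -/
structure Input where
  d : ℕ
  m : ℕ
  k : ℕ
  lam : ℝ
  l : ℝ
  failure : ℝ
  center : Fin m → EuclideanSpace ℝ (Fin d)
  radius : Fin m → ℝ

namespace Input

/-- The inputs that the problem allows. -/
structure Valid (I : Input) : Prop where
  d_pos : 0 < I.d
  k_le : I.k ≤ I.m
  failure_pos : 0 < I.failure
  failure_lt_one : I.failure < 1
  center_mem : ∀ i, I.center i ∈ centerSet I.lam I.d I.l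
  radius_pos : ∀ i, 0 < I.radius i

/-- The number of lattice points covered by the balls with index in `S`. -/
def coverage (I : Input) (S : Finset (Fin I.m)) : ℕ :=
  (⋃ i ∈ S, latticeBall (I.center i) (I.radius i)).ncard

/-- `S` is a `ρ`-approximate solution of the maximum coverage problem: it selects exactly `k`
of the sets, and covers at least `ρ` times as many points as any selection of `k` sets. -/
def IsApprox (I : Input) (ρ : ℝ) (S : Finset (Fin I.m)) : Prop :=
  S.card = I.k ∧
    ∀ J : Finset (Fin I.m), J.card = I.k → ρ * (I.coverage J : ℝ) ≤ (I.coverage S : ℝ)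

/-- The quantity in which the running time is polynomial. -/
def param (I : Input) : ℝ :=
  |I.lam| + (I.d : ℝ) + |I.l| + (I.k : ℝ) + (I.m : ℝ) + Real.log (1 / I.failure) + 1

/-- The total absolute value of the coordinates of the centers and of the radii. -/
def magnitude (I : Input) : ℝ :=
  ∑ i, (|I.radius i| + ∑ j, |I.center i j|)

end Input

/-! ### A randomized real-number random access machine, as a language of `while` programs -/

/-- Memory: real registers, and arrays of reals. -/
structure Store where
  reg : ℕ → ℝ
  arr : ℕ → ℕ → ℝ

/-- Binary arithmetic operations (`x / 0 = 0`). -/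
inductive BinOp
  | add | sub | mul | div

def BinOp.eval : BinOp → ℝ → ℝ → ℝ
  | .add, a, b => a + b
  | .sub, a, b => a - b
  | .mul, a, b => a * b
  | .div, a, b => a / b

/-- Comparisons of two registers. -/
inductive Test
  | le (x y : ℕ)
  | lt (x y : ℕ)

def Test.Holds : Test → Store → Prop
  | .le x y, s => s.reg x ≤ s.reg y
  | .lt x y, s => s.reg x < s.reg y

/-- Programs. Register and array names, and the integer constants, are fixed in the program;
array entries are addressed through the contents of a register.
* `const x c` : `x := c`
* `copy x y` : `x := y`
* `op o x y z` : `x := y o z`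
* `floor x y` : `x := ⌊y⌋`
* `load x a y` : `x := a[y]`
* `store a y x` : `a[y] := x`
* `rand x y` : `x :=` a uniformly random element of `{0, …, ⌊y⌋ - 1}` -/
inductive Prog
  | const (x : ℕ) (c : ℤ)
  | copy (x y : ℕ)
  | op (o : BinOp) (x y z : ℕ)
  | floor (x y : ℕ)
  | load (x a y : ℕ)
  | store (a y x : ℕ)
  | rand (x y : ℕ)
  | skip
  | seq (P Q : Prog)
  | ite (b : Test) (P Q : Prog)
  | loop (b : Test) (P : Prog)

/-- Assignment to a register. -/
def Store.setReg (s : Store) (x : ℕ) (v : ℝ) : Store :=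
  { s with reg := Function.update s.reg x v }

/-- Assignment to the array entry `a[n]`. -/
def Store.setArr (s : Store) (a n : ℕ) (v : ℝ) : Store :=
  { s with arr := Function.update s.arr a (Function.update (s.arr a) n v) }

/-- The uniform distribution on `{0, …, n - 1}`, as real numbers (the value is `0` if `n = 0`). -/
def uniformBelow : ℕ → PMF ℝ
  | 0 => PMF.pure 0
  | n + 1 => (PMF.uniformOfFintype (Fin (n + 1))).map (fun i => ((i : ℕ) : ℝ))

/-- A configuration: the stack of program parts that are still to be executed, and the memory. -/
structure Config where
  todo : List Prog
  mem : Store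

open Classical in
/-- One elementary step. A halted configuration, one with an empty stack, does not change. -/
def step : Config → PMF Config
  | ⟨[], s⟩ => PMF.pure ⟨[], s⟩
  | ⟨.const x c :: K, s⟩ => PMF.pure ⟨K, s.setReg x (c : ℝ)⟩
  | ⟨.copy x y :: K, s⟩ => PMF.pure ⟨K, s.setReg x (s.reg y)⟩
  | ⟨.op o x y z :: K, s⟩ => PMF.pure ⟨K, s.setReg x (o.eval (s.reg y) (s.reg z))⟩
  | ⟨.floor x y :: K, s⟩ => PMF.pure ⟨K, s.setReg x (⌊s.reg y⌋ : ℝ)⟩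
  | ⟨.load x a y :: K, s⟩ => PMF.pure ⟨K, s.setReg x (s.arr a ⌊s.reg y⌋₊)⟩
  | ⟨.store a y x :: K, s⟩ => PMF.pure ⟨K, s.setArr a ⌊s.reg y⌋₊ (s.reg x)⟩
  | ⟨.rand x y :: K, s⟩ => (uniformBelow ⌊s.reg y⌋₊).map (fun v => ⟨K, s.setReg x v⟩)
  | ⟨.skip :: K, s⟩ => PMF.pure ⟨K, s⟩
  | ⟨.seq P Q :: K, s⟩ => PMF.pure ⟨P :: Q :: K, s⟩
  | ⟨.ite b P Q :: K, s⟩ => PMF.pure (if b.Holds s then ⟨P :: K, s⟩ else ⟨Q :: K, s⟩)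
  | ⟨.loop b P :: K, s⟩ => PMF.pure (if b.Holds s then ⟨P :: .loop b P :: K, s⟩ else ⟨K, s⟩)

/-- The distribution of the configuration after `n` steps. -/
def runFrom (c : Config) : ℕ → PMF Config
  | 0 => PMF.pure c
  | n + 1 => (runFrom c n).bind step

/-- The initial memory. Registers `0, …, 5` hold `d`, `m`, `k`, `lam`, `l` and the failure
probability. Array `0` holds the radii, and entry `i * d + j` of array `1` is coordinate `j` of
the center of ball `i`. Everything else is `0`. -/
def Input.store (I : Input) : Store where
  reg
    | 0 => (I.d : ℝ)
    | 1 => (I.m : ℝ)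
    | 2 => (I.k : ℝ)
    | 3 => I.lam
    | 4 => I.l
    | 5 => I.failure
    | _ => 0
  arr
    | 0 => fun n => if h : n < I.m then I.radius ⟨n, h⟩ else 0
    | 1 => fun n =>
        if h : n / I.d < I.m ∧ n % I.d < I.d then I.center ⟨n / I.d, h.1⟩ ⟨n % I.d, h.2⟩ else 0
    | _ => fun _ => 0

/-- The distribution of the configuration after `n` steps of the program `P` on the input `I`. -/
def Prog.run (P : Prog) (I : Input) (n : ℕ) : PMF Config :=
  runFrom ⟨[P], I.store⟩ n

/-- The output: the sets whose indices are marked by a `1` in array `2`. -/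
def Config.output (c : Config) (I : Input) : Finset (Fin I.m) := by
  classical exact Finset.univ.filter (fun i => c.mem.arr 2 (i : ℕ) = 1)

/-- On the input `I`, every run of `P` halts after at most `T` steps. -/
def Prog.HaltsWithin (P : Prog) (I : Input) (T : ℝ) : Prop :=
  ∃ n : ℕ, (n : ℝ) ≤ T ∧ ∀ c ∈ (P.run I n).support, c.todo = []

/-- On the input `I`, no run of `P` ever stores a number of absolute value larger than `B`. -/
def Prog.NumbersBounded (P : Prog) (I : Input) (B : ℝ) : Prop :=
  ∀ n : ℕ, ∀ c ∈ (P.run I n).support,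
    (∀ x, |c.mem.reg x| ≤ B) ∧ ∀ a i, |c.mem.arr a i| ≤ B

/-- On the input `I`, the probability that `P` has halted after finitely many steps with an
output that satisfies `Good` is at least `q`. -/
def Prog.SucceedsWithProb (P : Prog) (I : Input) (Good : Finset (Fin I.m) → Prop) (q : ℝ) :
    Prop :=
  ∃ n : ℕ, ENNReal.ofReal q ≤
    (P.run I n).toOuterMeasure {c | c.todo = [] ∧ Good (c.output I)}

end BallCoverage

end

/-! Greedy selection with exact gains reaches 1 - (1 - 1/k)^k, which exceeds 1 - 1/e by a margin of
order 1/k. This margin pays for estimated gains, so no ε is lost: if every gain |A_i \ ⋃_{i' ∈ S}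
A_i'| is known up to 3/(100 k²) times the optimum, the errors accumulate to 3/(50 k) times the
optimum, which the margin covers (`GreedyRun.sub_cover_le`, `one_sub_inv_pow_le`,
`GreedyRun.approx`). A single ball never exceeds the optimum, so it is enough to estimate, by
uniform sampling, which fraction of each ball is still uncovered. The greedy choices depend on the
samples, so the estimates must be good for all pairs (S, i) at once; Hoeffding's inequality and a
union bound over these m 2^m pairs require only polynomially many samples (`exists_good_samples`,
`union_bound`).

The difficulty is to sample from a ball that may hold exponentially many lattice points. Write the
center as a + jλ with integer vectors a, j. With z = y - a, the squared distance of y from the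
center is Σ z² - 2λ Σ z j + λ² Σ j², so membership depends on two integers only, Σ z² and Σ z j. If
the radius is below the polynomial bound `F`, both have polynomially many values; they are packed
into one key, and dynamic programming counts the vectors with each key. The counts turn a rank into
a vector (`enc`, `rank`), hence a uniform rank into a uniform point. If the radius is larger, one
writes y = a + s z + u with s about r / F and 0 ≤ u < s in each coordinate, and decides by ‖z‖
alone, with a tolerance. The accepted points form a superset of the ball (`exists_point_eq`), and a
comparison of volumes shows that it is at most three times as large (`size_le`). A sample outside
the ball gets weight zero, so the estimates stay unbiased and the error grows by a factor of at most
3.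

All randomness is one number below M^N, where M is a common multiple of the sizes of the nonempty
supersets. Its N digits in base M are independent and uniform, and a digit modulo the size of a
superset is an exactly uniform rank (`card_filter_fin_mod`). The same digit serves all balls; the
resulting correlation is harmless in a union bound. The program is thus deterministic before and
after a single draw. Deterministic programs are verified by a precondition calculus that also counts
steps and limits the growth of numbers by a factor G per step (`wp_sound`), and
`runFrom_seq_rand_seq` glues the two halves together. -/

noncomputable section
namespace BallCoverage

/-! ### Symbolic execution of deterministic programs -/

namespace Store

/-- All numbers in the memory have absolute value at most `b`. -/
def Bounded (s : Store) (b : ℝ) : Prop :=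
  (∀ x, |s.reg x| ≤ b) ∧ ∀ a i, |s.arr a i| ≤ b

theorem setReg_reg (s : Store) (x : ℕ) (v : ℝ) (y : ℕ) :
    (s.setReg x v).reg y = if y = x then v else s.reg y := by
  simp [setReg, Function.update_apply]

theorem setReg_arr (s : Store) (x : ℕ) (v : ℝ) : (s.setReg x v).arr = s.arr := rfl

theorem setArr_reg (s : Store) (a n : ℕ) (v : ℝ) : (s.setArr a n v).reg = s.reg := rfl

theorem setArr_arr (s : Store) (a n : ℕ) (v : ℝ) (b i : ℕ) :
    (s.setArr a n v).arr b i = if b = a ∧ i = n then v else s.arr b i := by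
  by_cases hb : b = a
  · subst hb; simp [setArr, Function.update_apply]
  · simp [setArr, hb]

theorem Bounded.setReg {s : Store} {b v : ℝ} (h : s.Bounded b) (x : ℕ) (hv : |v| ≤ b) :
    (s.setReg x v).Bounded b := by
  refine ⟨fun y => ?_, h.2⟩
  rw [setReg_reg]
  split_ifs
  exacts [hv, h.1 y]

theorem Bounded.setArr {s : Store} {b v : ℝ} (h : s.Bounded b) (a n : ℕ) (hv : |v| ≤ b) :
    (s.setArr a n v).Bounded b := by
  refine ⟨h.1, fun y i => ?_⟩
  rw [setArr_arr]
  split_ifs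
  exacts [hv, h.2 y i]

theorem Bounded.mono {s : Store} {b b' : ℝ} (h : s.Bounded b) (hb : b ≤ b') : s.Bounded b' :=
  ⟨fun x => (h.1 x).trans hb, fun a i => (h.2 a i).trans hb⟩

/-- Passing from `s` to `s'` multiplies the size of the numbers by at most `G`. -/
def Grow (G : ℝ) (s s' : Store) : Prop :=
  ∀ b, 1 ≤ b → s.Bounded b → s'.Bounded (G * b)

end Store

/-- `n` deterministic steps lead from one configuration to another, and each of them multiplies
the size of the numbers by at most `G`. -/
inductive Path (G : ℝ) : ℕ → Config → Config → Prop
  | refl (c : Config) : Path G 0 c c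
  | cons {n : ℕ} {c c' c'' : Config} (h : step c = PMF.pure c') (hg : c.mem.Grow G c'.mem)
      (h' : Path G n c' c'') : Path G (n + 1) c c''

theorem Path.trans {G : ℝ} {n n' : ℕ} {c c' c'' : Config} (h : Path G n c c')
    (h' : Path G n' c' c'') : Path G (n + n') c c'' := by
  induction h with
  | refl c => simpa using h'
  | cons h hg _ ih =>
    rw [Nat.add_right_comm]
    exact .cons h hg (ih h')

theorem Path.single {G : ℝ} {c c' : Config} (h : step c = PMF.pure c')
    (hg : c.mem.Grow G c'.mem) : Path G 1 c c' := .cons h hg (.refl _)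

/-! ### Cost, frame rule and precondition calculus -/

namespace Prog

/-- The number of steps of a program all of whose loops have at most `Q` iterations. -/
def cost (Q : ℕ) : Prog → ℕ
  | .seq P R => P.cost Q + R.cost Q + 1
  | .ite _ P R => P.cost Q + R.cost Q + 1
  | .loop _ P => Q * (P.cost Q + 1) + 1
  | _ => 1

/-- An upper bound for the constants of a program. -/
def constBound : Prog → ℕ
  | .const _ c => c.natAbs
  | .seq P R => max P.constBound R.constBound
  | .ite _ P R => max P.constBound R.constBound
  | .loop _ P => P.constBound
  | _ => 0

/-- Can the program change the given register? -/
def modReg : Prog → ℕ → Bool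
  | .const x _, y => y == x
  | .copy x _, y => y == x
  | .op _ x _ _, y => y == x
  | .floor x _, y => y == x
  | .load x _ _, y => y == x
  | .store _ _ _, _ => false
  | .rand x _, y => y == x
  | .skip, _ => false
  | .seq P R, y => P.modReg y || R.modReg y
  | .ite _ P R, y => P.modReg y || R.modReg y
  | .loop _ P, y => P.modReg y

/-- Can the program change the given array? -/
def modArr : Prog → ℕ → Bool
  | .store a _ _, b => b == a
  | .seq P R, y => P.modArr y || R.modArr y
  | .ite _ P R, y => P.modArr y || R.modArr y
  | .loop _ P, y => P.modArr y
  | _, _ => false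

/-- `s` and `s'` agree on everything that `P` cannot change. -/
def Frame (P : Prog) (s s' : Store) : Prop :=
  (∀ x, P.modReg x = false → s'.reg x = s.reg x) ∧ ∀ a, P.modArr a = false → s'.arr a = s.arr a

theorem Frame.refl (P : Prog) (s : Store) : P.Frame s s := ⟨fun _ _ => rfl, fun _ _ => rfl⟩

theorem Frame.trans {P : Prog} {s s' s'' : Store} (h : P.Frame s s') (h' : P.Frame s' s'') :
    P.Frame s s'' :=
  ⟨fun x hx => (h'.1 x hx).trans (h.1 x hx), fun x hx => (h'.2 x hx).trans (h.2 x hx)⟩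

/-- A precondition under which the program, started in the memory `s`, terminates without use of
randomness in a memory that satisfies `Φ`. All loops have at most `Q` iterations, second factors
are at most `G` and divisors are at least `1` (or `0`) in absolute value. -/
def wp (G : ℝ) (Q : ℕ) : Prog → (Store → Prop) → Store → Prop
  | .const x c, Φ, s => Φ (s.setReg x (c : ℝ))
  | .copy x y, Φ, s => Φ (s.setReg x (s.reg y))
  | .op .add x y z, Φ, s => Φ (s.setReg x (s.reg y + s.reg z))
  | .op .sub x y z, Φ, s => Φ (s.setReg x (s.reg y - s.reg z))
  | .op .mul x y z, Φ, s => |s.reg z| ≤ G ∧ Φ (s.setReg x (s.reg y * s.reg z))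
  | .op .div x y z, Φ, s => 1 ≤ |s.reg z| ∧ Φ (s.setReg x (s.reg y / s.reg z))
  | .floor x y, Φ, s => Φ (s.setReg x (⌊s.reg y⌋ : ℝ))
  | .load x a y, Φ, s => Φ (s.setReg x (s.arr a ⌊s.reg y⌋₊))
  | .store a y x, Φ, s => Φ (s.setArr a ⌊s.reg y⌋₊ (s.reg x))
  | .rand _ _, _, _ => False
  | .skip, Φ, s => Φ s
  | .seq P R, Φ, s => P.wp G Q (R.wp G Q Φ) s
  | .ite b P R, Φ, s => (b.Holds s → P.wp G Q Φ s) ∧ (¬ b.Holds s → R.wp G Q Φ s)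
  | .loop b P, Φ, s => ∃ (Inv : ℕ → Store → Prop) (q : ℕ), q ≤ Q ∧ Inv q s ∧
      (∀ n s, Inv (n + 1) s → b.Holds s ∧ P.wp G Q (Inv n) s) ∧
      ∀ s, Inv 0 s → ¬ b.Holds s ∧ Φ s

theorem wp_mono {G : ℝ} {Q : ℕ} {P : Prog} {Φ Ψ : Store → Prop} {s : Store}
    (h : P.wp G Q Φ s) (hΦ : ∀ s', Φ s' → Ψ s') : P.wp G Q Ψ s := by
  induction P generalizing Φ Ψ s with
  | op o x y z =>
    cases o
    exacts [hΦ _ h, hΦ _ h, ⟨h.1, hΦ _ h.2⟩, ⟨h.1, hΦ _ h.2⟩]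
  | rand => exact h
  | seq P R ihP ihR => exact ihP h fun s' h' => ihR h' hΦ
  | ite b P R ihP ihR => exact ⟨fun hb => ihP (h.1 hb) hΦ, fun hb => ihR (h.2 hb) hΦ⟩
  | loop b P ih =>
    obtain ⟨Inv, q, hq, h0, h1, h2⟩ := h
    exact ⟨Inv, q, hq, h0, h1, fun s hs => ⟨(h2 s hs).1, hΦ _ (h2 s hs).2⟩⟩
  | _ => exact hΦ _ h

theorem wp_frame {G : ℝ} {Q : ℕ} {P : Prog} {Φ : Store → Prop} {s : Store}
    (h : P.wp G Q Φ s) : P.wp G Q (fun s' => Φ s' ∧ P.Frame s s') s := by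
  induction P generalizing Φ s with
  | op o x y z =>
    have key : ∀ v, (Prog.op o x y z).Frame s (s.setReg x v) := fun v =>
      ⟨fun y hy => by simp_all [modReg, Store.setReg_reg], fun _ _ => rfl⟩
    cases o
    exacts [⟨h, key _⟩, ⟨h, key _⟩, ⟨h.1, h.2, key _⟩, ⟨h.1, h.2, key _⟩]
  | rand => exact h
  | seq P R ihP ihR =>
    change P.wp G Q (R.wp G Q _) s
    refine wp_mono (ihP h) fun s' h' => wp_mono (ihR h'.1) fun s'' h'' => ⟨h''.1, ?_, ?_⟩
    · intro x hx
      simp only [modReg, Bool.or_eq_false_iff] at hx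
      exact (h''.2.1 x hx.2).trans (h'.2.1 x hx.1)
    · intro x hx
      simp only [modArr, Bool.or_eq_false_iff] at hx
      exact (h''.2.2 x hx.2).trans (h'.2.2 x hx.1)
  | ite b P R ihP ihR =>
    refine ⟨fun hb => wp_mono (ihP (h.1 hb)) fun s' h' => ⟨h'.1, ?_, ?_⟩,
      fun hb => wp_mono (ihR (h.2 hb)) fun s' h' => ⟨h'.1, ?_, ?_⟩⟩
    all_goals intro x hx
    all_goals simp only [modReg, modArr, Bool.or_eq_false_iff] at hx
    exacts [h'.2.1 x hx.1, h'.2.2 x hx.1, h'.2.1 x hx.2, h'.2.2 x hx.2]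
  | loop b P ih =>
    obtain ⟨Inv, q, hq, h0, h1, h2⟩ := h
    refine ⟨fun n s' => Inv n s' ∧ (Prog.loop b P).Frame s s', q, hq, ⟨h0, Frame.refl _ _⟩,
      fun n s' hs' => ⟨(h1 n s' hs'.1).1, wp_mono (ih (h1 n s' hs'.1).2) fun s'' h'' =>
        ⟨h''.1, hs'.2.trans h''.2⟩⟩, fun s' hs' => ⟨(h2 s' hs'.1).1, (h2 s' hs'.1).2, hs'.2⟩⟩
  | skip => exact ⟨h, Frame.refl _ _⟩
  | store a y x =>
    refine ⟨h, fun _ _ => rfl, fun b hb => ?_⟩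
    funext i
    simp_all [modArr, Store.setArr_arr]
  | _ =>
    exact ⟨h, fun y hy => by simp_all [modReg, Store.setReg_reg], fun _ _ => rfl⟩

/-- Sequential composition with the frame rule built in. -/
theorem wp_seq {G : ℝ} {Q : ℕ} {P R : Prog} {Φ Ψ : Store → Prop} {s : Store}
    (h : P.wp G Q Φ s) (hR : ∀ s', Φ s' → P.Frame s s' → R.wp G Q Ψ s') :
    (Prog.seq P R).wp G Q Ψ s := by
  change P.wp G Q (R.wp G Q _) s
  exact wp_mono (wp_frame h) fun s' h' => hR s' h'.1 h'.2

theorem abs_floor_le (x : ℝ) : |((⌊x⌋ : ℤ) : ℝ)| ≤ |x| + 1 := by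
  have h1 := Int.floor_le x
  have h2 := Int.lt_floor_add_one x
  have h3 := neg_abs_le x
  have h4 := le_abs_self x
  rw [abs_le]
  constructor <;> linarith

/-- Induction on the program. Each elementary step multiplies the size of the numbers by at most G ≥
2: sums, differences and floors at most double a bound b ≥ 1, a product has second factor at most G,
and a divisor of absolute value at least 1 does not enlarge the quotient. The stack `K` is arbitrary
so that the induction can pass through sequences and loop bodies. -/
theorem wp_sound {G : ℝ} {Q : ℕ} (hG : 2 ≤ G) {P : Prog} {Φ : Store → Prop} {s : Store}
    (hc : (P.constBound : ℝ) ≤ G) (h : P.wp G Q Φ s) (K : List Prog) :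
    ∃ n ≤ P.cost Q, ∃ s', Φ s' ∧ Path G n ⟨P :: K, s⟩ ⟨K, s'⟩ := by
  have hself : ∀ s : Store, s.Grow G s := fun s b hb hs => hs.mono (by nlinarith)
  have hset : ∀ (s : Store) x v, (∀ b, 1 ≤ b → s.Bounded b → |v| ≤ G * b) →
      s.Grow G (s.setReg x v) := fun s x v hv b hb hs =>
    (hself s b hb hs).setReg x (hv b hb hs)
  have hle : ∀ b : ℝ, 1 ≤ b → b + b ≤ G * b := fun b hb => by nlinarith
  induction P generalizing Φ s K with
  | const x c =>
    refine ⟨1, le_rfl, _, h, .single rfl (hset _ _ _ fun b hb _ => ?_)⟩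
    have : |(c : ℝ)| ≤ G := by
      refine le_trans (le_of_eq ?_) hc
      rw [constBound, Nat.cast_natAbs, Int.cast_abs]
    nlinarith
  | copy x y =>
    exact ⟨1, le_rfl, _, h, .single rfl (hset _ _ _ fun b hb hs =>
      (hs.1 y).trans (by nlinarith))⟩
  | op o x y z =>
    cases o
    · refine ⟨1, le_rfl, _, h, .single rfl (hset _ _ _ fun b hb hs => ?_)⟩
      exact (abs_add_le _ _).trans ((add_le_add (hs.1 y) (hs.1 z)).trans (hle b hb))
    · refine ⟨1, le_rfl, _, h, .single rfl (hset _ _ _ fun b hb hs => ?_)⟩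
      exact (abs_sub _ _).trans ((add_le_add (hs.1 y) (hs.1 z)).trans (hle b hb))
    · refine ⟨1, le_rfl, _, h.2, .single rfl (hset _ _ _ fun b hb hs => ?_)⟩
      rw [abs_mul, mul_comm]
      exact mul_le_mul h.1 (hs.1 y) (abs_nonneg _) (by linarith)
    · refine ⟨1, le_rfl, _, h.2, .single rfl (hset _ _ _ fun b hb hs => ?_)⟩
      rw [abs_div]
      exact (div_le_self (abs_nonneg _) h.1).trans ((hs.1 y).trans (by nlinarith))
  | floor x y =>
    refine ⟨1, le_rfl, _, h, .single rfl (hset _ _ _ fun b hb hs => ?_)⟩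
    exact (abs_floor_le _).trans ((add_le_add (hs.1 y) hb).trans (hle b hb))
  | load x a y =>
    exact ⟨1, le_rfl, _, h, .single rfl (hset _ _ _ fun b hb hs =>
      (hs.2 a _).trans (by nlinarith))⟩
  | store a y x =>
    exact ⟨1, le_rfl, _, h, .single rfl fun b hb hs =>
      (hself s b hb hs).setArr a _ ((hs.1 x).trans (by nlinarith))⟩
  | rand => exact h.elim
  | skip => exact ⟨1, le_rfl, _, h, .single rfl (hself _)⟩
  | seq P R ihP ihR =>
    simp only [constBound, Nat.cast_max, max_le_iff] at hc
    obtain ⟨n, hn, s', hs', hp⟩ := ihP hc.1 h (R :: K)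
    obtain ⟨n', hn', s'', hs'', hp'⟩ := ihR hc.2 hs' K
    refine ⟨n + n' + 1, ?_, s'', hs'', .cons rfl (hself _) (hp.trans hp')⟩
    simp only [cost]; omega
  | ite b P R ihP ihR =>
    simp only [constBound, Nat.cast_max, max_le_iff] at hc
    by_cases hb : b.Holds s
    · obtain ⟨n, hn, s', hs', hp⟩ := ihP hc.1 (h.1 hb) K
      refine ⟨n + 1, ?_, s', hs', .cons (c' := ⟨P :: K, s⟩) (by simp only [step, if_pos hb])
        (hself _) hp⟩
      simp only [cost]; omega
    · obtain ⟨n, hn, s', hs', hp⟩ := ihR hc.2 (h.2 hb) K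
      refine ⟨n + 1, ?_, s', hs', .cons (c' := ⟨R :: K, s⟩) (by simp only [step, if_neg hb])
        (hself _) hp⟩
      simp only [cost]; omega
  | loop b P ih =>
    obtain ⟨Inv, q, hq, h0, h1, h2⟩ := h
    -- The index of the invariant is the number of iterations that remain, so termination is
    -- induction on it.
    have key : ∀ q s, Inv q s → ∃ n ≤ q * (P.cost Q + 1) + 1, ∃ s', Φ s' ∧
        Path G n ⟨Prog.loop b P :: K, s⟩ ⟨K, s'⟩ := by
      intro q
      induction q with
      | zero =>
        intro s hs
        exact ⟨1, by simp, s, (h2 s hs).2, .single (by simp only [step, if_neg (h2 s hs).1])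
          (hself _)⟩
      | succ q ihq =>
        intro s hs
        obtain ⟨hb, hw⟩ := h1 q s hs
        obtain ⟨n, hn, s', hs', hp⟩ := ih hc hw (Prog.loop b P :: K)
        obtain ⟨n', hn', s'', hs'', hp'⟩ := ihq s' hs'
        refine ⟨n + n' + 1, ?_, s'', hs'', .cons (c' := ⟨P :: Prog.loop b P :: K, s⟩)
          (by simp only [step, if_pos hb]) (hself _) (hp.trans hp')⟩
        rw [Nat.succ_mul]; omega
    obtain ⟨n, hn, h⟩ := key q s h0
    refine ⟨n, hn.trans ?_, h⟩
    simp only [cost]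
    gcongr

/-- The nesting depth of loops is fixed by the program, so the cost is a polynomial in the iteration
bound `Q`. For Q ≥ 2 the constants are absorbed by raising the exponent, which leaves a pure power.
-/
theorem cost_le_pow (P : Prog) : ∃ c, ∀ Q, 2 ≤ Q → P.cost Q ≤ Q ^ c := by
  have h2 : ∀ Q c e : ℕ, 2 ≤ Q → 4 * Q ^ (max c e) ≤ Q ^ (c + e + 2) := by
    intro Q c e hQ
    rw [pow_add]
    calc 4 * Q ^ max c e ≤ Q ^ 2 * Q ^ max c e := by gcongr; nlinarith
      _ ≤ Q ^ (c + e) * Q ^ 2 := by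
        rw [mul_comm]; gcongr
        · omega
        · omega
  have hm : ∀ Q c e : ℕ, 2 ≤ Q → Q ^ c + Q ^ e + 1 ≤ Q ^ (c + e + 2) := by
    intro Q c e hQ
    have a1 : Q ^ c ≤ Q ^ (max c e) := Nat.pow_le_pow_right (by omega) (by omega)
    have a2 : Q ^ e ≤ Q ^ (max c e) := Nat.pow_le_pow_right (by omega) (by omega)
    have a3 : 1 ≤ Q ^ (max c e) := Nat.one_le_pow _ _ (by omega)
    have := h2 Q c e hQ
    omega
  induction P with
  | seq P R ihP ihR =>
    obtain ⟨c, hc⟩ := ihP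
    obtain ⟨e, he⟩ := ihR
    refine ⟨c + e + 2, fun Q hQ => le_trans ?_ (hm Q c e hQ)⟩
    have := hc Q hQ
    have := he Q hQ
    simp only [cost]; omega
  | ite b P R ihP ihR =>
    obtain ⟨c, hc⟩ := ihP
    obtain ⟨e, he⟩ := ihR
    refine ⟨c + e + 2, fun Q hQ => le_trans ?_ (hm Q c e hQ)⟩
    have := hc Q hQ
    have := he Q hQ
    simp only [cost]; omega
  | loop b P ih =>
    obtain ⟨c, hc⟩ := ih
    refine ⟨c + 3, fun Q hQ => ?_⟩
    have h1 := hc Q hQ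
    have a3 : 1 ≤ Q ^ c := Nat.one_le_pow _ _ (by omega)
    simp only [cost]
    calc Q * (P.cost Q + 1) + 1 ≤ Q * (Q ^ c + Q ^ c) + Q * Q ^ c := by
          gcongr
          nlinarith
      _ = 3 * (Q * Q ^ c) := by ring
      _ ≤ Q ^ 2 * (Q * Q ^ c) := by gcongr; nlinarith
      _ = Q ^ (c + 3) := by ring
  | _ => exact ⟨0, fun Q _ => by simp [cost]⟩

/-- `for x in 0, …, y - 1 do P`, provided that register `6` holds `1`. -/
def forLoop (x y : ℕ) (P : Prog) : Prog :=
  .seq (.const x 0) (.loop (.lt x y) (.seq P (.op .add x x 6)))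

/-- Translates the countdown of the loop rule into an invariant indexed by the counter. The frame
condition is supplied to the body and to the exit, so invariants need to mention only what the body
changes. -/
theorem wp_forLoop {G : ℝ} {Q : ℕ} {x y n : ℕ} {P : Prog} {Φ : Store → Prop} {s : Store}
    (Inv : ℕ → Store → Prop) (hy : s.reg y = (n : ℝ)) (h6 : s.reg 6 = 1) (hn : n ≤ Q)
    (hm : P.modReg x = false ∧ P.modReg y = false ∧ P.modReg 6 = false ∧ x ≠ y ∧ x ≠ 6)
    (h0 : Inv 0 (s.setReg x 0))
    (hs : ∀ i < n, ∀ s', s'.reg x = (i : ℝ) → (forLoop x y P).Frame s s' → Inv i s' →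
      P.wp G Q (fun t => Inv (i + 1) (t.setReg x ((i : ℝ) + 1))) s')
    (hΦ : ∀ s', s'.reg x = (n : ℝ) → (forLoop x y P).Frame s s' → Inv n s' → Φ s') :
    (forLoop x y P).wp G Q Φ s := by
  obtain ⟨m1, m2, m3, m4, m5⟩ := hm
  have fx : ∀ z, z ≠ x → P.modReg z = false → (forLoop x y P).modReg z = false := by
    intro z hz hz'
    simp [forLoop, modReg, hz, hz']
  refine ⟨fun r s' => r ≤ n ∧ s'.reg x = ((n - r : ℕ) : ℝ) ∧ (forLoop x y P).Frame s s' ∧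
    Inv (n - r) s', n, hn, ⟨le_rfl, ?_, ?_, ?_⟩, ?_, ?_⟩
  · simp [Store.setReg_reg]
  · refine ⟨fun z hz => ?_, fun _ _ => rfl⟩
    have : z ≠ x := by rintro rfl; simp [forLoop, modReg] at hz
    simp [Store.setReg_reg, this]
  · simpa using h0
  · rintro r s' ⟨hr, hx, hf, hi⟩
    have hlt : n - (r + 1) < n := by omega
    have hsub : n - r = n - (r + 1) + 1 := by omega
    have hy' : s'.reg y = n := by rw [hf.1 y (fx y m4.symm m2), hy]
    have h6' : s'.reg 6 = 1 := by rw [hf.1 6 (fx 6 m5.symm m3), h6]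
    refine ⟨?_, ?_⟩
    · simp only [Test.Holds, hx, hy']; exact_mod_cast hlt
    · change P.wp G Q (Prog.wp G Q (.op .add x x 6) _) s'
      refine wp_mono (wp_frame (hs _ hlt s' hx hf hi)) fun t ht => ?_
      have htx : t.reg x = ((n - (r + 1) : ℕ) : ℝ) := by rw [ht.2.1 x m1, hx]
      have ht6 : t.reg 6 = 1 := by rw [ht.2.1 6 m3, h6']
      simp only [wp, htx, ht6]
      refine ⟨by omega, ?_, ?_, ?_⟩
      · rw [hsub]; simp [Store.setReg_reg]
      · refine hf.trans ⟨fun z hz => ?_, fun a ha => ?_⟩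
        · simp only [forLoop, modReg, Bool.or_eq_false_iff, beq_eq_false_iff_ne] at hz
          simp only [Store.setReg_reg, hz.1, if_false]
          exact ht.2.1 z hz.2.1
        · simp only [forLoop, modArr, Bool.or_eq_false_iff] at ha
          exact ht.2.2 a ha.2.1
      · rw [hsub]; exact ht.1
  · rintro s' ⟨_, hx, hf, hi⟩
    have hy' : s'.reg y = n := by rw [hf.1 y (fx y m4.symm m2), hy]
    refine ⟨by simp [Test.Holds, hx, hy'], hΦ s' (by simpa using hx) hf (by simpa using hi)⟩

end Prog

/-! ### Programs that draw a single random number -/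

theorem runFrom_add (c : Config) (a b : ℕ) :
    runFrom c (a + b) = (runFrom c a).bind fun c' => runFrom c' b := by
  induction b with
  | zero => simp [runFrom]
  | succ b ih => rw [← add_assoc, runFrom, ih, PMF.bind_bind]; rfl

theorem runFrom_one (c : Config) : runFrom c 1 = step c := by simp [runFrom]

theorem runFrom_halted (s : Store) (n : ℕ) : runFrom ⟨[], s⟩ n = PMF.pure ⟨[], s⟩ := by
  induction n with
  | zero => rfl
  | succ n ih => rw [runFrom, ih, PMF.pure_bind]; rfl

/-- The intermediate configurations are included because the bound on stored numbers concerns every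
moment of a run, not just its end. -/
theorem Path.runFrom {G b : ℝ} {n : ℕ} {c c' : Config} (hG : 1 ≤ G) (h : Path G n c c')
    (hb : 1 ≤ b) (hc : c.mem.Bounded b) :
    BallCoverage.runFrom c n = PMF.pure c' ∧ c'.mem.Bounded (G ^ n * b) ∧
      ∀ k ≤ n, ∃ ck, BallCoverage.runFrom c k = PMF.pure ck ∧ ck.mem.Bounded (G ^ n * b) := by
  induction h generalizing b with
  | refl c =>
    refine ⟨rfl, by simpa using hc, fun k hk => ⟨c, ?_, by simpa using hc⟩⟩
    obtain rfl : k = 0 := by omega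
    rfl
  | @cons n c c1 c2 h hg _ ih =>
    have hb' : 1 ≤ G * b := by nlinarith
    obtain ⟨h1, h2, h3⟩ := ih hb' (hg b hb hc)
    have he : G ^ (n + 1) * b = G ^ n * (G * b) := by ring
    have hr : ∀ k, BallCoverage.runFrom c (k + 1) = BallCoverage.runFrom c1 k := by
      intro k
      rw [add_comm, runFrom_add, runFrom_one, h, PMF.pure_bind]
    rw [he]
    refine ⟨by rw [hr, h1], h2, fun k hk => ?_⟩
    cases k with
    | zero =>
      refine ⟨c, rfl, hc.mono ?_⟩
      have h4 : (1 : ℝ) ≤ G ^ n := one_le_pow₀ hG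
      nlinarith
    | succ k =>
      rw [hr]
      exact h3 k (by omega)

theorem uniformBelow_eq {M : ℕ} (hM : 0 < M) :
    ∃ _ : Nonempty (Fin M),
      uniformBelow M = (PMF.uniformOfFintype (Fin M)).map fun i : Fin M => ((i : ℕ) : ℝ) := by
  obtain ⟨n, rfl⟩ := Nat.exists_eq_succ_of_ne_zero hM.ne'
  refine ⟨inferInstance, ?_⟩
  simp only [uniformBelow]
  change ((PMF.uniformOfFintype (Fin (n + 1))).bind fun a => PMF.pure (a : ℕ)).map _ = _
  exact PMF.map_comp (fun a : Fin (n + 1) => (a : ℕ)) _ (fun i : ℕ => (i : ℝ))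

/-- A program that prepares, draws one random number below `M`, and continues without
randomness. -/
theorem runFrom_seq_rand_seq {G b q : ℝ} {Q : ℕ} (hG : 2 ≤ G) (hb : 1 ≤ b) {P R : Prog} {x y : ℕ}
    {s : Store} {Φ : Store → Prop} {Good : Store → Prop}
    (hP : (P.constBound : ℝ) ≤ G) (hR : (R.constBound : ℝ) ≤ G) (hs : s.Bounded b)
    (h : P.wp G Q Φ s)
    (hΦ : ∀ s', Φ s' → ∃ M : ℕ, 0 < M ∧ s'.reg y = (M : ℝ) ∧ ∃ Ψ : ℕ → Store → Prop,
      (∀ v < M, R.wp G Q (Ψ v) (s'.setReg x (v : ℝ))) ∧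
      ∃ V : Finset (Fin M), (∀ v ∈ V, ∀ t, Ψ v t → Good t) ∧ q * M ≤ (V.card : ℝ)) :
    ∃ n ≤ P.cost Q + R.cost Q + 3,
      (∀ c ∈ (runFrom ⟨[.seq P (.seq (.rand x y) R)], s⟩ n).support, c.todo = []) ∧
      ENNReal.ofReal q ≤ (runFrom ⟨[.seq P (.seq (.rand x y) R)], s⟩ n).toOuterMeasure
        {c | c.todo = [] ∧ Good c.mem} ∧
      ∀ n', ∀ c ∈ (runFrom ⟨[.seq P (.seq (.rand x y) R)], s⟩ n').support,
        c.mem.Bounded (G ^ (P.cost Q + R.cost Q + 3) * b) := by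
  classical
  have hG1 : 1 ≤ G := by linarith
  have hself : ∀ s : Store, s.Grow G s := fun s b hb hs => hs.mono (by nlinarith)
  obtain ⟨n1, hn1, s1, hs1, hp1⟩ := Prog.wp_sound hG hP h [.seq (.rand x y) R]
  obtain ⟨M, hM, hy, Ψ, hΨ, V, hV, hVq⟩ := hΦ s1 hs1
  obtain ⟨hne, hu⟩ := uniformBelow_eq hM
  have hp2 : Path G (n1 + 1 + 1) ⟨[.seq P (.seq (.rand x y) R)], s⟩ ⟨[.rand x y, R], s1⟩ :=
    .cons rfl (hself _) (hp1.trans (.single rfl (hself _)))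
  obtain ⟨r1, r2, r3⟩ := hp2.runFrom hG1 hb hs
  set b1 := G ^ (n1 + 1 + 1) * b with hb1
  have hb1' : 1 ≤ b1 := by
    have h4 : (1 : ℝ) ≤ G ^ (n1 + 1 + 1) := one_le_pow₀ hG1
    nlinarith
  have hw : ∀ v : Fin M, ∃ n ≤ R.cost Q, ∃ t, Ψ v t ∧
      Path G n ⟨[R], s1.setReg x ((v : ℕ) : ℝ)⟩ ⟨[], t⟩ := fun v =>
    Prog.wp_sound hG hR (hΨ v v.2) []
  choose nv hnv tv htv hpv using hw
  -- The drawn number is below `M`, which is already stored in a register, so the draw does not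
  -- raise the bound.
  have hbv : ∀ v : Fin M, (s1.setReg x ((v : ℕ) : ℝ)).Bounded b1 := fun v => by
    refine r2.setReg x ?_
    have h5 := r2.1 y
    simp only [hy] at h5
    rw [abs_of_nonneg (by positivity)] at h5 ⊢
    have : ((v : ℕ) : ℝ) ≤ M := by exact_mod_cast v.2.le
    linarith
  have hrun : ∀ j, runFrom ⟨[.seq P (.seq (.rand x y) R)], s⟩ (n1 + 1 + 1 + (1 + j)) =
      (PMF.uniformOfFintype (Fin M)).bind fun v =>
        runFrom ⟨[R], s1.setReg x ((v : ℕ) : ℝ)⟩ j := by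
    intro j
    rw [runFrom_add, r1, PMF.pure_bind, runFrom_add, runFrom_one]
    simp only [step, hy, Nat.floor_natCast, hu]
    rw [PMF.bind_map, PMF.bind_map]
    rfl
  have hend : ∀ v j, nv v ≤ j → runFrom ⟨[R], s1.setReg x ((v : ℕ) : ℝ)⟩ j =
      PMF.pure ⟨[], tv v⟩ := by
    intro v j hj
    obtain ⟨i, rfl⟩ := Nat.exists_eq_add_of_le hj
    rw [runFrom_add, ((hpv v).runFrom hG1 hb1' (hbv v)).1, PMF.pure_bind, runFrom_halted]
  -- The number of steps after the draw may depend on the outcome; since halted configurations stay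
  -- put, all outcomes can be inspected at the common time `R.cost Q`.
  have hfin : runFrom ⟨[.seq P (.seq (.rand x y) R)], s⟩ (n1 + 1 + 1 + (1 + R.cost Q)) =
      (PMF.uniformOfFintype (Fin M)).map fun v => ⟨[], tv v⟩ := by
    rw [hrun]
    refine congrArg _ (funext fun v => ?_)
    exact hend v _ (hnv v)
  have hT : ∀ j ≤ n1 + 1 + 1 + R.cost Q, G ^ j * b ≤ G ^ (P.cost Q + R.cost Q + 3) * b := by
    intro j hj
    gcongr
    omega
  -- Two steps unfold the two sequential compositions and one step draws: this is the 3 in the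
  -- bound.
  refine ⟨n1 + 1 + 1 + (1 + R.cost Q), by omega, ?_, ?_, ?_⟩
  · rw [hfin]
    intro c hc
    obtain ⟨v, -, rfl⟩ := (PMF.mem_support_map_iff _ _ _).1 hc
    rfl
  · rw [hfin, PMF.toOuterMeasure_map_apply, PMF.toOuterMeasure_uniformOfFintype_apply]
    rw [Fintype.card_fin]
    have hsub : V.card ≤ Fintype.card ((fun v => (⟨[], tv v⟩ : Config)) ⁻¹'
        {c | c.todo = [] ∧ Good c.mem} : Set (Fin M)) := by
      rw [← Fintype.card_coe V]
      refine Fintype.card_le_of_injective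
        (fun v => ⟨v.1, rfl, hV v.1 v.2 _ (htv v.1)⟩) fun v w hvw => ?_
      exact Subtype.ext (Subtype.mk.inj hvw)
    have hM' : (0 : ℝ) < M := by exact_mod_cast hM
    calc ENNReal.ofReal q ≤ ENNReal.ofReal ((V.card : ℝ) / M) :=
          ENNReal.ofReal_le_ofReal ((le_div_iff₀ hM').2 hVq)
      _ = (V.card : ENNReal) / M := by
          rw [ENNReal.ofReal_div_of_pos hM', ENNReal.ofReal_natCast, ENNReal.ofReal_natCast]
      _ ≤ _ := by
          gcongr
  · intro n' c hc
    by_cases hn' : n' ≤ n1 + 1 + 1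
    · obtain ⟨ck, hk, hk'⟩ := r3 n' hn'
      rw [hk, PMF.mem_support_pure_iff] at hc
      subst hc
      exact hk'.mono (hT _ (by omega))
    · obtain ⟨j, rfl⟩ : ∃ j, n' = n1 + 1 + 1 + (1 + j) := ⟨n' - (n1 + 1 + 1) - 1, by omega⟩
      rw [hrun, PMF.mem_support_bind_iff] at hc
      obtain ⟨v, -, hc⟩ := hc
      obtain ⟨q1, q2, q3⟩ := (hpv v).runFrom hG1 hb1' (hbv v)
      have hle : G ^ nv v * b1 ≤ G ^ (P.cost Q + R.cost Q + 3) * b := by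
        rw [hb1, ← mul_assoc, ← pow_add]
        exact hT _ (by have := hnv v; omega)
      by_cases hj : j ≤ nv v
      · obtain ⟨ck, hk, hk'⟩ := q3 j hj
        rw [hk, PMF.mem_support_pure_iff] at hc
        subst hc
        exact hk'.mono hle
      · rw [hend v j (by omega), PMF.mem_support_pure_iff] at hc
        subst hc
        exact q2.mono hle

/-! ### Counting vectors by a key, and ranking them -/

open Finset in
-- The intervals of lengths v 0, v 1, … laid end to end are disjoint, so a number determines its
-- interval and its offset there. Every level of the ranking is of this form.
theorem sum_range_add_inj {v : ℕ → ℕ} {a b x y : ℕ} (hx : x < v a) (hy : y < v b)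
    (h : ∑ i ∈ range a, v i + x = ∑ i ∈ range b, v i + y) : a = b ∧ x = y := by
  have key : ∀ {a b x y : ℕ}, x < v a →
      ∑ i ∈ range a, v i + x = ∑ i ∈ range b, v i + y → ¬ a < b := by
    intro a b x y hx h hab
    have h1 : ∑ i ∈ range (a + 1), v i ≤ ∑ i ∈ range b, v i :=
      sum_le_sum_of_subset (range_mono hab)
    rw [sum_range_succ] at h1
    omega
  have hab : a = b := by
    have := key hx h
    have := key hy h.symm
    omega
  subst hab
  exact ⟨rfl, by omega⟩

open Finset in
theorem exists_sum_range_add {v : ℕ → ℕ} {n R : ℕ} (h : R < ∑ i ∈ range n, v i) :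
    ∃ a < n, ∃ x < v a, R = ∑ i ∈ range a, v i + x := by
  induction n with
  | zero => simp at h
  | succ n ih =>
    by_cases h' : R < ∑ i ∈ range n, v i
    · obtain ⟨a, ha, h⟩ := ih h'
      exact ⟨a, by omega, h⟩
    · rw [sum_range_succ] at h
      exact ⟨n, by omega, R - ∑ i ∈ range n, v i, by omega, by omega⟩

section Rank

variable (C s : ℕ) (κ : ℕ → ℕ → ℕ)

/-- The number of vectors of length `t` with entries in `[0, C) × [0, s)` whose first components
have total key `x`. -/
def cnt : ℕ → ℕ → ℕ
  | 0, x => if x = 0 then 1 else 0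
  | t + 1, x => ∑ c ∈ Finset.range C, if κ t c ≤ x then s * cnt t (x - κ t c) else 0

/-- The part of `cnt (t + 1) x` that is due to vectors with last entry in `{c} × [0, s)`. -/
def wt (t x c : ℕ) : ℕ :=
  if κ t c ≤ x then s * cnt C s κ t (x - κ t c) else 0

/-- The key of a vector. -/
def key (c : ℕ → ℕ) (t : ℕ) : ℕ := ∑ i ∈ Finset.range t, κ i (c i)

/-- The rank of a vector among those of the same length and key. -/
def enc (c u : ℕ → ℕ) : ℕ → ℕ
  | 0 => 0
  | t + 1 => ∑ c' ∈ Finset.range (c t), wt C s κ t (key κ c (t + 1)) c' +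
      (u t * cnt C s κ t (key κ c t) + enc c u t)

variable {C s κ}

theorem cnt_succ (t x : ℕ) : cnt C s κ (t + 1) x = ∑ c ∈ Finset.range C, wt C s κ t x c := rfl

theorem key_succ (c : ℕ → ℕ) (t : ℕ) : key κ c (t + 1) = key κ c t + κ t (c t) :=
  Finset.sum_range_succ _ _

theorem wt_key_succ (c : ℕ → ℕ) (t : ℕ) :
    wt C s κ t (key κ c (t + 1)) (c t) = s * cnt C s κ t (key κ c t) := by
  rw [wt, key_succ, if_pos (by omega), Nat.add_sub_cancel]

theorem mul_add_lt_mul {a b u s : ℕ} (h : a < b) (hu : u < s) : u * b + a < s * b :=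
  calc u * b + a < (u + 1) * b := by rw [Nat.succ_mul]; omega
    _ ≤ s * b := Nat.mul_le_mul_right _ hu

theorem sum_range_add_lt {v : ℕ → ℕ} {a n x : ℕ} (ha : a < n) (hx : x < v a) :
    ∑ i ∈ Finset.range a, v i + x < ∑ i ∈ Finset.range n, v i := by
  have h1 : ∑ i ∈ Finset.range (a + 1), v i ≤ ∑ i ∈ Finset.range n, v i :=
    Finset.sum_le_sum_of_subset (Finset.range_mono ha)
  rw [Finset.sum_range_succ] at h1
  omega

theorem enc_lt {c u : ℕ → ℕ} {t : ℕ} (h : ∀ i < t, c i < C ∧ u i < s) :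
    enc C s κ c u t < cnt C s κ t (key κ c t) := by
  induction t with
  | zero => simp [enc, cnt, key]
  | succ t ih =>
    rw [enc, cnt_succ]
    refine sum_range_add_lt (h t (by omega)).1 ?_
    rw [wt_key_succ]
    exact mul_add_lt_mul (ih fun i hi => h i (by omega)) (h t (by omega)).2

theorem enc_succ_lt {c u : ℕ → ℕ} {t : ℕ} (h : ∀ i < t + 1, c i < C ∧ u i < s) :
    u t * cnt C s κ t (key κ c t) + enc C s κ c u t <
      wt C s κ t (key κ c (t + 1)) (c t) := by
  rw [wt_key_succ]
  exact mul_add_lt_mul (enc_lt fun i hi => h i (by omega)) (h t (by omega)).2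

/-- The rank is read from the last entry downwards: the interval in which it lies gives `c t`, the
quotient of the offset by the count of shorter vectors gives `u t`, and the remainder is the rank of
the truncated vector, to which induction applies. -/
theorem enc_inj {c u c' u' : ℕ → ℕ} {t : ℕ} (h : ∀ i < t, c i < C ∧ u i < s)
    (h' : ∀ i < t, c' i < C ∧ u' i < s) (hk : key κ c t = key κ c' t)
    (he : enc C s κ c u t = enc C s κ c' u' t) : ∀ i < t, c i = c' i ∧ u i = u' i := by
  induction t with
  | zero => simp
  | succ t ih =>
    have h1 := enc_succ_lt (κ := κ) h
    have h2 := enc_succ_lt (κ := κ) h'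
    rw [enc, enc, hk] at he
    rw [hk] at h1
    obtain ⟨hc, he⟩ := sum_range_add_inj h1 h2 he
    have hk' : key κ c t = key κ c' t := by
      rw [key_succ, key_succ, hc] at hk
      omega
    have e1 := enc_lt (κ := κ) fun i (hi : i < t) => h i (by omega)
    have e2 := enc_lt (κ := κ) fun i (hi : i < t) => h' i (by omega)
    rw [hk'] at e1 he
    have hpos : 0 < cnt C s κ t (key κ c' t) := by omega
    have hdiv := congrArg (· / cnt C s κ t (key κ c' t)) he
    have hmod := congrArg (· % cnt C s κ t (key κ c' t)) he
    simp only [Nat.mul_comm _ (cnt C s κ t (key κ c' t)), Nat.mul_add_div hpos,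
      Nat.div_eq_of_lt e1, Nat.div_eq_of_lt e2, Nat.mul_add_mod, Nat.mod_eq_of_lt e1,
      Nat.mod_eq_of_lt e2, add_zero] at hdiv hmod
    intro i hi
    rcases Nat.lt_succ_iff_lt_or_eq.1 hi with hi | rfl
    · exact ih (fun i hi => h i (by omega)) (fun i hi => h' i (by omega)) hk' hmod i hi
    · exact ⟨hc, hdiv⟩

theorem key_congr {c c' : ℕ → ℕ} {t : ℕ} (h : ∀ i < t, c i = c' i) : key κ c t = key κ c' t :=
  Finset.sum_congr rfl fun i hi => by rw [h i (Finset.mem_range.1 hi)]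

theorem enc_congr {c u c' u' : ℕ → ℕ} {t : ℕ} (h : ∀ i < t, c i = c' i ∧ u i = u' i) :
    enc C s κ c u t = enc C s κ c' u' t := by
  induction t with
  | zero => rfl
  | succ t ih =>
    rw [enc, enc, ih fun i hi => h i (by omega), key_congr fun i hi => (h i hi).1,
      key_congr fun i (hi : i < t) => (h i (by omega)).1, (h t (by omega)).1, (h t (by omega)).2]

/-- The same decoding as in `enc_inj`, run as a construction: interval, quotient and remainder
produce the last entry and a smaller rank. It is also what `stepProg` computes. -/
theorem enc_surj {t x R : ℕ} (h : R < cnt C s κ t x) :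
    ∃ c u : ℕ → ℕ, (∀ i < t, c i < C ∧ u i < s) ∧ key κ c t = x ∧ enc C s κ c u t = R := by
  induction t generalizing x R with
  | zero =>
    refine ⟨fun _ => 0, fun _ => 0, by simp, ?_⟩
    rw [cnt] at h
    split_ifs at h with hx
    · exact ⟨by simp [key, hx], by rw [enc]; omega⟩
    · simp at h
  | succ t ih =>
    rw [cnt_succ] at h
    obtain ⟨a, ha, y, hy, rfl⟩ := exists_sum_range_add h
    have hy0 := hy
    rw [wt] at hy
    split_ifs at hy with hx
    swap
    · simp at hy
    -- An offset below the product forces the count to be nonzero, so the division is legitimate.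
    have hpos : 0 < cnt C s κ t (x - κ t a) := by
      rcases Nat.eq_zero_or_pos (cnt C s κ t (x - κ t a)) with h0 | h0
      · simp [h0] at hy
      · exact h0
    obtain ⟨c, u, h1, h2, h3⟩ := ih (Nat.mod_lt y hpos)
    have e1 : ∀ i < t, Function.update c t a i = c i := fun i hi => by
      rw [Function.update_of_ne (by omega)]
    have e2 : ∀ i < t, Function.update u t (y / cnt C s κ t (x - κ t a)) i = u i :=
      fun i hi => by rw [Function.update_of_ne (by omega)]
    have e3 : key κ (Function.update c t a) (t + 1) = x := by
      rw [key_succ, key_congr e1, Function.update_self]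
      omega
    refine ⟨Function.update c t a, Function.update u t (y / cnt C s κ t (x - κ t a)),
      fun i hi => ?_, e3, ?_⟩
    · rcases Nat.lt_succ_iff_lt_or_eq.1 hi with hi | rfl
      · rw [e1 i hi, e2 i hi]
        exact h1 i hi
      · rw [Function.update_self, Function.update_self]
        exact ⟨ha, Nat.div_lt_of_lt_mul (by rwa [Nat.mul_comm])⟩
    · rw [enc, e3, enc_congr fun i hi => ⟨e1 i hi, e2 i hi⟩, h3, key_congr e1, h2,
        Function.update_self, Function.update_self, Nat.mul_comm, Nat.div_add_mod]

/-- All the `cnt`s are at most the number of vectors. -/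
theorem cnt_le (t x : ℕ) : cnt C s κ t x ≤ (C * s) ^ t := by
  induction t generalizing x with
  | zero => rw [cnt]; split_ifs <;> simp
  | succ t ih =>
    rw [cnt_succ]
    calc _ ≤ ∑ _c ∈ Finset.range C, s * (C * s) ^ t := by
          refine Finset.sum_le_sum fun c _ => ?_
          rw [wt]
          split_ifs
          · exact Nat.mul_le_mul_left _ (ih _)
          · simp
      _ = _ := by simp only [Finset.sum_const, Finset.card_range, smul_eq_mul]; ring

variable (C s κ)

open Classical in
/-- The number of vectors with key `x`, if `x` is acceptable. -/
def topWt (d : ℕ) (acc : ℕ → Prop) (x : ℕ) : ℕ := if acc x then cnt C s κ d x else 0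

/-- The number of vectors with an acceptable key below `X`. -/
def total (d X : ℕ) (acc : ℕ → Prop) : ℕ := ∑ x ∈ Finset.range X, topWt C s κ d acc x

/-- The rank of a vector among all those with an acceptable key. -/
def rank (d : ℕ) (acc : ℕ → Prop) (c u : ℕ → ℕ) : ℕ :=
  ∑ x ∈ Finset.range (key κ c d), topWt C s κ d acc x + enc C s κ c u d

/-- The vectors that are counted by `total`. -/
structure Adm (d X : ℕ) (acc : ℕ → Prop) (c u : ℕ → ℕ) : Prop where
  lt : ∀ i < d, c i < C ∧ u i < s
  key_lt : key κ c d < X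
  acc : acc (key κ c d)

variable {C s κ}
variable {d X : ℕ} {acc : ℕ → Prop}

theorem Adm.enc_lt_topWt {c u : ℕ → ℕ} (h : Adm C s κ d X acc c u) :
    enc C s κ c u d < topWt C s κ d acc (key κ c d) := by
  rw [topWt, if_pos h.acc]
  exact enc_lt h.lt

theorem Adm.rank_lt {c u : ℕ → ℕ} (h : Adm C s κ d X acc c u) :
    rank C s κ d acc c u < total C s κ d X acc :=
  sum_range_add_lt h.key_lt h.enc_lt_topWt

theorem rank_inj {c u c' u' : ℕ → ℕ} (h : Adm C s κ d X acc c u) (h' : Adm C s κ d X acc c' u')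
    (he : rank C s κ d acc c u = rank C s κ d acc c' u') : ∀ i < d, c i = c' i ∧ u i = u' i := by
  obtain ⟨h1, h2⟩ := sum_range_add_inj h.enc_lt_topWt h'.enc_lt_topWt he
  exact enc_inj h.lt h'.lt h1 h2

theorem rank_congr {c u c' u' : ℕ → ℕ} (h : ∀ i < d, c i = c' i ∧ u i = u' i) :
    rank C s κ d acc c u = rank C s κ d acc c' u' := by
  rw [rank, rank, enc_congr h, key_congr fun i hi => (h i hi).1]

theorem exists_rank_eq {R : ℕ} (h : R < total C s κ d X acc) :
    ∃ c u, Adm C s κ d X acc c u ∧ rank C s κ d acc c u = R := by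
  obtain ⟨x, hx, y, hy, rfl⟩ := exists_sum_range_add h
  rw [topWt] at hy
  split_ifs at hy with ha
  · obtain ⟨c, u, h1, rfl, rfl⟩ := enc_surj hy
    exact ⟨c, u, ⟨h1, hx, ha⟩, rfl⟩
  · simp at hy

theorem total_le : total C s κ d X acc ≤ X * (C * s) ^ d := by
  rw [total]
  calc _ ≤ ∑ _x ∈ Finset.range X, (C * s) ^ d := by
        refine Finset.sum_le_sum fun x _ => ?_
        rw [topWt]
        split_ifs
        · exact cnt_le _ _
        · simp
    _ = _ := by simp

end Rank

/-! ### Comparing the numbers of lattice points of concentric balls -/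

section Volume

open MeasureTheory

variable {d : ℕ}

/-- The point of Euclidean space with the given integer coordinates. -/
def latticePoint (y : Fin d → ℤ) : EuclideanSpace ℝ (Fin d) := WithLp.toLp 2 fun i => (y i : ℝ)

theorem mem_latticeBall {p : EuclideanSpace ℝ (Fin d)} {r : ℝ} {y : Fin d → ℤ} :
    y ∈ latticeBall p r ↔ dist (latticePoint y) p ≤ r := Iff.rfl

theorem mem_latticeBall_iff_sum {p : EuclideanSpace ℝ (Fin d)} {r : ℝ} (hr : 0 ≤ r)
    {y : Fin d → ℤ} : y ∈ latticeBall p r ↔ ∑ i, ((y i : ℝ) - p i) ^ 2 ≤ r ^ 2 := by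
  rw [mem_latticeBall, EuclideanSpace.dist_eq, Real.sqrt_le_left hr]
  simp [latticePoint, Real.dist_eq, sq_abs]

/-- The crude factor d instead of √d allows the derived constants `E` and `F` to be natural numbers.
-/
theorem norm_le_mul_of_abs_le {v : EuclideanSpace ℝ (Fin d)} {b : ℝ} (hb : 0 ≤ b)
    (h : ∀ i, |v i| ≤ b) : ‖v‖ ≤ d * b := by
  rw [EuclideanSpace.norm_eq, Real.sqrt_le_left (by positivity)]
  rcases Nat.eq_zero_or_pos d with rfl | hd
  · simp
  calc ∑ i, ‖v i‖ ^ 2 ≤ ∑ _i : Fin d, b ^ 2 :=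
        Finset.sum_le_sum fun i _ => pow_le_pow_left₀ (norm_nonneg _) (h i) 2
    _ = d * b ^ 2 := by simp
    _ ≤ (d * b) ^ 2 := by
        have : (1 : ℝ) ≤ d := by exact_mod_cast hd
        rw [mul_pow]
        gcongr
        nlinarith

theorem sq_norm_latticePoint (z : Fin d → ℤ) :
    ‖latticePoint z‖ ^ 2 = ∑ t, (z t : ℝ) ^ 2 := by
  rw [EuclideanSpace.norm_eq, Real.sq_sqrt (Finset.sum_nonneg fun _ _ => by positivity)]
  simp [latticePoint]

theorem abs_apply_le_norm (z : Fin d → ℤ) (t : Fin d) :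
    |(z t : ℝ)| ≤ ‖latticePoint z‖ := by
  have := PiLp.norm_apply_le (latticePoint z) t
  simpa [latticePoint] using this

/-- The half-open unit cube above a lattice point. -/
def unitCube (y : Fin d → ℤ) : Set (EuclideanSpace ℝ (Fin d)) := {x | ∀ i, ⌊x i⌋ = y i}

theorem dist_le_of_mem_unitCube {y : Fin d → ℤ} {x : EuclideanSpace ℝ (Fin d)}
    (h : x ∈ unitCube y) : dist x (latticePoint y) ≤ d := by
  rw [dist_eq_norm]
  refine (norm_le_mul_of_abs_le zero_le_one fun i => ?_).trans (by simp)
  have h1 := Int.floor_le (x i)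
  have h2 := Int.lt_floor_add_one (x i)
  rw [h i] at h1 h2
  simp only [PiLp.sub_apply, latticePoint]
  rw [abs_le]
  constructor <;> linarith

theorem measurableSet_unitCube (y : Fin d → ℤ) : MeasurableSet (unitCube y) := by
  have : unitCube y = ⋂ i, (fun x : EuclideanSpace ℝ (Fin d) => ⌊x i⌋) ⁻¹' {y i} := by
    ext x; simp [unitCube]
  rw [this]
  refine MeasurableSet.iInter fun i => ?_
  have hm : Measurable fun x : EuclideanSpace ℝ (Fin d) => x i := by fun_prop
  exact (Int.measurable_floor.comp hm) (measurableSet_singleton _)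

theorem volume_unitCube_eq (y : Fin d → ℤ) :
    volume (unitCube y) = volume (unitCube (0 : Fin d → ℤ)) := by
  have : unitCube (0 : Fin d → ℤ) = (fun x => x + latticePoint y) ⁻¹' unitCube y := by
    ext x
    simp [unitCube, latticePoint]
  rw [this, measure_preimage_add_right]

theorem volume_unitCube_ne_top : volume (unitCube (0 : Fin d → ℤ)) ≠ ⊤ := by
  refine ((measure_mono (t := Metric.closedBall (latticePoint 0) d) fun x hx => ?_).trans_lt
    measure_closedBall_lt_top).ne
  exact dist_le_of_mem_unitCube hx

/-- Countably many translates cover the space, so they cannot all be null. The exact volume is never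
needed: it cancels from the comparison of two balls. -/
theorem volume_unitCube_ne_zero : volume (unitCube (0 : Fin d → ℤ)) ≠ 0 := by
  have hsub : (Set.univ : Set (EuclideanSpace ℝ (Fin d))) ⊆ ⋃ y : Fin d → ℤ, unitCube y :=
    fun x _ => Set.mem_iUnion.2 ⟨fun i => ⌊x i⌋, fun i => rfl⟩
  intro h0
  have h1 : volume (⋃ y : Fin d → ℤ, unitCube y) = 0 :=
    measure_iUnion_null fun y => by rw [volume_unitCube_eq, h0]
  have h2 := measure_mono_null hsub h1
  exact NeZero.ne (volume : Measure (EuclideanSpace ℝ (Fin d))) (Measure.measure_univ_eq_zero.1 h2)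

theorem disjoint_unitCube {y y' : Fin d → ℤ} (h : y ≠ y') :
    Disjoint (unitCube y) (unitCube y') := by
  rw [Set.disjoint_left]
  intro x hx hx'
  exact h (funext fun i => (hx i).symm.trans (hx' i))

theorem volume_iUnion_unitCube (p : EuclideanSpace ℝ (Fin d)) (r : ℝ) :
    volume (⋃ y ∈ (latticeBall_finite p r).toFinset, unitCube y) =
      (latticeBall p r).ncard * volume (unitCube (0 : Fin d → ℤ)) := by
  rw [measure_biUnion_finset (fun y _ y' _ h => disjoint_unitCube h)
    fun y _ => measurableSet_unitCube y]
  simp only [volume_unitCube_eq, Finset.sum_const, nsmul_eq_mul]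
  rw [Set.ncard_eq_toFinset_card _ (latticeBall_finite p r)]

/-- A unit cube has diameter at most d. Hence the disjoint cubes above the lattice points of the
R-ball lie in the ball of radius R + d, while the cubes above those of the r-ball cover the ball of
radius r - d. Volumes of balls scale with the d-th power of the radius, and the volumes of the unit
ball and of the cube drop out. -/
theorem ncard_latticeBall_mul_le (p : EuclideanSpace ℝ (Fin d)) {R r : ℝ} (hR : 0 ≤ R)
    (hr : (d : ℝ) ≤ r) :
    ((latticeBall p R).ncard : ℝ) * (r - d) ^ d ≤ (R + d) ^ d * (latticeBall p r).ncard := by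
  have h1 : ((latticeBall p R).ncard : ENNReal) * volume (unitCube (0 : Fin d → ℤ)) ≤
      volume (Metric.closedBall p (R + d)) := by
    rw [← volume_iUnion_unitCube]
    refine measure_mono fun x hx => ?_
    simp only [Set.Finite.mem_toFinset, Set.mem_iUnion, exists_prop] at hx
    obtain ⟨y, hy, hx⟩ := hx
    have := dist_triangle x (latticePoint y) p
    have h2 := dist_le_of_mem_unitCube hx
    rw [mem_latticeBall] at hy
    rw [Metric.mem_closedBall]
    linarith
  have h2 : volume (Metric.closedBall p (r - d)) ≤
      ((latticeBall p r).ncard : ENNReal) * volume (unitCube (0 : Fin d → ℤ)) := by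
    rw [← volume_iUnion_unitCube]
    refine measure_mono fun x hx => ?_
    simp only [Set.Finite.mem_toFinset, Set.mem_iUnion, exists_prop]
    have hx' : x ∈ unitCube fun i => ⌊x i⌋ := fun i => rfl
    refine ⟨_, ?_, hx'⟩
    have := dist_triangle (latticePoint fun i => ⌊x i⌋) x p
    have h2 := dist_le_of_mem_unitCube hx'
    rw [Metric.mem_closedBall] at hx
    rw [dist_comm] at h2
    rw [mem_latticeBall]
    linarith
  rw [Measure.addHaar_closedBall' _ _ (by positivity), finrank_euclideanSpace_fin] at h1
  rw [Measure.addHaar_closedBall' _ _ (by linarith), finrank_euclideanSpace_fin] at h2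
  set v := volume (unitCube (0 : Fin d → ℤ)) with hv
  set B := volume (Metric.closedBall (0 : EuclideanSpace ℝ (Fin d)) 1)
  have hvt : v ≠ ⊤ := volume_unitCube_ne_top
  have hv0 : v ≠ 0 := volume_unitCube_ne_zero
  have hrd : 0 ≤ (r - d) ^ d := pow_nonneg (by linarith) _
  have hRd : 0 ≤ (R + d) ^ d := by positivity
  have h3 : ((latticeBall p R).ncard : ENNReal) * v * ENNReal.ofReal ((r - d) ^ d) ≤
      ENNReal.ofReal ((R + d) ^ d) * (((latticeBall p r).ncard : ENNReal) * v) := by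
    calc _ ≤ ENNReal.ofReal ((R + d) ^ d) * B * ENNReal.ofReal ((r - d) ^ d) := by gcongr
      _ = ENNReal.ofReal ((R + d) ^ d) * (ENNReal.ofReal ((r - d) ^ d) * B) := by ring
      _ ≤ _ := by gcongr
  have h4 : ((latticeBall p R).ncard : ENNReal) * ENNReal.ofReal ((r - d) ^ d) ≤
      ENNReal.ofReal ((R + d) ^ d) * ((latticeBall p r).ncard : ENNReal) := by
    refine (ENNReal.mul_le_mul_iff_left hv0 hvt).1 ?_
    calc _ = ((latticeBall p R).ncard : ENNReal) * v * ENNReal.ofReal ((r - d) ^ d) := by ring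
      _ ≤ _ := h3
      _ = _ := by ring
  rw [← ENNReal.ofReal_natCast, ← ENNReal.ofReal_natCast, ← ENNReal.ofReal_mul (by positivity),
    ← ENNReal.ofReal_mul hRd] at h4
  exact (ENNReal.ofReal_le_ofReal_iff (by positivity)).1 h4

end Volume

/-! ### The sampled supersets of the lattice balls -/

namespace Input

variable (I : Input)

/-- A bound for the absolute value of the multiples of `lam` in the coordinates. -/
def L : ℕ := ⌊I.l * I.l⌋₊
/-- A bound for `|lam|`. -/
def Lam : ℕ := ⌊I.lam * I.lam⌋₊ + 1
/-- The rounding error, relative to the scale. -/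
def E : ℕ := I.d * (1 + I.L * I.Lam)
/-- The radius from which on a ball is rescaled. -/
def F : ℕ := 8 * (I.d * I.E)
/-- A bound for the rescaled coordinates. -/
def Z : ℕ := 3 * I.F
/-- The number of rescaled coordinates. -/
def C : ℕ := 2 * I.Z + 1
/-- The base of the keys. -/
def W : ℕ := I.d * I.Z ^ 2 + 1
/-- The offset that makes keys nonnegative. -/
def O : ℕ := I.Z * I.L
/-- A bound for the keys. -/
def X : ℕ := I.d * (I.Z ^ 2 + 2 * I.W * I.O) + 1

/-- Coordinates of centers, in the order in which they are given. -/
def p (e : ℕ) : ℝ := I.store.arr 1 e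
/-- Radii, in the order in which they are given. -/
def r (i : ℕ) : ℝ := I.store.arr 0 i

variable {I}

theorem coord_div_mod {d i t : ℕ} (ht : t < d) : (i * d + t) / d = i ∧ (i * d + t) % d = t := by
  constructor
  · rw [mul_comm, Nat.mul_add_div (by omega), Nat.div_eq_of_lt ht, add_zero]
  · rw [mul_comm, Nat.mul_add_mod, Nat.mod_eq_of_lt ht]

theorem p_eq (i : Fin I.m) (t : Fin I.d) : I.p (i * I.d + t) = I.center i t := by
  obtain ⟨h1, h2⟩ := coord_div_mod (i := i) t.2
  simp only [p, store]
  simp [h1, h2]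

theorem r_eq (i : Fin I.m) : I.r i = I.radius i := by
  simp [r, store]

variable (I) in
/-- A decomposition of the coordinates of the centers. -/
structure Coords (a j : ℕ → ℤ) : Prop where
  abs_le : ∀ e < I.m * I.d, |j e| ≤ I.L
  eq : ∀ e < I.m * I.d, I.p e = a e + j e * I.lam

theorem idx_lt (i : Fin I.m) {t : ℕ} (ht : t < I.d) : (i : ℕ) * I.d + t < I.m * I.d :=
  calc (i : ℕ) * I.d + t < (i + 1) * I.d := by rw [Nat.succ_mul]; omega
    _ ≤ I.m * I.d := Nat.mul_le_mul_right _ i.2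

/-- The square is used since the machine obtains it with one multiplication; |λ| ≤ max(1, λ²). -/
theorem abs_lam_le : |I.lam| ≤ I.Lam := by
  have h := Nat.lt_floor_add_one (I.lam * I.lam)
  rw [Lam]
  push_cast
  have h2 : |I.lam| * |I.lam| = I.lam * I.lam := abs_mul_abs_self _
  nlinarith [abs_nonneg I.lam, sq_nonneg (|I.lam| - 1)]

/-- Integers satisfy |j| ≤ j², so the floor of l² is a bound that is computable in two operations.
-/
theorem abs_le_L {j : ℤ} (h1 : -I.l ≤ j) (h2 : (j : ℝ) ≤ I.l) : |j| ≤ I.L := by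
  have h3 : |(j : ℝ)| ≤ I.l := abs_le.2 ⟨by linarith, h2⟩
  have h4 : ((j.natAbs * j.natAbs : ℕ) : ℝ) ≤ I.l * I.l := by
    push_cast
    rw [Nat.cast_natAbs, Int.cast_abs]
    exact mul_le_mul h3 h3 (abs_nonneg _) ((abs_nonneg _).trans h3)
  have h5 : j.natAbs * j.natAbs ≤ I.L := Nat.le_floor h4
  have h6 : j.natAbs ≤ j.natAbs * j.natAbs := Nat.le_mul_self _
  rw [Int.abs_eq_natAbs]
  exact_mod_cast h6.trans h5

theorem E_pos (hd : 0 < I.d) : 0 < I.E := Nat.mul_pos hd (by omega)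

theorem d_le_E : I.d ≤ I.E := Nat.le_mul_of_pos_right _ (by omega)

theorem E_le_F (hd : 0 < I.d) : I.E ≤ I.F := by
  rw [F]
  nlinarith [Nat.le_mul_of_pos_left I.E hd]

theorem F_pos (hd : 0 < I.d) : 0 < I.F := (E_pos hd).trans_le (E_le_F hd)

variable (I) in
/-- The scale of a ball. -/
def scale (i : ℕ) : ℕ := if I.r i < I.F then 1 else ⌊I.r i / I.F⌋₊

variable (I) in
/-- The linear part of the condition on keys. -/
def slope (i : ℕ) : ℝ := if I.r i < I.F then I.lam + I.lam else 0

variable (I) in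
/-- The constant part of the condition on keys. -/
def thresh (j : ℕ → ℤ) (i : ℕ) : ℝ :=
  if I.r i < I.F then I.r i * I.r i -
    (∑ t ∈ Finset.range I.d, (j (i * I.d + t) : ℝ) * j (i * I.d + t)) * I.lam * I.lam
  else (I.r i / I.scale i + I.E) * (I.r i / I.scale i + I.E)

variable (I) in
/-- The contribution of a coordinate to the key. -/
def coordKey (j : ℕ → ℤ) (e c : ℕ) : ℕ :=
  (((c : ℤ) - I.Z) * ((c : ℤ) - I.Z) + (((c : ℤ) - I.Z) * j e + I.O) * I.W).toNat

variable (I) in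
/-- The contribution of a coordinate of ball `i` to the key. -/
def ballKey (j : ℕ → ℤ) (i t c : ℕ) : ℕ := I.coordKey j (i * I.d + t) c

variable (I) in
/-- The condition on keys. -/
def acc (j : ℕ → ℤ) (i x : ℕ) : Prop :=
  ((x % I.W : ℕ) : ℝ) ≤ I.thresh j i + (((x / I.W : ℕ) : ℝ) - I.d * I.O) * I.slope i

variable (I) in
/-- The point with the given rescaled coordinates. -/
def point (a : ℕ → ℤ) (i : ℕ) (c u : ℕ → ℕ) (t : ℕ) : ℤ :=
  ((c t : ℤ) - I.Z) * I.scale i + u t + a (i * I.d + t)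

theorem one_le_scale (i : ℕ) (hd : 0 < I.d) : 1 ≤ I.scale i := by
  rw [scale]
  split_ifs with h
  · exact le_rfl
  · have := F_pos hd
    refine Nat.le_floor ?_
    rw [Nat.cast_one, one_le_div (by exact_mod_cast this)]
    exact not_lt.1 h

/-! ### Keys as pairs of integers -/

section Key

variable {a j : ℕ → ℤ} (h : I.Coords a j)
include h

theorem coordKey_cast {e c : ℕ} (he : e < I.m * I.d) (hc : c < I.C) :
    (I.coordKey j e c : ℤ) =
      ((c : ℤ) - I.Z) * ((c : ℤ) - I.Z) + (((c : ℤ) - I.Z) * j e + I.O) * I.W := by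
  refine Int.toNat_of_nonneg ?_
  have h1 := h.abs_le e he
  have h2 : |(c : ℤ) - I.Z| ≤ I.Z := by rw [C] at hc; rw [abs_le]; constructor <;> omega
  have h3 : |((c : ℤ) - I.Z) * j e| ≤ I.O := by
    rw [abs_mul, O]; push_cast
    exact mul_le_mul h2 h1 (abs_nonneg _) (by positivity)
  have h4 := neg_abs_le (((c : ℤ) - I.Z) * j e)
  have h5 : (0 : ℤ) ≤ I.W := by positivity
  have h6 : 0 ≤ (((c : ℤ) - I.Z) * j e + I.O) * I.W := mul_nonneg (by linarith) h5
  nlinarith [mul_self_nonneg ((c : ℤ) - I.Z)]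

/-- The key is N + (M + d O) W with N = Σ z² and M = Σ z j. Since 0 ≤ N ≤ d Z² < W, remainder and
quotient by W recover N and M; the offset O = Z L per coordinate dominates |z j| and keeps
everything nonnegative. -/
theorem key_props (i : Fin I.m) {c : ℕ → ℕ} (hc : ∀ t < I.d, c t < I.C) :
    ((key (I.ballKey j i) c I.d % I.W : ℕ) : ℤ) =
      ∑ t ∈ Finset.range I.d, ((c t : ℤ) - I.Z) ^ 2 ∧
    ((key (I.ballKey j i) c I.d / I.W : ℕ) : ℤ) - I.d * I.O =
      ∑ t ∈ Finset.range I.d, ((c t : ℤ) - I.Z) * j (i * I.d + t) ∧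
    key (I.ballKey j i) c I.d < I.X := by
  have e1 : (key (I.ballKey j i) c I.d : ℤ) =
      ∑ t ∈ Finset.range I.d, ((c t : ℤ) - I.Z) ^ 2 +
        (∑ t ∈ Finset.range I.d, ((c t : ℤ) - I.Z) * j (i * I.d + t) + I.d * I.O) * I.W := by
    rw [key]; push_cast
    have : (I.d : ℤ) * I.O = ∑ _t ∈ Finset.range I.d, (I.O : ℤ) := by simp
    rw [this, ← Finset.sum_add_distrib, Finset.sum_mul, ← Finset.sum_add_distrib]
    refine Finset.sum_congr rfl fun t ht => ?_
    have ht := Finset.mem_range.1 ht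
    rw [ballKey, coordKey_cast h (idx_lt i ht) (hc t ht)]
    ring
  have hz : ∀ t < I.d, |(c t : ℤ) - I.Z| ≤ I.Z := fun t ht => by
    have := hc t ht
    rw [C] at this; rw [abs_le]; constructor <;> omega
  have hzj : ∀ t < I.d, |((c t : ℤ) - I.Z) * j (i * I.d + t)| ≤ I.O := fun t ht => by
    rw [abs_mul, O]; push_cast
    exact mul_le_mul (hz t ht) (h.abs_le _ (idx_lt i ht)) (abs_nonneg _) (by positivity)
  have n1 : 0 ≤ ∑ t ∈ Finset.range I.d, ((c t : ℤ) - I.Z) ^ 2 :=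
    Finset.sum_nonneg fun t _ => sq_nonneg _
  have n2 : ∑ t ∈ Finset.range I.d, ((c t : ℤ) - I.Z) ^ 2 ≤ I.d * (I.Z : ℤ) ^ 2 := by
    calc _ ≤ ∑ _t ∈ Finset.range I.d, (I.Z : ℤ) ^ 2 := Finset.sum_le_sum fun t ht => by
          rw [← sq_abs]
          exact pow_le_pow_left₀ (abs_nonneg _) (hz t (Finset.mem_range.1 ht)) 2
      _ = _ := by simp
  have n3 : |∑ t ∈ Finset.range I.d, ((c t : ℤ) - I.Z) * j (i * I.d + t)| ≤ I.d * I.O := by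
    calc _ ≤ ∑ t ∈ Finset.range I.d, |((c t : ℤ) - I.Z) * j (i * I.d + t)| :=
          Finset.abs_sum_le_sum_abs _ _
      _ ≤ ∑ _t ∈ Finset.range I.d, (I.O : ℤ) :=
          Finset.sum_le_sum fun t ht => hzj t (Finset.mem_range.1 ht)
      _ = _ := by simp
  set N := ∑ t ∈ Finset.range I.d, ((c t : ℤ) - I.Z) ^ 2
  set M := ∑ t ∈ Finset.range I.d, ((c t : ℤ) - I.Z) * j (i * I.d + t)
  have hW : (I.W : ℤ) = I.d * (I.Z : ℤ) ^ 2 + 1 := by rw [W]; push_cast; ring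
  have hWpos : (0 : ℤ) < I.W := by rw [hW]; positivity
  have hN : N < I.W := by rw [hW]; linarith
  have n4 := abs_le.1 n3
  refine ⟨?_, ?_, ?_⟩
  · rw [Int.natCast_mod, e1, Int.add_mul_emod_self_right, Int.emod_eq_of_lt n1 hN]
  · rw [Int.natCast_div, e1, Int.add_mul_ediv_right _ _ hWpos.ne', Int.ediv_eq_zero_of_lt n1 hN]
    ring
  · have : (key (I.ballKey j i) c I.d : ℤ) < I.X := by
      rw [e1, X]; push_cast
      have : (M + I.d * I.O) * I.W ≤ (I.d * I.O + I.d * I.O) * I.W :=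
        mul_le_mul_of_nonneg_right (by linarith) hWpos.le
      nlinarith
    exact_mod_cast this

theorem acc_iff (i : Fin I.m) {c : ℕ → ℕ} (hc : ∀ t < I.d, c t < I.C) :
    I.acc j i (key (I.ballKey j i) c I.d) ↔
      ∑ t : Fin I.d, ((c t : ℝ) - I.Z) ^ 2 ≤ I.thresh j i +
        (∑ t : Fin I.d, ((c t : ℝ) - I.Z) * j (i * I.d + t)) * I.slope i := by
  obtain ⟨h1, h2, -⟩ := key_props h i hc
  rw [acc]
  have h1' : ((key (I.ballKey j i) c I.d % I.W : ℕ) : ℝ) =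
      ∑ t : Fin I.d, ((c t : ℝ) - I.Z) ^ 2 := by
    rw [Fin.sum_univ_eq_sum_range fun t => ((c t : ℝ) - I.Z) ^ 2]
    rw [← Int.cast_natCast, h1, Int.cast_sum]
    exact Finset.sum_congr rfl fun t _ => by push_cast; ring
  have h2' : ((key (I.ballKey j i) c I.d / I.W : ℕ) : ℝ) - I.d * I.O =
      ∑ t : Fin I.d, ((c t : ℝ) - I.Z) * j (i * I.d + t) := by
    rw [Fin.sum_univ_eq_sum_range fun t => ((c t : ℝ) - I.Z) * (j (i * I.d + t) : ℝ)]
    have h3 := congrArg (Int.cast : ℤ → ℝ) h2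
    rw [Int.cast_sub, Int.cast_natCast, Int.cast_sum] at h3
    push_cast at h3 ⊢
    exact h3
  rw [h1', h2']

end Key

variable {I : Input}

/-- Admissibility of a vector for a ball. -/
abbrev BallAdm (I : Input) (j : ℕ → ℤ) (i : ℕ) (c u : ℕ → ℕ) : Prop :=
  Adm I.C (I.scale i) (I.ballKey j i) I.d I.X (I.acc j i) c u

/-- The number of points in the superset of a ball. -/
def size (I : Input) (j : ℕ → ℤ) (i : ℕ) : ℕ :=
  total I.C (I.scale i) (I.ballKey j i) I.d I.X (I.acc j i)

/-- The lattice points of a ball. -/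
def ball (I : Input) (i : Fin I.m) : Set (Fin I.d → ℤ) := latticeBall (I.center i) (I.radius i)

theorem ball_finite (i : Fin I.m) : (I.ball i).Finite := latticeBall_finite _ _

/-- The floor of a number x ≥ 1 is between x / 2 and x. -/
theorem two_mul_scale_mul_E_le {i : ℕ} (hd : 0 < I.d) (hr : ¬ I.r i < I.F) :
    (I.scale i : ℝ) * I.F ≤ I.r i ∧ I.r i ≤ 2 * I.scale i * I.F := by
  have hF : (0 : ℝ) < I.F := by exact_mod_cast F_pos hd
  have h1 : (I.scale i : ℝ) ≤ I.r i / I.F := by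
    rw [scale, if_neg hr]
    exact Nat.floor_le (div_nonneg (hF.le.trans (not_lt.1 hr)) hF.le)
  have h2 : I.r i / I.F < I.scale i + 1 := by
    rw [scale, if_neg hr]
    exact Nat.lt_floor_add_one _
  have h3 : (1 : ℝ) ≤ I.scale i := by exact_mod_cast one_le_scale i hd
  rw [le_div_iff₀ hF] at h1
  rw [div_lt_iff₀ hF] at h2
  constructor <;> nlinarith

/-- A vector is determined by its point. -/
theorem point_inj {a : ℕ → ℤ} (hd : 0 < I.d) {i : ℕ} {c u c' u' : ℕ → ℕ} (hc : ∀ t < I.d, u t < I.scale i)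
    (hc' : ∀ t < I.d, u' t < I.scale i)
    (he : ∀ t : Fin I.d, I.point a i c u t = I.point a i c' u' t) :
    ∀ t < I.d, c t = c' t ∧ u t = u' t := by
  intro t ht
  have hs := one_le_scale i hd
  have hs' : (0 : ℤ) < I.scale i := by exact_mod_cast hs
  have h1 := he ⟨t, ht⟩
  simp only [point, add_left_inj] at h1
  have h2 := congrArg (· / (I.scale i : ℤ)) h1
  have h3 := congrArg (· % (I.scale i : ℤ)) h1
  have b1 := hc t ht
  have b2 := hc' t ht
  have b3 : (u t : ℤ) / I.scale i = 0 := Int.ediv_eq_zero_of_lt (by omega) (by omega)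
  have b4 : (u' t : ℤ) / I.scale i = 0 := Int.ediv_eq_zero_of_lt (by omega) (by omega)
  simp only [Int.add_comm (_ * _), Int.add_mul_ediv_right _ _ hs'.ne',
    Int.add_mul_emod_self_right, b3, b4] at h2 h3
  rw [Int.emod_eq_of_lt (by omega) (by omega), Int.emod_eq_of_lt (by omega) (by omega)] at h3
  constructor <;> omega

/-- The vector of a given rank. -/
theorem exists_decode (j : ℕ → ℤ) (i : ℕ) : ∃ cu : ℕ → (ℕ → ℕ) × (ℕ → ℕ), ∀ R < I.size j i,
    I.BallAdm j i (cu R).1 (cu R).2 ∧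
      rank I.C (I.scale i) (I.ballKey j i) I.d (I.acc j i) (cu R).1 (cu R).2 = R := by
  have key : ∀ R, ∃ cu : (ℕ → ℕ) × (ℕ → ℕ), R < I.size j i → I.BallAdm j i cu.1 cu.2 ∧
      rank I.C (I.scale i) (I.ballKey j i) I.d (I.acc j i) cu.1 cu.2 = R := by
    intro R
    by_cases hR : R < I.size j i
    · obtain ⟨c, u, hcu⟩ := exists_rank_eq hR
      exact ⟨(c, u), fun _ => hcu⟩
    · exact ⟨default, fun h => absurd h hR⟩
  choose cu hcu using key
  exact ⟨cu, hcu⟩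

/-! ### The supersets contain the balls -/

section Coords

variable {a j : ℕ → ℤ} (h : I.Coords a j)
include h

/-- At scale 1 the remainder `u` vanishes, and the difference from the center is z - jλ exactly.
Expanding the square separates the condition into the two parts of the key, so no point is accepted
wrongly. -/
theorem small_acc_iff (hI : I.Valid) (i : Fin I.m) (hr : I.r i < I.F) {c u : ℕ → ℕ}
    (hc : ∀ t < I.d, c t < I.C ∧ u t < I.scale i) :
    I.acc j i (key (I.ballKey j i) c I.d) ↔ (fun t : Fin I.d => I.point a i c u t) ∈ I.ball i := by
  rw [acc_iff h i fun t ht => (hc t ht).1, ball, mem_latticeBall_iff_sum (hI.radius_pos i).le,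
    thresh, if_pos hr, slope, if_pos hr, ← r_eq, ← sub_nonneg, ← sub_nonneg (b := ∑ _, _)]
  have e : ∀ t : Fin I.d, ((I.point a i c u t : ℤ) : ℝ) - I.center i t =
      ((c t : ℝ) - I.Z) - j (i * I.d + t) * I.lam := by
    intro t
    have h1 := (hc t t.2).2
    have h2 : I.scale i = 1 := by rw [scale, if_pos hr]
    have h3 : u t = 0 := by omega
    have h4 := h.eq _ (idx_lt i t.2)
    rw [p_eq] at h4
    rw [h4, point, h2, h3]
    push_cast
    ring
  simp only [e]
  have e2 : ∑ t : Fin I.d, ((c t : ℝ) - I.Z - j (i * I.d + t) * I.lam) ^ 2 =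
      ∑ t : Fin I.d, ((c t : ℝ) - I.Z) ^ 2 -
        (∑ t : Fin I.d, ((c t : ℝ) - I.Z) * j (i * I.d + t)) * (I.lam + I.lam) +
        (∑ t : Fin I.d, (j (i * I.d + t) : ℝ) * j (i * I.d + t)) * I.lam * I.lam := by
    simp only [Finset.sum_mul, ← Finset.sum_sub_distrib, ← Finset.sum_add_distrib]
    exact Finset.sum_congr rfl fun t _ => by ring
  rw [e2, Fin.sum_univ_eq_sum_range fun t => (j (i * I.d + t) : ℝ) * j (i * I.d + t)]
  constructor <;> intro h <;> linarith

/-- Replacing the center by its integer part `a` moves it by a bounded amount, independent of the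
radius. For large balls this shift is part of the tolerance `E`. -/
theorem norm_center_sub_le (i : Fin I.m) :
    ‖I.center i - latticePoint (fun t : Fin I.d => a (i * I.d + t))‖ ≤ I.d * (I.L * I.Lam) := by
  refine norm_le_mul_of_abs_le (by positivity) fun t => ?_
  have h4 := h.eq _ (idx_lt i t.2)
  rw [p_eq] at h4
  simp only [PiLp.sub_apply, latticePoint, h4, add_sub_cancel_left, abs_mul]
  have h5 : |(j (i * I.d + t) : ℝ)| ≤ I.L := by exact_mod_cast h.abs_le _ (idx_lt i t.2)
  exact mul_le_mul h5 abs_lam_le (abs_nonneg _) (by positivity)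

/-- The rescaled, rounded coordinates of a point and of the center of a ball are close. -/
theorem abs_dist_sub_norm_le (hd : 0 < I.d) (i : Fin I.m) {y z u : Fin I.d → ℤ}
    (hu : ∀ t, 0 ≤ u t ∧ u t < I.scale i)
    (hy : ∀ t : Fin I.d, y t = z t * I.scale i + u t + a (i * I.d + t)) :
    |dist (latticePoint y) (I.center i) - I.scale i * ‖latticePoint z‖| ≤ I.scale i * I.E := by
  have h1 := norm_center_sub_le h i
  have h2 : ‖latticePoint u‖ ≤ I.d * I.scale i := by
    refine norm_le_mul_of_abs_le (by positivity) fun t => ?_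
    simp only [latticePoint]
    rw [abs_of_nonneg (by exact_mod_cast (hu t).1)]
    exact_mod_cast (hu t).2.le
  have h3 : ‖(I.scale i : ℝ) • latticePoint z‖ = I.scale i * ‖latticePoint z‖ := by
    rw [norm_smul, Real.norm_eq_abs, abs_of_nonneg (by positivity)]
  -- What separates the true difference vector from s z is the remainder u, of norm at most d s, and
  -- the shift of the center, of norm at most d L Λ. As s ≥ 1, the sum is at most s E.
  have h4 : latticePoint y - I.center i - (I.scale i : ℝ) • latticePoint z =
      latticePoint u - (I.center i - latticePoint fun t : Fin I.d => a (i * I.d + t)) := by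
    ext t
    simp only [PiLp.sub_apply, PiLp.smul_apply, latticePoint, smul_eq_mul, hy]
    push_cast
    ring
  have h5 : (1 : ℝ) ≤ I.scale i := by exact_mod_cast one_le_scale i hd
  rw [dist_eq_norm, ← h3]
  refine (abs_norm_sub_norm_le _ _).trans ?_
  rw [h4]
  refine (norm_sub_le _ _).trans ?_
  rw [E]
  push_cast
  have h6 : (0 : ℝ) ≤ I.d * (I.L * I.Lam) := by positivity
  nlinarith

/-- Here the slope is 0, so only Σ z² is consulted; the threshold is the square of r / s + E. -/
theorem large_acc_iff (hI : I.Valid) (i : Fin I.m) (hr : ¬ I.r i < I.F) {c : ℕ → ℕ}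
    (hc : ∀ t < I.d, c t < I.C) :
    I.acc j i (key (I.ballKey j i) c I.d) ↔
      I.scale i * ‖latticePoint fun t : Fin I.d => (c t : ℤ) - I.Z‖ ≤
        I.r i + I.scale i * I.E := by
  rw [acc_iff h i hc, thresh, if_neg hr, slope, if_neg hr, mul_zero, add_zero, ← sq]
  have h1 : ∑ t : Fin I.d, ((c t : ℝ) - I.Z) ^ 2 =
      ‖latticePoint fun t : Fin I.d => (c t : ℤ) - I.Z‖ ^ 2 := by
    rw [sq_norm_latticePoint]
    push_cast
    rfl
  have h2 : (0 : ℝ) < I.scale i := by exact_mod_cast one_le_scale i hI.d_pos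
  have h3 : 0 < I.r i := by rw [r_eq]; exact hI.radius_pos i
  rw [h1, pow_le_pow_iff_left₀ (norm_nonneg _) (by positivity) two_ne_zero,
    ← mul_le_mul_iff_right₀ h2, mul_add, mul_div_cancel₀ _ h2.ne']

/-- Every point of a ball is obtained from an admissible vector. -/
theorem exists_point_eq (hI : I.Valid) (i : Fin I.m) {y : Fin I.d → ℤ} (hy : y ∈ I.ball i) :
    ∃ c u, I.BallAdm j i c u ∧ ∀ t : Fin I.d, I.point a i c u t = y t := by
  have hd := hI.d_pos
  have hs := one_le_scale i hd
  have hs' : (0 : ℤ) < I.scale i := by exact_mod_cast hs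
  have hsr : (0 : ℝ) < I.scale i := by exact_mod_cast hs
  set z : Fin I.d → ℤ := fun t => (y t - a (i * I.d + t)) / I.scale i with hz
  set u : Fin I.d → ℤ := fun t => (y t - a (i * I.d + t)) % I.scale i with hu
  have hu0 : ∀ t, 0 ≤ u t ∧ u t < I.scale i := fun t =>
    ⟨Int.emod_nonneg _ hs'.ne', Int.emod_lt_of_pos _ hs'⟩
  have hyz : ∀ t : Fin I.d, y t = z t * I.scale i + u t + a (i * I.d + t) := by
    intro t
    have := Int.mul_ediv_add_emod (y t - a (i * I.d + t)) (I.scale i)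
    simp only [hz, hu]
    linarith
  have hdist := abs_le.1 (abs_dist_sub_norm_le h hd i hu0 hyz)
  have hy' : dist (latticePoint y) (I.center i) ≤ I.r i := by rw [r_eq]; exact hy
  have hnorm : I.scale i * ‖latticePoint z‖ ≤ I.r i + I.scale i * I.E := by linarith
  have hEF : (I.E : ℝ) ≤ I.F := by exact_mod_cast E_le_F hd
  -- Why Z = 3 F: for small balls r + E < 2 F, and for large ones r ≤ 2 s F and s E ≤ s F.
  have hzZ : ‖latticePoint z‖ ≤ I.Z := by
    refine le_of_mul_le_mul_left (hnorm.trans ?_) hsr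
    rw [Z]; push_cast
    by_cases hr : I.r i < I.F
    · have h1 : (I.scale i : ℝ) = 1 := by rw [scale, if_pos hr]; simp
      have : (0 : ℝ) ≤ I.F := by positivity
      rw [h1]; linarith
    · have := (two_mul_scale_mul_E_le hd hr).2
      nlinarith
  have hzt : ∀ t, |z t| ≤ I.Z := fun t => by
    exact_mod_cast (abs_apply_le_norm z t).trans hzZ
  -- Shifting by `Z` makes the coordinates natural numbers below C = 2 Z + 1. The value 0 beyond the
  -- dimension is arbitrary; only indices below d are ever inspected.
  set c' : ℕ → ℕ := fun t => if ht : t < I.d then (z ⟨t, ht⟩ + I.Z).toNat else 0 with hc'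
  set u' : ℕ → ℕ := fun t => if ht : t < I.d then (u ⟨t, ht⟩).toNat else 0 with hu'
  have hcz : ∀ t : Fin I.d, (c' t : ℤ) = z t + I.Z := fun t => by
    simp only [hc', t.2, dif_pos]
    exact Int.toNat_of_nonneg (by have := abs_le.1 (hzt t); linarith)
  have huz : ∀ t : Fin I.d, (u' t : ℤ) = u t := fun t => by
    simp only [hu', t.2, dif_pos]
    exact Int.toNat_of_nonneg (hu0 t).1
  have hlt : ∀ t < I.d, c' t < I.C ∧ u' t < I.scale i := by
    intro t ht
    have h1 := hcz ⟨t, ht⟩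
    have h2 := huz ⟨t, ht⟩
    have h3 := (hu0 ⟨t, ht⟩).2
    have h4 := abs_le.1 (hzt ⟨t, ht⟩)
    simp only at h1 h2
    rw [C]
    constructor <;> omega
  have hpt : ∀ t : Fin I.d, I.point a i c' u' t = y t := by
    intro t
    rw [point, hcz, huz, hyz]
    ring
  refine ⟨c', u', ⟨hlt, (key_props h i fun t ht => (hlt t ht).1).2.2, ?_⟩, hpt⟩
  by_cases hr : I.r i < I.F
  · rw [small_acc_iff h hI i hr hlt]
    rwa [show (fun t : Fin I.d => I.point a i c' u' t) = y from funext hpt]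
  · rw [large_acc_iff h hI i hr fun t ht => (hlt t ht).1]
    have : (fun t : Fin I.d => (c' t : ℤ) - I.Z) = z := funext fun t => by rw [hcz]; ring
    rwa [this]

/-- The tolerance s E enters twice: once in the acceptance condition and once in passing from s z
back to the point. -/
theorem point_mem_large (hI : I.Valid) (i : Fin I.m) (hr : ¬ I.r i < I.F) {c u : ℕ → ℕ}
    (hc : I.BallAdm j i c u) : (fun t : Fin I.d => I.point a i c u t) ∈
      latticeBall (I.center i) (I.r i + 2 * (I.scale i * I.E)) := by
  have h1 := (large_acc_iff h hI i hr fun t ht => (hc.lt t ht).1).1 hc.acc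
  have h2 := abs_le.1 (abs_dist_sub_norm_le h hI.d_pos i
    (y := fun t : Fin I.d => I.point a i c u t)
    (z := fun t : Fin I.d => (c t : ℤ) - I.Z) (u := fun t => (u t : ℤ))
    (fun t => ⟨by positivity, by exact_mod_cast (hc.lt t t.2).2⟩) fun t => rfl)
  rw [mem_latticeBall]
  linarith

end Coords

/-! ### The supersets are at most three times as large as the balls -/

variable {I : Input}

theorem one_add_pow_le_three {d : ℕ} (hd : 0 < d) : (1 + 5 * (1 / (8 * d : ℝ))) ^ d ≤ 3 := by
  have h1 : (1 + 5 * (1 / (8 * d : ℝ))) ≤ Real.exp (5 * (1 / (8 * d : ℝ))) := by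
    rw [add_comm]; exact Real.add_one_le_exp _
  have hd' : (0 : ℝ) < d := by exact_mod_cast hd
  calc _ ≤ Real.exp (5 * (1 / (8 * d : ℝ))) ^ d := by gcongr
    _ = Real.exp (5 / 8) := by
        rw [← Real.exp_nat_mul]
        congr 1
        field_simp
    _ ≤ Real.exp 1 := Real.exp_le_exp.2 (by norm_num)
    _ ≤ 3 := by linarith [Real.exp_one_lt_d9]

theorem decode_injOn {a j : ℕ → ℤ} {cu : ℕ → (ℕ → ℕ) × (ℕ → ℕ)} (hd : 0 < I.d) (i : ℕ)
    (hcu : ∀ R < I.size j i, I.BallAdm j i (cu R).1 (cu R).2 ∧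
      rank I.C (I.scale i) (I.ballKey j i) I.d (I.acc j i) (cu R).1 (cu R).2 = R) :
    Set.InjOn (fun R => (fun t : Fin I.d => I.point a i (cu R).1 (cu R).2 t))
      (Finset.range (I.size j i)) := by
  intro R hR R' hR' he
  simp only [Finset.coe_range, Set.mem_Iio] at hR hR'
  obtain ⟨h1, h2⟩ := hcu R hR
  obtain ⟨h3, h4⟩ := hcu R' hR'
  rw [← h2, ← h4]
  exact rank_congr (point_inj hd (fun t ht => (h1.lt t ht).2) (fun t ht => (h3.lt t ht).2)
    fun t => congrFun he t)

theorem size_le_ncard {a j : ℕ → ℤ} {i : Fin I.m} (hd : 0 < I.d) {B : Set (Fin I.d → ℤ)} (hB : B.Finite)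
    (hc : ∀ c u, I.BallAdm j i c u → (fun t : Fin I.d => I.point a i c u t) ∈ B) :
    I.size j i ≤ B.ncard := by
  obtain ⟨cu, hcu⟩ := exists_decode (I := I) j i
  have hinj := decode_injOn (a := a) hd i hcu
  calc I.size j i = (Finset.range (I.size j i) : Set ℕ).ncard := by
        rw [Set.ncard_coe_finset, Finset.card_range]
    _ ≤ B.ncard := by
        refine Set.ncard_le_ncard_of_injOn _ (fun R hR => ?_) hinj hB
        simp only [Finset.coe_range, Set.mem_Iio] at hR
        exact hc _ _ (hcu R hR).1

section Coords

variable {a j : ℕ → ℤ} (h : I.Coords a j) {cu : ℕ → (ℕ → ℕ) × (ℕ → ℕ)}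
include h

/-- Decoding is injective on ranks and reaches every point of the ball. Hence each point of `B` has
exactly one rank, and a uniform rank hits `B` with probability |B| / size. -/
theorem card_filter_decode (hI : I.Valid) (i : Fin I.m)
    (hcu : ∀ R < I.size j i, I.BallAdm j i (cu R).1 (cu R).2 ∧
      rank I.C (I.scale i) (I.ballKey j i) I.d (I.acc j i) (cu R).1 (cu R).2 = R)
    {B : Set (Fin I.d → ℤ)} [DecidablePred (· ∈ B)] (hB : B ⊆ I.ball i) :
    ((Finset.range (I.size j i)).filter fun R =>
      (fun t : Fin I.d => I.point a i (cu R).1 (cu R).2 t) ∈ B).card = B.ncard := by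
  have hinj := decode_injOn (a := a) hI.d_pos i hcu
  rw [← Set.ncard_coe_finset]
  refine Set.ncard_congr (fun R _ => fun t : Fin I.d => I.point a i (cu R).1 (cu R).2 t) ?_ ?_ ?_
  · intro R hR
    simp only [Finset.coe_filter, Set.mem_ofPred_eq] at hR
    exact hR.2
  · intro R R' hR hR' he
    simp only [Finset.coe_filter, Set.mem_ofPred_eq] at hR hR'
    exact hinj hR.1 hR'.1 he
  · intro y hy
    obtain ⟨c, u, h1, h2⟩ := exists_point_eq h hI i (hB hy)
    have hlt : rank I.C (I.scale i) (I.ballKey j i) I.d (I.acc j i) c u < I.size j i := h1.rank_lt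
    obtain ⟨h3, h4⟩ := hcu _ hlt
    have h5 := rank_inj h3 h1 h4
    have h6 : (fun t : Fin I.d => I.point a i
        (cu (rank I.C (I.scale i) (I.ballKey j i) I.d (I.acc j i) c u)).1
        (cu (rank I.C (I.scale i) (I.ballKey j i) I.d (I.acc j i) c u)).2 t) = y := by
      funext t
      rw [← h2, point, point, (h5 t t.2).1, (h5 t t.2).2]
    refine ⟨_, ?_, h6⟩
    simp only [Finset.coe_filter, Set.mem_ofPred_eq, Finset.mem_range]
    exact ⟨hlt, by rwa [h6]⟩

theorem ncard_ball_le_size (hI : I.Valid) (i : Fin I.m) : (I.ball i).ncard ≤ I.size j i := by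
  classical
  obtain ⟨cu, hcu⟩ := exists_decode (I := I) j i
  rw [← card_filter_decode h hI i hcu subset_rfl]
  exact (Finset.card_filter_le _ _).trans (by simp)

/-- Small balls equal their supersets. For a large one the superset lies in the concentric ball of
radius r + 2 s E, and F = 8 d E makes s E at most r / (8 d), so the comparison of volumes costs a
factor of at most (1 + 5 / (8 d))^d ≤ e^(5/8) ≤ 3. -/
theorem size_le (hI : I.Valid) (i : Fin I.m) : (I.size j i : ℝ) ≤ 3 * (I.ball i).ncard := by
  have hd := hI.d_pos
  by_cases hr : I.r i < I.F
  · have h1 : I.size j i ≤ (I.ball i).ncard :=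
      size_le_ncard hd (ball_finite i) fun c u hc => (small_acc_iff h hI i hr hc.lt).1 hc.acc
    have h2 : (I.size j i : ℝ) ≤ (I.ball i).ncard := by exact_mod_cast h1
    have h3 : (0 : ℝ) ≤ (I.ball i).ncard := by positivity
    linarith
  · have h1 : I.size j i ≤ (latticeBall (I.center i) (I.r i + 2 * (I.scale i * I.E))).ncard :=
      size_le_ncard hd (latticeBall_finite _ _) fun c u hc => point_mem_large h hI i hr hc
    have h2 : (I.size j i : ℝ) ≤
        (latticeBall (I.center i) (I.r i + 2 * (I.scale i * I.E))).ncard := by exact_mod_cast h1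
    refine h2.trans ?_
    have hd' : (1 : ℝ) ≤ I.d := by exact_mod_cast hd
    have hs : (1 : ℝ) ≤ I.scale i := by exact_mod_cast one_le_scale i hd
    have hE : (I.d : ℝ) ≤ I.E := by exact_mod_cast d_le_E
    have hF : (I.F : ℝ) = 8 * (I.d * I.E) := by rw [F]; push_cast; ring
    have h3 := (two_mul_scale_mul_E_le hd hr).1
    rw [hF] at h3
    set x : ℝ := 1 / (8 * I.d) with hx
    have hx0 : 0 < x := by positivity
    have hx1 : x ≤ 1 / 8 := by rw [hx]; gcongr; linarith
    have hsE : I.scale i * I.E ≤ x * I.r i := by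
      have : x * (I.scale i * (8 * (I.d * I.E))) = I.scale i * I.E := by rw [hx]; field_simp
      rw [← this]
      gcongr
    have hdE : (I.d : ℝ) ≤ I.scale i * I.E := by nlinarith
    have hr0 : 0 < I.r i := by rw [r_eq]; exact hI.radius_pos i
    have hlow : 0 < I.r i - I.d := by nlinarith
    have h4 := ncard_latticeBall_mul_le (I.center i) (R := I.r i + 2 * (I.scale i * I.E))
      (r := I.r i) (by positivity) (by linarith)
    -- With d ≤ s E ≤ x r, the left radius is at most (1 + 3 x) r and the right one at least (1 - x)
    -- r; (1 + 5 x)(1 - x) ≥ 1 + 3 x holds because x ≤ 1/8.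
    have h5 : (I.r i + 2 * (I.scale i * I.E) + I.d) ^ I.d ≤ 3 * (I.r i - I.d) ^ I.d := by
      calc _ ≤ ((1 + 5 * x) * (I.r i - I.d)) ^ I.d := by
            gcongr
            have hxr : 0 ≤ x * I.r i := by positivity
            nlinarith
        _ = (1 + 5 * x) ^ I.d * (I.r i - I.d) ^ I.d := mul_pow _ _ _
        _ ≤ _ := by
            gcongr
            exact one_add_pow_le_three hd
    have h6 : 0 < (I.r i - I.d) ^ I.d := pow_pos hlow _
    have h7 : latticeBall (I.center i) (I.r i) = I.ball i := by rw [r_eq]; rfl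
    rw [h7] at h4
    refine le_of_mul_le_mul_right (h4.trans ?_) h6
    have h8 : (0 : ℝ) ≤ (I.ball i).ncard := by positivity
    nlinarith

end Coords
end Input

/-! ### Concentration for uniform samples -/

section Concentration

/-- On [-1, 1] the convex exponential lies below its chord, whose value is affine in x; for a
centered variable the linear term averages out. -/
theorem exp_mul_le_cosh_add {x h : ℝ} (hx : |x| ≤ 1) :
    Real.exp (h * x) ≤ Real.cosh h + x * Real.sinh h := by
  obtain ⟨h1, h2⟩ := abs_le.1 hx
  have := convexOn_exp.2 (Set.mem_univ h) (Set.mem_univ (-h))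
    (by linarith : 0 ≤ (1 + x) / 2) (by linarith : 0 ≤ (1 - x) / 2) (by ring)
  simp only [smul_eq_mul] at this
  calc Real.exp (h * x) = Real.exp ((1 + x) / 2 * h + (1 - x) / 2 * -h) := by ring_nf
    _ ≤ _ := this
    _ = _ := by rw [Real.cosh_eq, Real.sinh_eq]; ring

/-- Hoeffding's inequality for samples from a finite set. -/
theorem card_le_sum_le {α : Type*} [Fintype α] {X : α → ℝ} (hX : ∀ a, |X a| ≤ 1)
    (h0 : ∑ a, X a = 0) (N : ℕ) {η : ℝ} (hη : 0 ≤ η) :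
    ((Finset.univ.filter fun ω : Fin N → α => η * N ≤ ∑ τ, X (ω τ)).card : ℝ) ≤
      Real.exp (-(N * (η ^ 2 / 2))) * (Fintype.card α : ℝ) ^ N := by
  have h1 : ∑ a, Real.exp (η * X a) ≤ Fintype.card α * Real.exp (η ^ 2 / 2) := by
    calc _ ≤ ∑ a, (Real.cosh η + X a * Real.sinh η) :=
          Finset.sum_le_sum fun a _ => exp_mul_le_cosh_add (hX a)
      _ = Fintype.card α * Real.cosh η := by
          rw [Finset.sum_add_distrib, ← Finset.sum_mul, h0]
          simp
      _ ≤ _ := by gcongr; exact Real.cosh_le_exp_half_sq η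
  have h2 : ∑ ω : Fin N → α, Real.exp (η * ∑ τ, X (ω τ)) ≤
      (Fintype.card α * Real.exp (η ^ 2 / 2)) ^ N := by
    calc _ = (∑ a, Real.exp (η * X a)) ^ N := by
          rw [Fintype.sum_pow]
          refine Finset.sum_congr rfl fun ω _ => ?_
          rw [Finset.mul_sum, Real.exp_sum]
      _ ≤ _ := pow_le_pow_left₀ (Finset.sum_nonneg fun _ _ => (Real.exp_pos _).le) h1 N
  -- Markov's inequality: on the event, the exponential summand is at least 1.
  have h3 : ((Finset.univ.filter fun ω : Fin N → α => η * N ≤ ∑ τ, X (ω τ)).card : ℝ) ≤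
      ∑ ω : Fin N → α, Real.exp (η * ∑ τ, X (ω τ)) * Real.exp (-(η ^ 2 * N)) := by
    rw [Finset.card_filter]
    push_cast
    refine Finset.sum_le_sum fun ω _ => ?_
    split_ifs with h
    · rw [← Real.exp_add]
      refine Real.one_le_exp ?_
      nlinarith
    · positivity
  refine h3.trans ?_
  rw [← Finset.sum_mul]
  calc _ ≤ (Fintype.card α * Real.exp (η ^ 2 / 2)) ^ N * Real.exp (-(η ^ 2 * N)) := by gcongr
    _ = _ := by
        rw [mul_pow, ← Real.exp_nat_mul, mul_assoc, ← Real.exp_add, mul_comm]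
        congr 2
        ring

/-- Hoeffding's inequality for the centered indicator and for its negative. -/
theorem card_freq_le {α : Type*} [Fintype α] [Nonempty α] (B : α → Prop) [DecidablePred B]
    (N : ℕ) {η : ℝ} (hη : 0 ≤ η) :
    ((Finset.univ.filter fun ω : Fin N → α =>
      η * N < |((Finset.univ.filter fun τ => B (ω τ)).card : ℝ) -
        N * ((Finset.univ.filter B).card / Fintype.card α)|).card : ℝ) ≤
      2 * Real.exp (-(N * (η ^ 2 / 2))) * (Fintype.card α : ℝ) ^ N := by
  have hc : (0 : ℝ) < Fintype.card α := by exact_mod_cast Fintype.card_pos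
  set p : ℝ := (Finset.univ.filter B).card / Fintype.card α with hp
  have hp0 : 0 ≤ p := by positivity
  have hp1 : p ≤ 1 := by
    rw [hp, div_le_one hc]
    exact_mod_cast Finset.card_le_univ _
  set X : α → ℝ := fun a => (if B a then 1 else 0) - p with hXdef
  have hX : ∀ a, |X a| ≤ 1 := fun a => by
    simp only [hXdef]
    rw [abs_le]
    split_ifs <;> constructor <;> linarith
  have hX0 : ∑ a, X a = 0 := by
    simp only [hXdef, Finset.sum_sub_distrib, Finset.sum_boole, Finset.sum_const,
      Finset.card_univ, nsmul_eq_mul, hp]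
    field_simp
    simp
  have hsum : ∀ ω : Fin N → α, ((Finset.univ.filter fun τ => B (ω τ)).card : ℝ) - N * p =
      ∑ τ, X (ω τ) := fun ω => by
    simp [hXdef, Finset.sum_sub_distrib]
  have h1 := card_le_sum_le hX hX0 N hη
  have h2 := card_le_sum_le (X := fun a => -X a) (fun a => by rw [abs_neg]; exact hX a)
    (by simp [hX0]) N hη
  classical
  have hsub : (Finset.univ.filter fun ω : Fin N → α =>
      η * N < |((Finset.univ.filter fun τ => B (ω τ)).card : ℝ) - N * p|) ⊆
      (Finset.univ.filter fun ω : Fin N → α => η * N ≤ ∑ τ, X (ω τ)) ∪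
      Finset.univ.filter fun ω : Fin N → α => η * N ≤ ∑ τ, -X (ω τ) := by
    intro ω hω
    simp only [Finset.mem_filter, Finset.mem_univ, true_and, Finset.mem_union,
      Finset.sum_neg_distrib] at hω ⊢
    rw [hsum] at hω
    exact (lt_abs.1 hω).imp le_of_lt le_of_lt
  have h3 : ((Finset.univ.filter fun ω : Fin N → α =>
      η * N < |((Finset.univ.filter fun τ => B (ω τ)).card : ℝ) - N * p|).card : ℝ) ≤ _ :=
    Nat.cast_le.2 ((Finset.card_le_card hsub).trans (Finset.card_union_le _ _))
  push_cast at h3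
  linarith

/-- With high probability, finitely many frequencies are all close to the probabilities. -/
theorem exists_good_samples {ι : Type*} [Fintype ι] {M N : ℕ} (hM : 0 < M)
    (B : ι → Fin M → Prop) [∀ i, DecidablePred (B i)] {η γ : ℝ} (hη : 0 ≤ η)
    (hγ : Fintype.card ι * (2 * Real.exp (-(N * (η ^ 2 / 2)))) ≤ γ) :
    ∃ V : Finset (Fin N → Fin M), (1 - γ) * (M : ℝ) ^ N ≤ V.card ∧ ∀ ω ∈ V, ∀ i,
      |((Finset.univ.filter fun τ => B i (ω τ)).card : ℝ) -
        N * ((Finset.univ.filter (B i)).card / M)| ≤ η * N := by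
  classical
  have : Nonempty (Fin M) := ⟨⟨0, hM⟩⟩
  set bad : ι → Finset (Fin N → Fin M) := fun i => Finset.univ.filter fun ω =>
      η * N < |((Finset.univ.filter fun τ => B i (ω τ)).card : ℝ) -
        N * ((Finset.univ.filter (B i)).card / Fintype.card (Fin M))| with hbad
  refine ⟨(Finset.univ.biUnion bad)ᶜ, ?_, fun ω hω i => ?_⟩
  · have h1 : ((Finset.univ.biUnion bad).card : ℝ) ≤ γ * (M : ℝ) ^ N := by
      calc ((Finset.univ.biUnion bad).card : ℝ) ≤ ∑ i, ((bad i).card : ℝ) := by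
            exact_mod_cast Finset.card_biUnion_le
        _ ≤ ∑ _i : ι, 2 * Real.exp (-(N * (η ^ 2 / 2))) * (M : ℝ) ^ N :=
            Finset.sum_le_sum fun i _ => by
              have := card_freq_le (B i) N hη
              simpa only [hbad, Fintype.card_fin] using this
        _ = Fintype.card ι * (2 * Real.exp (-(N * (η ^ 2 / 2)))) * (M : ℝ) ^ N := by
            rw [Finset.sum_const, Finset.card_univ, nsmul_eq_mul]; ring
        _ ≤ _ := by gcongr
    have h2 : (((Finset.univ.biUnion bad)ᶜ).card : ℝ) =
        (M : ℝ) ^ N - ((Finset.univ.biUnion bad).card : ℝ) := by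
      rw [Finset.card_compl, Nat.cast_sub (Finset.card_le_univ _)]
      simp
    rw [h2]
    linarith
  · simp only [Finset.mem_compl, Finset.mem_biUnion, Finset.mem_univ, true_and, not_exists,
      hbad, Finset.mem_filter, not_lt, Fintype.card_fin] at hω
    exact hω i

end Concentration

/-! ### The greedy algorithm with approximate gains -/

section Greedy

variable {ι α : Type*}

/-- The number of elements of a union of sets. -/
def cover (A : ι → Set α) (S : Finset ι) : ℕ := (⋃ i ∈ S, A i).ncard

theorem finite_cover {A : ι → Set α} (hA : ∀ i, (A i).Finite) (S : Finset ι) :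
    (⋃ i ∈ S, A i).Finite := S.finite_toSet.biUnion fun i _ => hA i

theorem cover_le_add_sum {A : ι → Set α} (hA : ∀ i, (A i).Finite) (S J : Finset ι) :
    cover A J ≤ cover A S + ∑ i ∈ J, (A i \ ⋃ i' ∈ S, A i').ncard := by
  have h1 : (⋃ i ∈ J, A i) ⊆ (⋃ i ∈ S, A i) ∪ ⋃ i ∈ J, (A i \ ⋃ i' ∈ S, A i') := by
    intro x hx
    by_cases hS : x ∈ ⋃ i ∈ S, A i
    · exact Or.inl hS
    · simp only [Set.mem_iUnion, exists_prop] at hx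
      obtain ⟨i, hi, hx⟩ := hx
      refine Or.inr ?_
      simp only [Set.mem_iUnion, exists_prop]
      exact ⟨i, hi, hx, by simpa using hS⟩
  have hfin : (⋃ i ∈ J, (A i \ ⋃ i' ∈ S, A i')).Finite :=
    J.finite_toSet.biUnion fun i _ => (hA i).sdiff
  calc cover A J ≤ _ := Set.ncard_le_ncard h1 ((finite_cover hA S).union hfin)
    _ ≤ _ := Set.ncard_union_le _ _
    _ ≤ _ := by
        rw [cover]
        gcongr
        exact Finset.set_ncard_biUnion_le J _

variable [DecidableEq ι]

/-- `GreedyRun gain n S`: the greedy algorithm may select the set `S` in `n` rounds. -/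
inductive GreedyRun (gain : Finset ι → ι → ℝ) : ℕ → Finset ι → Prop
  | zero : GreedyRun gain 0 ∅
  | succ {n : ℕ} {S : Finset ι} {i : ι} (h : GreedyRun gain n S) (hi : i ∉ S)
      (hmax : ∀ i' ∉ S, gain S i' ≤ gain S i) : GreedyRun gain (n + 1) (insert i S)

theorem GreedyRun.card_eq {gain : Finset ι → ι → ℝ} {n : ℕ} {S : Finset ι}
    (h : GreedyRun gain n S) : S.card = n := by
  induction h with
  | zero => rfl
  | succ h hi _ ih => rw [Finset.card_insert_of_notMem hi, ih]

theorem cover_insert {A : ι → Set α} (hA : ∀ i, (A i).Finite) (S : Finset ι) (i : ι) :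
    cover A (insert i S) = cover A S + (A i \ ⋃ i' ∈ S, A i').ncard := by
  rw [cover, cover, Finset.set_biUnion_insert, ← Set.sdiff_union_self, add_comm]
  exact Set.ncard_union_eq Set.disjoint_sdiff_left ((hA i).sdiff) (finite_cover hA S)

/-- The k sets of `J` together fill the gap, so some gain is at least gap / k. Selecting by
estimates loses at most 2 δ against the best gain: δ for the chosen set and δ for the competitor.
Hence each round shrinks the gap by 1 - 1/k and adds at most 2 δ. -/
theorem GreedyRun.sub_cover_le {A : ι → Set α} (hA : ∀ i, (A i).Finite)
    {gain : Finset ι → ι → ℝ} {δ : ℝ} (hδ : 0 ≤ δ)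
    (hg : ∀ S i, |gain S i - ((A i \ ⋃ i' ∈ S, A i').ncard : ℝ)| ≤ δ)
    {k : ℕ} (hk : 0 < k) {J : Finset ι} (hJ : J.card = k) {n : ℕ} {S : Finset ι}
    (h : GreedyRun gain n S) :
    (cover A J : ℝ) - cover A S ≤ (1 - 1 / k) ^ n * cover A J + n * (2 * δ) := by
  have hk' : (1 : ℝ) ≤ k := by exact_mod_cast hk
  have hk1 : (1 : ℝ) / k ≤ 1 := by rw [div_le_one (by linarith)]; exact hk'
  induction h with
  | zero => simp [cover]
  | @succ n S i h hi hmax ih =>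
    have h1 : ∀ i' ∈ J, ((A i' \ ⋃ i'' ∈ S, A i'').ncard : ℝ) ≤
        ((A i \ ⋃ i'' ∈ S, A i'').ncard : ℝ) + 2 * δ := by
      intro i' _
      -- Sets that are already selected have gain 0, so maximality among the unselected ones
      -- suffices.
      by_cases hi' : i' ∈ S
      · have : A i' \ ⋃ i'' ∈ S, A i'' = ∅ := by
          rw [Set.sdiff_eq_empty]
          exact Set.subset_biUnion_of_mem (u := A) hi'
        rw [this, Set.ncard_empty]
        push_cast
        positivity
      · have e1 := abs_le.1 (hg S i')
        have e2 := abs_le.1 (hg S i)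
        have e3 := hmax i' hi'
        linarith [e1.1, e2.2]
    have h2 : (cover A J : ℝ) ≤ cover A S +
        k * (((A i \ ⋃ i'' ∈ S, A i'').ncard : ℝ) + 2 * δ) := by
      calc (cover A J : ℝ) ≤ cover A S + ∑ i ∈ J, ((A i \ ⋃ i' ∈ S, A i').ncard : ℝ) := by
            exact_mod_cast cover_le_add_sum hA S J
        _ ≤ _ := by
            gcongr
            calc _ ≤ ∑ _i' ∈ J, (((A i \ ⋃ i'' ∈ S, A i'').ncard : ℝ) + 2 * δ) :=
                  Finset.sum_le_sum h1
              _ = _ := by rw [Finset.sum_const, hJ, nsmul_eq_mul]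
    have h3 : (cover A (insert i S) : ℝ) =
        cover A S + ((A i \ ⋃ i'' ∈ S, A i'').ncard : ℝ) := by
      exact_mod_cast cover_insert hA S i
    rw [h3]
    set g : ℝ := ((A i \ ⋃ i'' ∈ S, A i'').ncard : ℝ)
    have h4 : (1 / k : ℝ) * ((cover A J : ℝ) - cover A S) ≤ g + 2 * δ := by
      rw [one_div, inv_mul_le_iff₀ (by linarith)]
      linarith
    have h5 := mul_le_mul_of_nonneg_left ih (by linarith : (0 : ℝ) ≤ 1 - 1 / k)
    have h6 : (1 - 1 / k : ℝ) * (n * (2 * δ)) ≤ n * (2 * δ) :=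
      mul_le_of_le_one_left (by positivity) (by linarith [show (0 : ℝ) ≤ 1 / k by positivity])
    push_cast
    rw [pow_succ]
    linarith

/-- With x = 1/k, the second-order bound log(1 - x) ≤ -x - x²/2 gives (1 - x)^k ≤ e^(-1) e^(-x/2) ≤
e^(-1) (1 - x/4). The slack x / (4 e) is at least 3 x / 50 because 1/e ≥ 6/25. This slack is the
error budget of the sampling. -/
theorem one_sub_inv_pow_le {k : ℕ} (hk : 0 < k) :
    (1 - 1 / k : ℝ) ^ k + 3 / 50 * (1 / k) ≤ 1 / Real.exp 1 := by
  have hk' : (1 : ℝ) ≤ k := by exact_mod_cast hk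
  set x : ℝ := 1 / k with hx
  have hx0 : 0 < x := by positivity
  have hx1 : x ≤ 1 := by rw [hx, div_le_one (by linarith)]; exact hk'
  have hkx : k * x = 1 := by rw [hx]; field_simp
  have h1 : 1 - x ≤ Real.exp (-x - x ^ 2 / 2) := by
    -- The case k = 1 is separate, as the logarithm of 1 - x is then not available.
    rcases eq_or_lt_of_le hx1 with h | h
    · rw [h]; simpa using (Real.exp_pos _).le
    have hlog : Real.log (1 - x) ≤ -x - x ^ 2 / 2 := by
      -- The series of -log(1 - x) has nonnegative terms, so its first two bound it from below.
      have hser := Real.hasSum_pow_div_log_of_abs_lt_one (x := x) (by rwa [abs_of_pos hx0])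
      have := hser.summable.sum_le_tsum (Finset.range 2) fun i _ => by positivity
      rw [hser.tsum_eq] at this
      norm_num [Finset.sum_range_succ] at this
      linarith
    calc 1 - x = Real.exp (Real.log (1 - x)) := (Real.exp_log (by linarith)).symm
      _ ≤ _ := Real.exp_le_exp.2 hlog
  have h2 : (1 - x) ^ k ≤ Real.exp (-1 - x / 2) := by
    calc (1 - x) ^ k ≤ Real.exp (-x - x ^ 2 / 2) ^ k := pow_le_pow_left₀ (by linarith) h1 k
      _ = _ := by
          rw [← Real.exp_nat_mul]
          congr 1
          have : (k : ℝ) * (-x - x ^ 2 / 2) = -(k * x) - (k * x) * x / 2 := by ring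
          rw [this, hkx]
          ring
  have h3 : Real.exp (-(x / 2)) ≤ 1 - x / 4 := by
    have := Real.abs_exp_sub_one_sub_id_le (x := -(x / 2)) (by rw [abs_le]; constructor <;> linarith)
    have := (abs_le.1 this).2
    nlinarith
  have h4 : Real.exp (-1 - x / 2) = 1 / Real.exp 1 * Real.exp (-(x / 2)) := by
    rw [one_div, ← Real.exp_neg, ← Real.exp_add]
    congr 1
  have h5 : (6 / 25 : ℝ) ≤ 1 / Real.exp 1 := by
    rw [le_div_iff₀ (Real.exp_pos _)]
    linarith [Real.exp_one_lt_d9]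
  rw [h4] at h2
  have h6 := mul_le_mul_of_nonneg_left h3 (by positivity : 0 ≤ 1 / Real.exp 1)
  nlinarith

/-- The greedy algorithm with sufficiently accurate gains is a `1 - 1 / e` approximation. -/
theorem GreedyRun.approx {A : ι → Set α} (hA : ∀ i, (A i).Finite)
    {gain : Finset ι → ι → ℝ} {k : ℕ} (hk : 0 < k) {J : Finset ι} (hJ : J.card = k)
    (hg : ∀ S i, |gain S i - ((A i \ ⋃ i' ∈ S, A i').ncard : ℝ)| ≤
      3 / (100 * k ^ 2) * cover A J)
    {S : Finset ι} (h : GreedyRun gain k S) :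
    (1 - 1 / Real.exp 1) * cover A J ≤ cover A S := by
  have hk' : (1 : ℝ) ≤ k := by exact_mod_cast hk
  have h1 := h.sub_cover_le hA (by positivity) hg hk hJ
  have h2 := one_sub_inv_pow_le hk
  have h3 : (k : ℝ) * (2 * (3 / (100 * k ^ 2) * cover A J)) = 3 / 50 * (1 / k) * cover A J := by
    field_simp
    ring
  rw [h3] at h1
  have h4 : (0 : ℝ) ≤ cover A J := by positivity
  nlinarith

end Greedy

/-! ### The preparation phase of the program -/

namespace Prog

/-- Sequential composition. -/
def block : List Prog → Prog
  | [] => .skip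
  | P :: Ps => .seq P (block Ps)

section Rules

variable {G : ℝ} {Q : ℕ} {Φ : Store → Prop} {s : Store} {x y z a : ℕ} {P R : Prog}

theorem wp_block_nil : (block []).wp G Q Φ s = Φ s := rfl
theorem wp_block_cons {Ps : List Prog} :
    (block (P :: Ps)).wp G Q Φ s = P.wp G Q ((block Ps).wp G Q Φ) s := rfl
theorem wp_const {c : ℤ} : (Prog.const x c).wp G Q Φ s = Φ (s.setReg x (c : ℝ)) := rfl
theorem wp_copy : (Prog.copy x y).wp G Q Φ s = Φ (s.setReg x (s.reg y)) := rfl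
theorem wp_add : (Prog.op .add x y z).wp G Q Φ s = Φ (s.setReg x (s.reg y + s.reg z)) := rfl
theorem wp_sub : (Prog.op .sub x y z).wp G Q Φ s = Φ (s.setReg x (s.reg y - s.reg z)) := rfl
theorem wp_mul : (Prog.op .mul x y z).wp G Q Φ s =
    (|s.reg z| ≤ G ∧ Φ (s.setReg x (s.reg y * s.reg z))) := rfl
theorem wp_div : (Prog.op .div x y z).wp G Q Φ s =
    (1 ≤ |s.reg z| ∧ Φ (s.setReg x (s.reg y / s.reg z))) := rfl
theorem wp_floor : (Prog.floor x y).wp G Q Φ s = Φ (s.setReg x (⌊s.reg y⌋ : ℝ)) := rfl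
theorem wp_load : (Prog.load x a y).wp G Q Φ s = Φ (s.setReg x (s.arr a ⌊s.reg y⌋₊)) := rfl
theorem wp_store : (Prog.store a y x).wp G Q Φ s = Φ (s.setArr a ⌊s.reg y⌋₊ (s.reg x)) := rfl
theorem wp_skip : Prog.skip.wp G Q Φ s = Φ s := rfl
theorem wp_ite {b : Test} : (Prog.ite b P R).wp G Q Φ s =
    ((b.Holds s → P.wp G Q Φ s) ∧ (¬ b.Holds s → R.wp G Q Φ s)) := rfl

attribute [simp] wp_block_nil wp_block_cons wp_const wp_copy wp_add wp_sub wp_mul wp_div wp_floor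
  wp_load wp_store wp_skip Store.setReg_reg Store.setReg_arr Store.setArr_reg Store.setArr_arr
  Test.Holds

end Rules
end Prog

/-- Integer division and, with the next lemma, remainders are obtained from real division, floor and
subtraction; all digit extraction in the program rests on this. -/
theorem floor_div_natCast (a b : ℕ) : ((⌊(a : ℝ) / (b : ℝ)⌋ : ℤ) : ℝ) = ((a / b : ℕ) : ℝ) := by
  have h : ⌊(a : ℝ) / (b : ℝ)⌋₊ = a / b := Nat.floor_div_eq_div a b
  rw [← h, ← Int.natCast_floor_eq_floor (by positivity)]
  simp

theorem sub_div_mul_natCast (a b : ℕ) : (a : ℝ) - ((a / b : ℕ) : ℝ) * b = ((a % b : ℕ) : ℝ) := by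
  have h := Nat.div_add_mod a b
  have h2 : ((b * (a / b) + a % b : ℕ) : ℝ) = a := by rw [h]
  push_cast at h2 ⊢
  linarith

namespace Input

variable (I : Input)

/-- The number of doublings that bring the failure probability to at least `1`. -/
def bits : ℕ := ⌈Real.logb 2 (1 / I.failure)⌉₊

/-- The number of samples. -/
def samples : ℕ := 20000 * I.k ^ 4 * (2 * I.m + 1 + I.bits)

/-- A common multiple of the sizes of the nonempty supersets. -/
def prodSize (j : ℕ → ℤ) : ℕ := ∏ i ∈ Finset.range I.m, max (I.size j i) 1

/-- Bounds for the quantities that control the running time and the size of the numbers. -/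
structure SizeBound (G : ℝ) (Q : ℕ) : Prop where
  Q_le : (Q : ℝ) ≤ G
  const_le : 20000 ≤ Q
  two_F : 2 * I.F + I.E ≤ Q
  bits : I.bits ≤ Q
  r : ∀ i < I.m, |I.r i| ≤ G
  lam_add_lam : |I.lam + I.lam| ≤ G
  samples : I.samples ≤ Q
  samples_mul : I.samples * I.m ≤ Q
  scale : ∀ i < I.m, (I.scale i : ℝ) ≤ G
  size : ∀ j, ∀ i < I.m, (I.size j i : ℝ) ≤ G
  prodSize : ∀ j, (I.prodSize j : ℝ) ≤ G
  cnt : ∀ (κ : ℕ → ℕ → ℕ), ∀ i < I.m, ∀ t ≤ I.d, ∀ x, (cnt I.C (I.scale i) κ t x : ℝ) ≤ G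
  diff : ∀ a j, I.Coords a j → ∀ i < I.m, ∀ i' < I.m, ∀ t < I.d, ∀ c u : ℕ → ℕ, c t < I.C →
    u t < I.scale i → |(I.point a i c u t : ℝ) - I.p (i' * I.d + t)| ≤ G
  d : I.d ≤ Q
  m : I.m ≤ Q
  k : I.k ≤ Q
  L : I.L ≤ Q
  Lam : I.Lam ≤ Q
  E : I.E ≤ Q
  F : I.F ≤ Q
  Z : I.Z ≤ Q
  C : I.C ≤ Q
  W : I.W ≤ Q
  O : I.O ≤ Q
  X : I.X ≤ Q
  md : I.m * I.d ≤ Q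
  two_L : 2 * I.L + 1 ≤ Q
  d_succ : I.d + 1 ≤ Q
  cells : I.m * (I.d + 1) * I.X ≤ Q
  lam : |I.lam| ≤ G
  l : |I.l| ≤ G

theorem SizeBound.natCast {I : Input} {G : ℝ} {Q : ℕ} (h : I.SizeBound G Q) {n : ℕ} (hn : n ≤ Q) :
    (n : ℝ) ≤ G := (Nat.cast_le.2 hn).trans h.Q_le

/-- The registers that hold the parameters. -/
structure Env (s : Store) : Prop where
  d : s.reg 0 = I.d
  m : s.reg 1 = I.m
  k : s.reg 2 = I.k
  lam : s.reg 3 = I.lam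
  one : s.reg 6 = 1
  L : s.reg 7 = I.L
  E : s.reg 8 = I.E
  F : s.reg 9 = I.F
  Z : s.reg 10 = I.Z
  C : s.reg 11 = I.C
  W : s.reg 12 = I.W
  O : s.reg 13 = I.O
  X : s.reg 14 = I.X
  md : s.reg 15 = (I.m * I.d : ℕ)
  two_L : s.reg 16 = (2 * I.L + 1 : ℕ)
  d_succ : s.reg 29 = (I.d + 1 : ℕ)
  cells : s.reg 40 = (I.m * (I.d + 1) * I.X : ℕ)
  dO : s.reg 51 = I.d * I.O

@[simp]
theorem env_setReg {I : Input} {s : Store} {x : ℕ} {v : ℝ}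
    (hx : x ∉ [0, 1, 2, 3, 6, 7, 8, 9, 10, 11, 12, 13, 14, 15, 16, 29, 40, 51]) :
    I.Env (s.setReg x v) ↔ I.Env s := by
  have key : ∀ y ∈ [0, 1, 2, 3, 6, 7, 8, 9, 10, 11, 12, 13, 14, 15, 16, 29, 40, 51],
      (s.setReg x v).reg y = s.reg y := fun y hy => by
    rw [Store.setReg_reg, if_neg]
    rintro rfl
    exact hx hy
  simp only [List.forall_mem_cons] at key
  obtain ⟨k0, k1, k2, k3, k6, k7, k8, k9, k10, k11, k12, k13, k14, k15, k16, k29, k40, k51, -⟩ :=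
    key
  constructor
  · intro h
    constructor
    exacts [k0 ▸ h.d, k1 ▸ h.m, k2 ▸ h.k, k3 ▸ h.lam, k6 ▸ h.one, k7 ▸ h.L, k8 ▸ h.E, k9 ▸ h.F,
      k10 ▸ h.Z, k11 ▸ h.C, k12 ▸ h.W, k13 ▸ h.O, k14 ▸ h.X, k15 ▸ h.md, k16 ▸ h.two_L,
      k29 ▸ h.d_succ, k40 ▸ h.cells, k51 ▸ h.dO]
  · intro h
    constructor
    exacts [k0.trans h.d, k1.trans h.m, k2.trans h.k, k3.trans h.lam, k6.trans h.one,
      k7.trans h.L, k8.trans h.E, k9.trans h.F, k10.trans h.Z, k11.trans h.C, k12.trans h.W,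
      k13.trans h.O, k14.trans h.X, k15.trans h.md, k16.trans h.two_L, k29.trans h.d_succ,
      k40.trans h.cells, k51.trans h.dO]

@[simp]
theorem env_setArr {I : Input} {s : Store} {x n : ℕ} {v : ℝ} :
    I.Env (s.setArr x n v) ↔ I.Env s :=
  ⟨fun h => ⟨h.d, h.m, h.k, h.lam, h.one, h.L, h.E, h.F, h.Z, h.C, h.W, h.O, h.X, h.md, h.two_L,
    h.d_succ, h.cells, h.dO⟩, fun h => ⟨h.d, h.m, h.k, h.lam, h.one, h.L, h.E, h.F, h.Z, h.C, h.W,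
    h.O, h.X, h.md, h.two_L, h.d_succ, h.cells, h.dO⟩⟩

theorem Env.frame {I : Input} {P : Prog} {s s' : Store} (h : I.Env s) (hf : P.Frame s s')
    (hP : ∀ x ∈ [0, 1, 2, 3, 6, 7, 8, 9, 10, 11, 12, 13, 14, 15, 16, 29, 40, 51],
      P.modReg x = false) : I.Env s' := by
  have key : ∀ x ∈ [0, 1, 2, 3, 6, 7, 8, 9, 10, 11, 12, 13, 14, 15, 16, 29, 40, 51],
      s'.reg x = s.reg x := fun x hx => hf.1 x (hP x hx)
  simp only [List.forall_mem_cons] at key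
  obtain ⟨k0, k1, k2, k3, k6, k7, k8, k9, k10, k11, k12, k13, k14, k15, k16, k29, k40, k51, -⟩ :=
    key
  constructor
  exacts [k0.trans h.d, k1.trans h.m, k2.trans h.k, k3.trans h.lam, k6.trans h.one, k7.trans h.L,
    k8.trans h.E, k9.trans h.F, k10.trans h.Z, k11.trans h.C, k12.trans h.W, k13.trans h.O,
    k14.trans h.X, k15.trans h.md, k16.trans h.two_L, k29.trans h.d_succ, k40.trans h.cells,
    k51.trans h.dO]

end Input

open Prog

/-- Computes the parameters. -/
def paramProg : Prog := block [
  .const 6 1,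
  .op .mul 7 4 4, .floor 7 7,
  .op .mul 8 3 3, .floor 8 8, .op .add 8 8 6,
  .op .mul 8 7 8, .op .add 8 6 8, .op .mul 8 8 0,
  .const 9 8, .op .mul 9 9 0, .op .mul 9 9 8,
  .const 10 3, .op .mul 10 10 9,
  .op .add 11 10 10, .op .add 11 11 6,
  .op .mul 12 10 10, .copy 14 12, .op .mul 12 12 0, .op .add 12 12 6,
  .op .mul 13 10 7,
  .op .mul 20 12 13, .op .add 20 20 20, .op .add 14 14 20, .op .mul 14 14 0, .op .add 14 14 6,
  .op .mul 15 1 0, .op .add 16 7 7, .op .add 16 16 6,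
  .op .add 29 0 6, .op .mul 51 0 13, .op .mul 40 1 29, .op .mul 40 40 14]

theorem paramProg_spec {I : Input} {G : ℝ} {Q : ℕ} (hb : I.SizeBound G Q) :
    paramProg.wp G Q (fun s => I.Env s ∧ s.reg 5 = I.failure ∧ s.arr = I.store.arr) I.store := by
  have hL : ((⌊I.l * I.l⌋ : ℤ) : ℝ) = I.L := by
    rw [Input.L, natCast_floor_eq_intCast_floor (mul_self_nonneg _)]
  have hLam : ((⌊I.lam * I.lam⌋ : ℤ) : ℝ) + 1 = I.Lam := by
    rw [Input.Lam, Nat.cast_add, natCast_floor_eq_intCast_floor (mul_self_nonneg _), Nat.cast_one]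
  have hE : (1 + (I.L : ℝ) * I.Lam) * I.d = I.E := by rw [Input.E]; push_cast; ring
  have hF : 8 * (I.d : ℝ) * I.E = I.F := by rw [Input.F]; push_cast; ring
  have hZ : 3 * (I.F : ℝ) = I.Z := by rw [Input.Z]; push_cast; ring
  have hC : (I.Z : ℝ) + I.Z + 1 = I.C := by rw [Input.C]; push_cast; ring
  have hW : (I.Z : ℝ) * I.Z * I.d + 1 = I.W := by rw [Input.W]; push_cast; ring
  have hO : (I.Z : ℝ) * I.L = I.O := by rw [Input.O]; push_cast; ring
  have hX : ((I.Z : ℝ) * I.Z + (I.W * I.O + I.W * I.O)) * I.d + 1 = I.X := by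
    rw [Input.X]; push_cast; ring
  have hd1 : (I.d : ℝ) + 1 = (I.d + 1 : ℕ) := by push_cast; ring
  have r0 : I.store.reg 0 = I.d := rfl
  have r1 : I.store.reg 1 = I.m := rfl
  have r2 : I.store.reg 2 = I.k := rfl
  have r3 : I.store.reg 3 = I.lam := rfl
  have r4 : I.store.reg 4 = I.l := rfl
  have r5 : I.store.reg 5 = I.failure := rfl
  simp [paramProg, r0, r1, r3, r4, r5, hL, hLam, hE, hF, hZ, hC, hW, hO, hX, hb.lam, hb.l,
    hb.natCast hb.d, hb.natCast hb.Lam, hb.natCast hb.E, hb.natCast hb.F, hb.natCast hb.Z,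
    hb.natCast hb.L, hb.natCast hb.O, hb.natCast hb.X, abs_of_nonneg]
  rw [hd1]
  refine ⟨?_, ?_⟩
  · rw [abs_of_nonneg (by positivity)]
    exact hb.natCast hb.d_succ
  · constructor <;> simp [r0, r1, r2, r3]
    ring
/-- Computes the number of samples. -/
def countProg : Prog := block [
  .copy 20 5, .const 17 0,
  .loop (.lt 20 6) (block [.op .add 20 20 20, .op .add 17 17 6]),
  .op .add 17 17 1, .op .add 17 17 1, .op .add 17 17 6,
  .op .mul 17 17 2, .op .mul 17 17 2, .op .mul 17 17 2, .op .mul 17 17 2,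
  .const 20 20000, .op .mul 17 17 20]

/-- With the next lemma: the doubling loop runs exactly `bits` times, so the machine finds ⌈log₂
(1/γ)⌉ without logarithms. -/
theorem failure_mul_two_pow_lt {I : Input} (hI : I.Valid) {n : ℕ} (hn : n < I.bits) :
    I.failure * 2 ^ n < 1 := by
  have h1 := Nat.lt_ceil.1 hn
  rw [Real.lt_logb_iff_rpow_lt one_lt_two (by have := hI.failure_pos; positivity),
    Real.rpow_natCast, lt_div_iff₀ hI.failure_pos] at h1
  linarith

theorem one_le_failure_mul_two_pow {I : Input} (hI : I.Valid) :
    1 ≤ I.failure * 2 ^ I.bits := by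
  have h1 := Nat.le_ceil (Real.logb 2 (1 / I.failure))
  rw [Real.logb_le_iff_le_rpow one_lt_two (by have := hI.failure_pos; positivity)] at h1
  change 1 / I.failure ≤ (2 : ℝ) ^ ((I.bits : ℕ) : ℝ) at h1
  rw [Real.rpow_natCast, div_le_iff₀ hI.failure_pos] at h1
  linarith

theorem countProg_spec {I : Input} {G : ℝ} {Q : ℕ} (hI : I.Valid) (hb : I.SizeBound G Q)
    {s : Store} (h : I.Env s) (h5 : s.reg 5 = I.failure) :
    countProg.wp G Q (fun s => s.reg 17 = I.samples) s := by
  have hk := hb.natCast hb.k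
  have hc := hb.natCast hb.const_le
  simp only [countProg, wp_block_cons, wp_copy, wp_const]
  refine ⟨fun q s' => q ≤ I.bits ∧ s'.reg 20 = I.failure * 2 ^ (I.bits - q) ∧
    s'.reg 17 = (I.bits - q : ℕ) ∧ s'.reg 6 = 1 ∧ s'.reg 1 = I.m ∧ s'.reg 2 = I.k, I.bits, hb.bits,
    ?_, ?_, ?_⟩
  · simp [h.one, h.m, h.k, h5]
  · rintro q s' ⟨h1, h2, h3, h6, hm, hk⟩
    have e : I.bits - q = I.bits - (q + 1) + 1 := by omega
    simp only [Test.Holds, h2, h6]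
    refine ⟨failure_mul_two_pow_lt hI (by omega), ?_⟩
    simp only [wp_block_cons, wp_block_nil, wp_add]
    simp [h2, h3, h6, hm, hk, e]
    exact ⟨by omega, by ring⟩
  · rintro s' ⟨-, h2, h3, h6, h1, h2'⟩
    simp only [Nat.sub_zero] at h2 h3
    simp only [Test.Holds, h2, h6, not_lt]
    refine ⟨one_le_failure_mul_two_pow hI, ?_⟩
    simp [h1, h2', h3, h6, hk]
    refine ⟨by simpa using hc, ?_⟩
    rw [Input.samples]
    push_cast
    ring

/-- Decomposes the coordinates of the centers. -/
def coordProg : Prog := forLoop 21 15 (block [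
  .load 22 1 21,
  forLoop 23 16 (block [
    .op .sub 24 23 7, .op .mul 25 24 3, .op .sub 25 22 25, .floor 26 25,
    .ite (.le 25 26) (block [.store 3 21 26, .store 4 21 24]) .skip])])

/-- Is `x + y * lam`, with integers `x` and `y`, a decomposition of coordinate `e`? -/
def Input.IsCoord (I : Input) (e : ℕ) (x y : ℝ) : Prop :=
  ∃ a j : ℤ, x = a ∧ y = j ∧ |j| ≤ I.L ∧ I.p e = a + j * I.lam

theorem exists_isCoord {I : Input} (hI : I.Valid) {e : ℕ} (he : e < I.m * I.d) :
    ∃ a : ℤ, ∃ q < 2 * I.L + 1, I.p e = a + ((q : ℝ) - I.L) * I.lam := by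
  have hd := hI.d_pos
  have h1 : e / I.d < I.m := Nat.div_lt_of_lt_mul (by rwa [Nat.mul_comm])
  have h2 : e % I.d < I.d := Nat.mod_lt _ hd
  obtain ⟨a, j, h3, h4, h5⟩ := hI.center_mem ⟨_, h1⟩ ⟨_, h2⟩
  have h6 := Input.p_eq (I := I) ⟨_, h1⟩ ⟨_, h2⟩
  rw [Nat.mul_comm, Nat.div_add_mod, h5] at h6
  have h7 := abs_le.1 (Input.abs_le_L h3 h4)
  refine ⟨a, (j + I.L).toNat, by omega, ?_⟩
  have h8 : ((j + I.L).toNat : ℤ) = j + I.L := Int.toNat_of_nonneg (by linarith)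
  have h9 : (((j + I.L).toNat : ℕ) : ℝ) = j + I.L := by exact_mod_cast h8
  rw [h6, h9]
  ring

/-- Every candidate j in [-L, L] is tried, and integrality of p - jλ is tested against the floor.
Decompositions need not be unique (for rational λ), and any of them serves: later arguments use only
`Coords`. -/
theorem coordProg_spec {I : Input} {G : ℝ} {Q : ℕ} (hI : I.Valid) (hb : I.SizeBound G Q)
    {s : Store} (h : I.Env s) (h1 : s.arr 1 = I.store.arr 1) :
    coordProg.wp G Q (fun s => ∃ a j, I.Coords a j ∧
      ∀ e < I.m * I.d, s.arr 3 e = a e ∧ s.arr 4 e = j e) s := by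
  refine wp_forLoop (fun n s' => ∀ e < n, I.IsCoord e (s'.arr 3 e) (s'.arr 4 e)) h.md h.one hb.md
    (by decide) (by simp) ?_ ?_
  · intro e he s' he' hf hinv
    have h' := h.frame hf (by decide)
    have h1' : s'.arr 1 e = I.p e := by rw [hf.2 1 rfl, h1]; rfl
    simp only [wp_block_cons, wp_load, he', Nat.floor_natCast, h1']
    obtain ⟨a0, q0, hq0, hp⟩ := exists_isCoord hI he
    -- Once the candidate `q0` known to succeed has been passed, a valid decomposition is stored;
    -- later successes overwrite it only with valid ones.
    refine wp_forLoop (n := 2 * I.L + 1) (fun q s'' => (∀ e' < e, I.IsCoord e' (s''.arr 3 e')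
        (s''.arr 4 e')) ∧ (q0 < q → I.IsCoord e (s''.arr 3 e) (s''.arr 4 e)))
      (by simp [h'.two_L]) (by simp [h'.one]) hb.two_L (by decide) (by simpa using hinv) ?_ ?_
    · intro q hq s'' hq' hf' ⟨hi1, hi2⟩
      have e7 : s''.reg 7 = I.L := by rw [hf'.1 7 rfl]; simp [h'.L]
      have e3 : s''.reg 3 = I.lam := by rw [hf'.1 3 rfl]; simp [h'.lam]
      have e22 : s''.reg 22 = I.p e := by rw [hf'.1 22 rfl]; simp
      have e21 : s''.reg 21 = e := by rw [hf'.1 21 rfl]; simp [he']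
      simp only [wp_block_cons, wp_block_nil, wp_ite, wp_sub, wp_mul, wp_floor, wp_store, wp_skip,
        Store.setReg_reg, Store.setReg_arr, Store.setArr_reg, Store.setArr_arr, Test.Holds]
      simp only [hq', e7, e3, e22, e21]
      refine ⟨by simpa using hb.lam, fun ht => ?_, fun ht => ?_⟩
      · have hfl : (⌊I.p e - ((q : ℝ) - I.L) * I.lam⌋ : ℝ) =
            I.p e - ((q : ℝ) - I.L) * I.lam := le_antisymm (Int.floor_le _) (by simpa using ht)
        refine ⟨fun e' he' => ?_, fun _ => ?_⟩
        · simpa [he'.ne, Store.setArr_arr] using hi1 e' he'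
        · refine ⟨⌊I.p e - ((q : ℝ) - I.L) * I.lam⌋, (q : ℤ) - I.L, by simp, by simp,
            by rw [abs_le]; constructor <;> omega, ?_⟩
          rw [hfl]
          push_cast
          ring
      · refine ⟨hi1, fun hq1 => ?_⟩
        rcases Nat.lt_succ_iff_lt_or_eq.1 hq1 with hq2 | rfl
        · exact hi2 hq2
        · exact absurd (by simp [hp]) ht
    · rintro s'' - - ⟨hi1, hi2⟩
      simp only [wp_block_nil, Store.setReg_arr]
      intro e' he'
      rcases Nat.lt_succ_iff_lt_or_eq.1 he' with he' | rfl
      · exact hi1 e' he'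
      · exact hi2 hq0
  · intro s' _ _ hinv
    have key : ∀ e, ∃ a j : ℤ, e < I.m * I.d → s'.arr 3 e = a ∧ s'.arr 4 e = j ∧ |j| ≤ I.L ∧
        I.p e = a + j * I.lam := by
      intro e
      by_cases he : e < I.m * I.d
      · obtain ⟨a, j, haj⟩ := hinv e he
        exact ⟨a, j, fun _ => haj⟩
      · exact ⟨0, 0, fun h => absurd h he⟩
    choose a j haj using key
    exact ⟨a, j, ⟨fun e he => (haj e he).2.2.1, fun e he => (haj e he).2.2.2⟩,
      fun e he => ⟨(haj e he).1, (haj e he).2.1⟩⟩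

/-- Computes the scales of the balls, and the conditions on the keys. -/
def scaleProg : Prog := forLoop 21 1 (block [
  .load 22 0 21, .const 26 0,
  forLoop 27 0 (block [.op .mul 28 21 0, .op .add 28 28 27, .load 28 4 28, .op .mul 28 28 28,
    .op .add 26 26 28]),
  .ite (.lt 22 9)
    (block [.store 5 21 6, .op .mul 23 22 22, .op .mul 26 26 3, .op .mul 26 26 3,
      .op .sub 23 23 26, .store 6 21 23, .op .add 24 3 3, .store 7 21 24])
    (block [.op .div 23 22 9, .floor 23 23, .store 5 21 23, .op .div 24 22 23, .op .add 24 24 8,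
      .op .mul 24 24 24, .store 6 21 24, .const 24 0, .store 7 21 24])])

theorem coord_abs_le {I : Input} {a j : ℕ → ℤ} (h : I.Coords a j) {e : ℕ} (he : e < I.m * I.d) :
    |(j e : ℝ)| ≤ I.L := by exact_mod_cast h.abs_le e he

theorem scaleProg_spec {I : Input} {G : ℝ} {Q : ℕ} (hI : I.Valid) (hb : I.SizeBound G Q)
    {s : Store} (h : I.Env s) (h0 : s.arr 0 = I.store.arr 0) {a j : ℕ → ℤ} (hj : I.Coords a j)
    (h4 : ∀ e < I.m * I.d, s.arr 4 e = j e) :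
    scaleProg.wp G Q (fun s => ∀ i < I.m, s.arr 5 i = I.scale i ∧ s.arr 6 i = I.thresh j i ∧
      s.arr 7 i = I.slope i) s := by
  have hF : (1 : ℝ) ≤ I.F := by exact_mod_cast Input.F_pos hI.d_pos
  refine wp_forLoop (fun n s => ∀ i < n, s.arr 5 i = I.scale i ∧ s.arr 6 i = I.thresh j i ∧
      s.arr 7 i = I.slope i) h.m h.one hb.m (by decide) (by simp) ?_ fun _ _ _ h => h
  intro i hi s' hi' hf hinv
  have h' := h.frame hf (by decide)
  have h0' : s'.arr 0 i = I.r i := by rw [hf.2 0 rfl, h0]; rfl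
  have hr0 : 0 < I.r i := by rw [Input.r_eq ⟨i, hi⟩]; exact hI.radius_pos ⟨i, hi⟩
  simp only [wp_block_cons, wp_load, wp_const, hi', Nat.floor_natCast, h0']
  refine wp_forLoop (n := I.d) (fun n s => s.reg 26 =
      ∑ t ∈ Finset.range n, (j (i * I.d + t) : ℝ) * j (i * I.d + t))
    (by simp [h'.d]) (by simp [h'.one]) hb.d (by decide) (by simp) ?_ ?_
  · intro t ht s'' ht' hf' hinv'
    have e0 : s''.reg 0 = I.d := by rw [hf'.1 0 rfl]; simp [h'.d]
    have e21 : s''.reg 21 = i := by rw [hf'.1 21 rfl]; simp [hi']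
    have hidx := Input.idx_lt (I := I) ⟨i, hi⟩ ht
    have e4 : s''.arr 4 (i * I.d + t) = j (i * I.d + t) := by
      rw [hf'.2 4 rfl]
      simp [hf.2 4 rfl, h4 _ hidx]
    have hfl : ⌊(i : ℝ) * I.d + t⌋₊ = i * I.d + t := by
      exact_mod_cast Nat.floor_natCast (i * I.d + t)
    have hjQ := (coord_abs_le hj hidx).trans (hb.natCast hb.L)
    simp [ht', e0, e21, hfl, e4, hinv', hb.natCast hb.d, Finset.sum_range_succ, hjQ]
  · intro s'' _ hf' hinv'
    have e21 : s''.reg 21 = i := by rw [hf'.1 21 rfl]; simp [hi']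
    have e22 : s''.reg 22 = I.r i := by rw [hf'.1 22 rfl]; simp
    have e9 : s''.reg 9 = I.F := by rw [hf'.1 9 rfl]; simp [h'.F]
    have e8 : s''.reg 8 = I.E := by rw [hf'.1 8 rfl]; simp [h'.E]
    have e6 : s''.reg 6 = 1 := by rw [hf'.1 6 rfl]; simp [h'.one]
    have e3 : s''.reg 3 = I.lam := by rw [hf'.1 3 rfl]; simp [h'.lam]
    have e5' : s''.arr 5 = s'.arr 5 := by rw [hf'.2 5 rfl]; simp
    have e6' : s''.arr 6 = s'.arr 6 := by rw [hf'.2 6 rfl]; simp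
    have e7' : s''.arr 7 = s'.arr 7 := by rw [hf'.2 7 rfl]; simp
    simp only [wp_ite, Test.Holds, e22, e9, wp_block_cons]
    refine ⟨fun hr => ?_, fun hr => ?_⟩
    · simp [e21, e22, e6, e3, hinv', hb.r i hi, hb.lam, e5', e6', e7']
      intro i' hi'
      rcases lt_or_eq_of_le hi' with hi' | rfl
      · simpa [hi'.ne] using hinv i' hi'
      · simp [Input.scale, Input.thresh, Input.slope, hr]
    · have hsc : (⌊I.r i / I.F⌋ : ℝ) = I.scale i := by
        rw [Input.scale, if_neg hr, natCast_floor_eq_intCast_floor (by positivity)]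
      have hs1 : (1 : ℝ) ≤ I.scale i := by exact_mod_cast Input.one_le_scale i hI.d_pos
      -- This number is the second factor of a product. The quotient is at most 2 F although r
      -- itself is not polynomially bounded.
      have hle : |I.r i / I.scale i + I.E| ≤ G := by
        rw [abs_of_nonneg (by positivity)]
        have h1 := (Input.two_mul_scale_mul_E_le hI.d_pos hr).2
        have h2 : I.r i / I.scale i ≤ 2 * I.F := by
          rw [div_le_iff₀ (by linarith)]; linarith
        have h3 := hb.natCast hb.two_F
        push_cast at h3
        linarith
      simp [e21, e22, e9, e8, hsc, hle, e5', e6', e7', abs_of_nonneg, hF, hs1]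
      intro i' hi'
      rcases lt_or_eq_of_le hi' with hi' | rfl
      · simpa [hi'.ne] using hinv i' hi'
      · simp [Input.thresh, Input.slope, hr]

/-- Computes the number of vectors with a given last component and key. It expects the address of
a cell in register `30`, its key in `31`, the index of the coordinate in `32`, the scale in `33`
and the component in `34`. -/
def wtProg : Prog := block [
  .op .sub 38 34 10, .load 39 4 32, .op .mul 39 38 39, .op .add 39 39 13, .op .mul 39 39 12,
  .op .mul 36 38 38, .op .add 36 36 39,
  .ite (.le 36 31)
    (block [.op .sub 37 30 14, .op .sub 37 37 36, .load 37 9 37, .op .mul 35 37 33])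
    (.const 35 0)]

variable (I : Input) in
/-- The address of a cell. -/
def Input.addr (i t x : ℕ) : ℕ := (i * (I.d + 1) + t) * I.X + x

variable (I : Input) in
/-- The content of a cell. -/
def Input.cell (j : ℕ → ℤ) (i t x : ℕ) : ℕ := cnt I.C (I.scale i) (I.ballKey j i) t x

theorem coordKey_real {I : Input} {a j : ℕ → ℤ} (h : I.Coords a j) {e c : ℕ}
    (he : e < I.m * I.d) (hc : c < I.C) :
    ((c : ℝ) - I.Z) * ((c : ℝ) - I.Z) + (((c : ℝ) - I.Z) * j e + I.O) * I.W =
      I.coordKey j e c := by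
  have := congrArg (Int.cast : ℤ → ℝ) (Input.coordKey_cast h he hc)
  rw [Int.cast_natCast] at this
  rw [this]
  push_cast
  ring

/-- Rows of length `X` are stored consecutively, so cell (t, x - κ) has the address of cell (t + 1,
x) minus X minus κ. -/
theorem wtProg_spec {I : Input} {G : ℝ} {Q : ℕ} (hb : I.SizeBound G Q)
    {s : Store} (h : I.Env s) {a j : ℕ → ℤ} (hj : I.Coords a j) {i t x c : ℕ} (hi : i < I.m)
    (ht : t < I.d) (hc : c < I.C)
    (h4 : s.arr 4 (i * I.d + t) = j (i * I.d + t))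
    (h9 : ∀ x' ≤ x, s.arr 9 (I.addr i t x') = I.cell j i t x')
    (h30 : s.reg 30 = I.addr i (t + 1) x) (h31 : s.reg 31 = x)
    (h32 : s.reg 32 = (i * I.d + t : ℕ)) (h33 : s.reg 33 = I.scale i) (h34 : s.reg 34 = c) :
    wtProg.wp G Q (fun s => s.reg 35 = wt I.C (I.scale i) (I.ballKey j i) t x c ∧
      s.reg 36 = I.ballKey j i t c ∧
      (I.ballKey j i t c ≤ x → s.reg 37 = I.cell j i t (x - I.ballKey j i t c))) s := by
  have hidx := Input.idx_lt (I := I) ⟨i, hi⟩ ht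
  have hjQ := (coord_abs_le hj hidx).trans (hb.natCast hb.L)
  have hz : |(c : ℝ) - I.Z| ≤ G := by
    have h1 : (c : ℝ) < 2 * I.Z + 1 := by rw [Input.C] at hc; exact_mod_cast hc
    have h1' : (c : ℝ) ≤ 2 * I.Z := by rw [Input.C] at hc; exact_mod_cast Nat.lt_succ_iff.1 hc
    have h2 := hb.natCast hb.Z
    have h3 : (0 : ℝ) ≤ c := by positivity
    rw [abs_le]; constructor <;> linarith
  have hkey := coordKey_real hj hidx hc
  have hbk : I.ballKey j i t c = I.coordKey j (i * I.d + t) c := rfl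
  rw [hbk]
  simp [wtProg, h31, h30, h32, h33, h34, h.Z, h.O, h.W, h.X, h4, hjQ, hz, hb.natCast hb.W,
    hkey, wp_ite, hb.scale i hi, -Nat.cast_add, -Nat.cast_mul]
  refine ⟨fun hle => ?_, fun hle => ?_⟩
  · have haddr : I.addr i (t + 1) x - I.X - I.coordKey j (i * I.d + t) c =
        I.addr i t (x - I.coordKey j (i * I.d + t) c) := by
      rw [Input.addr, Input.addr, ← add_assoc, Nat.succ_mul]
      omega
    rw [haddr, h9 _ (Nat.sub_le _ _), wt, hbk, if_pos hle]
    refine ⟨?_, fun _ => rfl⟩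
    rw [Input.cell]
    push_cast
    ring
  · rw [wt, hbk, if_neg (not_le.2 hle)]
    simp [not_le.2 hle]

/-- Fills the table of the numbers of vectors with given keys. -/
def cellProg : Prog := forLoop 30 40 (block [
  .op .div 41 30 14, .floor 41 41, .op .mul 42 41 14, .op .sub 31 30 42,
  .op .div 43 41 29, .floor 43 43, .op .mul 42 43 29, .op .sub 44 41 42,
  .ite (.lt 44 6)
    (.ite (.lt 31 6) (.const 45 1) (.const 45 0))
    (block [.op .mul 32 43 0, .op .add 32 32 44, .op .sub 32 32 6, .load 33 5 43, .const 45 0,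
      forLoop 34 11 (block [wtProg, .op .add 45 45 35])]),
  .store 9 30 45])

/-- Dynamic programming by increasing address: the row for t vectors entries precedes the row for t
+ 1, so all cells in the recursion of `cnt` are already filled. One loop over addresses replaces
three nested ones; ball, row and key are recovered by division. -/
theorem cellProg_spec {I : Input} {G : ℝ} {Q : ℕ} (hb : I.SizeBound G Q)
    {s : Store} (h : I.Env s) {a j : ℕ → ℤ} (hj : I.Coords a j)
    (h4 : ∀ e < I.m * I.d, s.arr 4 e = j e) (h5 : ∀ i < I.m, s.arr 5 i = I.scale i) :
    cellProg.wp G Q (fun s => ∀ i < I.m, ∀ t ≤ I.d, ∀ x < I.X,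
      s.arr 9 (I.addr i t x) = I.cell j i t x) s := by
  have hXpos : 0 < I.X := Nat.succ_pos _
  have addr_div : ∀ {i t x}, x < I.X → I.addr i t x / I.X = i * (I.d + 1) + t ∧
      I.addr i t x % I.X = x := fun hx => Input.coord_div_mod hx
  refine wp_forLoop (fun n s => ∀ A < n, s.arr 9 A =
      I.cell j (A / I.X / (I.d + 1)) (A / I.X % (I.d + 1)) (A % I.X)) h.cells h.one hb.cells
    (by decide) (by simp) ?_ ?_
  · intro A hA s' hA' hf hinv
    have h' := h.frame hf (by decide)
    have hi : A / I.X / (I.d + 1) < I.m := by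
      rw [Nat.div_div_eq_div_mul]
      refine Nat.div_lt_of_lt_mul ?_
      rw [Nat.mul_comm I.X, Nat.mul_comm _ I.m, ← Nat.mul_assoc]
      exact hA
    have ht : A / I.X % (I.d + 1) < I.d + 1 := Nat.mod_lt _ (by omega)
    have hx : A % I.X < I.X := Nat.mod_lt _ hXpos
    have hAeq : A = I.addr (A / I.X / (I.d + 1)) (A / I.X % (I.d + 1)) (A % I.X) := by
      rw [Input.addr, Nat.mul_comm _ (I.d + 1), Nat.div_add_mod, Nat.mul_comm, Nat.div_add_mod]
    set i := A / I.X / (I.d + 1) with hidef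
    set t := A / I.X % (I.d + 1) with htdef
    set x := A % I.X with hxdef
    have hX1 : (1 : ℝ) ≤ I.X := by exact_mod_cast hXpos
    have f1 : ((A : ℝ) - ((A / I.X : ℕ) : ℝ) * I.X) = x := sub_div_mul_natCast A I.X
    have f2 : (((A / I.X : ℕ) : ℝ) - ((i : ℕ) : ℝ) * ((I.d + 1 : ℕ) : ℝ)) = t :=
      sub_div_mul_natCast (A / I.X) (I.d + 1)
    have f3 : (⌊((A / I.X : ℕ) : ℝ) / ((I.d + 1 : ℕ) : ℝ)⌋ : ℝ) = i := floor_div_natCast _ _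
    have hfin : ∀ arr : ℕ → ℝ, (∀ A' < A, arr A' = s'.arr 9 A') → ∀ v : ℝ,
        v = I.cell j i t x → ∀ A' ≤ A, (if A' = A then v else arr A') =
          I.cell j (A' / I.X / (I.d + 1)) (A' / I.X % (I.d + 1)) (A' % I.X) := by
      intro arr harr v hv A' hA'
      rcases lt_or_eq_of_le hA' with hA' | rfl
      · rw [if_neg hA'.ne, harr A' hA', hinv A' hA']
      · rw [if_pos rfl, hv]
    simp [wp_ite, hA', h'.X, h'.d_succ, floor_div_natCast, f1, f2, f3, h'.one, h'.d,
      hb.natCast hb.X, hX1, -Nat.cast_add]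
    refine ⟨hb.natCast hb.d_succ, fun ht0 => ⟨fun hx0 => hfin _ (fun _ _ => rfl) _ ?_,
      fun hx0 => hfin _ (fun _ _ => rfl) _ ?_⟩, fun ht0 => ⟨hb.natCast hb.d, ?_⟩⟩
    · simp [ht0, hx0, Input.cell, cnt]
    · simp [ht0, hx0, Input.cell, cnt]
    obtain ⟨t', ht'⟩ := Nat.exists_eq_succ_of_ne_zero ht0
    rw [ht']
    have ht'd : t' < I.d := by omega
    have hidx : (i : ℝ) * I.d + (t'.succ : ℕ) - 1 = (i * I.d + t' : ℕ) := by push_cast; ring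
    rw [hidx]
    refine wp_forLoop (fun q st => st.reg 45 =
        (∑ c ∈ Finset.range q, wt I.C (I.scale i) (I.ballKey j i) t' x c : ℕ))
      (by simp [h'.C]) (by simp [h'.one]) hb.C (by decide) (by simp) ?_ ?_
    · intro c hc st hc' hf' hinv'
      have hst : I.Env st := Input.Env.frame (by simpa using h') hf' (by decide)
      refine wp_seq (wtProg_spec (x := x) hb hst hj hi ht'd hc ?_ ?_ ?_ ?_ ?_ ?_ hc') ?_
      · rw [hf'.2 4 rfl]
        simp [hf.2 4 rfl, h4 _ (Input.idx_lt ⟨i, hi⟩ ht'd)]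
      · intro x' hx'
        have hx'X : x' < I.X := hx'.trans_lt hx
        rw [hf'.2 9 rfl]
        have hlt : I.addr i t' x' < A := by
          rw [hAeq, ht', Input.addr, Input.addr, Nat.succ_eq_add_one, ← add_assoc, Nat.succ_mul]
          omega
        simp only [Store.setReg_arr]
        rw [hinv _ hlt, (addr_div hx'X).1, (addr_div hx'X).2,
          (Input.coord_div_mod (by omega)).1, (Input.coord_div_mod (by omega)).2]
      · rw [hf'.1 30 rfl]
        simp [hA']
        exact hAeq.trans (congrArg (fun t => I.addr i t x) ht')
      · rw [hf'.1 31 rfl]; simp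
      · rw [hf'.1 32 rfl]; simp
      · rw [hf'.1 33 rfl]; simp [hf.2 5 rfl, h5 i hi]
      · rintro st' ⟨h35, -, -⟩ hf''
        have e45 := hf''.1 45 rfl
        simp [h35, e45, hinv', Finset.sum_range_succ]
    · intro st _ hf' hinv'
      have e30 : st.reg 30 = A := by rw [hf'.1 30 rfl]; simp [hA']
      have e9 : st.arr 9 = s'.arr 9 := by rw [hf'.2 9 rfl]; simp
      simp [e30, e9, hinv']
      exact hfin _ (fun _ _ => rfl) _ (by rw [ht', Input.cell, cnt_succ]; push_cast; rfl)
  · intro s' _ _ hinv i hi t ht x hx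
    have hlt : I.addr i t x < I.m * (I.d + 1) * I.X := by
      rw [Input.addr]
      calc _ < (i * (I.d + 1) + t + 1) * I.X := by rw [Nat.succ_mul]; omega
        _ ≤ _ := by
            gcongr
            calc i * (I.d + 1) + t + 1 ≤ (i + 1) * (I.d + 1) := by rw [Nat.succ_mul]; omega
              _ ≤ _ := Nat.mul_le_mul_right _ hi
    rw [hinv _ hlt, (addr_div hx).1, (addr_div hx).2, (Input.coord_div_mod (by omega)).1,
      (Input.coord_div_mod (by omega)).2]

/-- Computes the number of vectors with a given key, if the key is acceptable. It expects the key
in register `31`, the address of the last row of the table of the ball in `46`, and the condition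
on keys in `47` and `48`. -/
def topProg : Prog := block [
  .op .div 49 31 12, .floor 49 49, .op .mul 50 49 12, .op .sub 50 31 50, .op .sub 49 49 51,
  .op .mul 49 49 48, .op .add 49 49 47,
  .ite (.le 50 49) (block [.op .add 37 46 31, .load 35 9 37]) (.const 35 0)]

theorem topProg_spec {I : Input} {G : ℝ} {Q : ℕ} (hb : I.SizeBound G Q)
    {s : Store} (h : I.Env s) {j : ℕ → ℤ} {i x : ℕ}
    (h9 : s.arr 9 (I.addr i I.d x) = I.cell j i I.d x)
    (h31 : s.reg 31 = x) (h46 : s.reg 46 = I.addr i I.d 0) (h47 : s.reg 47 = I.thresh j i)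
    (h48 : s.reg 48 = I.slope i) :
    topProg.wp G Q (fun s => s.reg 35 =
      topWt I.C (I.scale i) (I.ballKey j i) I.d (I.acc j i) x) s := by
  have hW : (1 : ℝ) ≤ I.W := by exact_mod_cast Nat.succ_pos _
  have hsl : |I.slope i| ≤ G := by
    rw [Input.slope]
    split_ifs
    · exact hb.lam_add_lam
    · have := hb.natCast (Nat.zero_le Q)
      simpa using this
  have f1 : (x : ℝ) - ((x / I.W : ℕ) : ℝ) * I.W = (x % I.W : ℕ) := sub_div_mul_natCast x I.W
  have hacc : I.acc j i x ↔ ((x % I.W : ℕ) : ℝ) ≤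
      (((x / I.W : ℕ) : ℝ) - I.d * I.O) * I.slope i + I.thresh j i := by
    rw [add_comm]; rfl
  have hadd : I.addr i I.d 0 + x = I.addr i I.d x := by simp [Input.addr]
  simp [topProg, h31, h46, h47, h48, h.W, h.dO, wp_ite, floor_div_natCast, hW, hb.natCast hb.W,
    hsl, f1]
  refine ⟨fun hle => ?_, fun hlt => ?_⟩
  · rw [topWt, if_pos (hacc.2 hle)]
    have : ⌊((I.addr i I.d 0 : ℕ) : ℝ) + x⌋₊ = I.addr i I.d x := by
      rw [← hadd]; exact_mod_cast Nat.floor_natCast _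
    simpa [this, hadd, Input.cell] using h9
  · rw [topWt, if_neg fun ha => absurd (hacc.1 ha) (not_le.2 hlt), Nat.cast_zero]

/-- Computes the sizes of the supersets and the number of outcomes of the random experiment. -/
def sizeProg : Prog := block [
  .const 18 1,
  forLoop 43 1 (block [
    .op .mul 46 43 29, .op .add 46 46 0, .op .mul 46 46 14, .load 47 6 43, .load 48 7 43,
    .const 45 0, forLoop 31 14 (block [topProg, .op .add 45 45 35]), .store 10 43 45,
    .ite (.lt 45 6) .skip (.op .mul 18 18 45)]),
  .const 19 1,
  forLoop 52 17 (.op .mul 19 19 18)]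

theorem sizeProg_spec {I : Input} {G : ℝ} {Q : ℕ} (hb : I.SizeBound G Q)
    {s : Store} (h : I.Env s) {j : ℕ → ℤ}
    (h6 : ∀ i < I.m, s.arr 6 i = I.thresh j i) (h7 : ∀ i < I.m, s.arr 7 i = I.slope i)
    (h9 : ∀ i < I.m, ∀ t ≤ I.d, ∀ x < I.X, s.arr 9 (I.addr i t x) = I.cell j i t x)
    (h17 : s.reg 17 = I.samples) :
    sizeProg.wp G Q (fun s => (∀ i < I.m, s.arr 10 i = I.size j i) ∧
      s.reg 18 = I.prodSize j ∧ s.reg 19 = (I.prodSize j ^ I.samples : ℕ)) s := by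
  simp only [sizeProg, wp_block_cons, wp_const]
  refine wp_forLoop (n := I.m) (fun n s => (∀ i < n, s.arr 10 i = I.size j i) ∧
    s.reg 18 = (∏ i ∈ Finset.range n, max (I.size j i) 1 : ℕ)) (by simp [h.m]) (by simp [h.one])
    hb.m (by decide) (by simp) ?_ ?_
  · intro i hi s' hi' hf ⟨hinv1, hinv2⟩
    have h' : I.Env s' := Input.Env.frame (by simpa using h) hf (by decide)
    have h6' : s'.arr 6 i = I.thresh j i := by rw [hf.2 6 rfl]; simp [h6 i hi]
    have h7' : s'.arr 7 i = I.slope i := by rw [hf.2 7 rfl]; simp [h7 i hi]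
    have h9' : s'.arr 9 = s.arr 9 := by rw [hf.2 9 rfl]; simp
    have h46 : ((i : ℝ) * (I.d + 1 : ℕ) + I.d) * I.X = (I.addr i I.d 0 : ℕ) := by
      rw [Input.addr]; push_cast; ring
    have g1 : |((I.d + 1 : ℕ) : ℝ)| ≤ G := by
      rw [abs_of_nonneg (by positivity)]; exact hb.natCast hb.d_succ
    simp only [wp_block_cons, wp_mul, wp_add, wp_load, wp_const]
    simp only [hi', h'.d_succ, h'.d, h'.X, h46, h6', h7', Store.setReg_reg, Store.setReg_arr,
      Nat.floor_natCast, if_true, Nat.reduceEqDiff, if_false]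
    refine ⟨g1, by simpa [h'.X] using hb.natCast hb.X, ?_⟩
    refine wp_forLoop (n := I.X) (fun n st => st.reg 45 = (∑ x ∈ Finset.range n,
        topWt I.C (I.scale i) (I.ballKey j i) I.d (I.acc j i) x : ℕ))
      (by simp [h'.X]) (by simp [h'.one]) hb.X (by decide) (by simp) ?_ ?_
    · intro x hx st hx' hf' hinv'
      have hst : I.Env st := Input.Env.frame (by simpa using h') hf' (by decide)
      refine wp_seq (topProg_spec (j := j) (i := i) (x := x) hb hst ?_ hx' ?_ ?_ ?_) ?_
      · rw [hf'.2 9 rfl]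
        simp [h9', h9 i hi I.d le_rfl x hx]
      · rw [hf'.1 46 rfl]; simp
      · rw [hf'.1 47 rfl]; simp
      · rw [hf'.1 48 rfl]; simp
      · rintro st' h35 hf''
        have e45 := hf''.1 45 rfl
        simp [h35, e45, hinv', Finset.sum_range_succ]
    · intro st _ hf' hinv'
      have hst : I.Env st := Input.Env.frame (by simpa using h') hf' (by decide)
      have e43 : st.reg 43 = i := by rw [hf'.1 43 rfl]; simp [hi']
      have e18 : st.reg 18 = s'.reg 18 := by rw [hf'.1 18 rfl]; simp
      have e10 : st.arr 10 = s'.arr 10 := by rw [hf'.2 10 rfl]; simp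
      have e45 : st.reg 45 = I.size j i := hinv'
      have hold : ∀ i' ≤ i, (if i' = i then (I.size j i : ℝ) else s'.arr 10 i') = I.size j i' := by
        intro i' hi'
        rcases lt_or_eq_of_le hi' with hi' | rfl
        · rw [if_neg hi'.ne, hinv1 i' hi']
        · rw [if_pos rfl]
      simp [e43, e18, e10, e45, hst.one, wp_ite, hinv2, Finset.prod_range_succ, hb.size j i hi]
      refine ⟨fun h0 => ⟨hold, ?_⟩, fun h0 => ⟨hold, ?_⟩⟩
      · simp [h0]
      · exact Or.inl (Nat.one_le_iff_ne_zero.2 h0)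
  · intro s' _ hf ⟨hinv1, hinv2⟩
    have h' : I.Env s' := Input.Env.frame (by simpa using h) hf (by decide)
    have e17 : s'.reg 17 = I.samples := by rw [hf.1 17 rfl]; simp [h17]
    -- The power itself exceeds G in general; only the fixed second factor, `prodSize`, has to be
    -- bounded by G.
    refine wp_forLoop (n := I.samples) (fun n st => st.reg 19 = (I.prodSize j ^ n : ℕ))
      (by simp [e17]) (by simp [h'.one]) hb.samples (by decide) (by simp) ?_ ?_
    · intro n hn st hn' hf' hinv'
      have e18 : st.reg 18 = I.prodSize j := by rw [hf'.1 18 rfl]; simpa [Input.prodSize] using hinv2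
      simp [e18, hinv', hb.prodSize j, pow_succ]
    · intro st _ hf' hinv'
      have e18 : st.reg 18 = I.prodSize j := by rw [hf'.1 18 rfl]; simpa [Input.prodSize] using hinv2
      have e10 : st.arr 10 = s'.arr 10 := by rw [hf'.2 10 rfl]; simp
      simp only [wp_block_nil]
      exact ⟨fun i hi => by rw [e10, hinv1 i hi], e18, hinv'⟩

/-! ### The sampling phase of the program -/

namespace Prog

theorem wp_loop {G : ℝ} {Q : ℕ} {b : Test} {P : Prog} {Φ : Store → Prop} {s : Store}
    (Inv : ℕ → Store → Prop) (q : ℕ) (hq : q ≤ Q) (h0 : Inv q s)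
    (h1 : ∀ n s', P.Frame s s' → Inv (n + 1) s' → b.Holds s' ∧ P.wp G Q (Inv n) s')
    (h2 : ∀ s', P.Frame s s' → Inv 0 s' → ¬ b.Holds s' ∧ Φ s') : (Prog.loop b P).wp G Q Φ s :=
  ⟨fun n s' => Inv n s' ∧ P.Frame s s', q, hq, ⟨h0, Frame.refl _ _⟩,
    fun n s' hs' => ⟨(h1 n s' hs'.2 hs'.1).1, wp_mono (wp_frame (h1 n s' hs'.2 hs'.1).2)
      fun _ h' => ⟨h'.1, hs'.2.trans h'.2⟩⟩, fun s' hs' => h2 s' hs'.2 hs'.1⟩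

/-- Finds the first index at which the running sum of the weights, which are computed by `P` in
register `35`, exceeds register `57`, and subtracts the preceding weights from that register. -/
def scan (x : ℕ) (P : Prog) : Prog :=
  block [.const x 0, P, .loop (.le 35 57) (block [.op .sub 57 57 35, .op .add x x 6, P])]

/-- The computational form of `exists_sum_range_add`: subtracting weights until the next one is too
large locates interval and offset. `Ψ` carries over whatever else the last evaluation of `P` leaves
in the memory. -/
theorem wp_scan {G : ℝ} {Q : ℕ} {x : ℕ} {P : Prog} {Φ : Store → Prop} {s : Store} {v : ℕ → ℕ}
    {Ψ : ℕ → Store → Prop} {n rest : ℕ} (hn : n ≤ Q) (hrest : rest < v n)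
    (hm : P.modReg x = false ∧ P.modReg 57 = false ∧ P.modReg 6 = false ∧ x ≠ 57 ∧ x ≠ 6 ∧ x ≠ 35)
    (h6 : s.reg 6 = 1) (h57 : s.reg 57 = (∑ i ∈ Finset.range n, v i + rest : ℕ))
    (hP : ∀ i ≤ n, ∀ st, (scan x P).Frame s st → st.reg x = (i : ℝ) →
      P.wp G Q (fun st' => st'.reg 35 = v i ∧ Ψ i st') st)
    (hΦ : ∀ st, (scan x P).Frame s st → st.reg x = (n : ℝ) → st.reg 57 = (rest : ℝ) →
      Ψ n st → Φ st) : (scan x P).wp G Q Φ s := by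
  obtain ⟨m1, m2, m3, m4, m5, m6⟩ := hm
  have fr : ∀ st, (∀ y, y ≠ x → y ≠ 57 → P.modReg y = false → st.reg y = s.reg y) →
      (∀ y, P.modArr y = false → st.arr y = s.arr y) → (scan x P).Frame s st := by
    intro st h1 h2
    refine ⟨fun y hy => ?_, fun y hy => ?_⟩
    · simp only [scan, block, modReg, Bool.or_eq_false_iff, beq_eq_false_iff_ne] at hy
      exact h1 y hy.1 hy.2.2.1.1 hy.2.1
    · simp only [scan, block, modArr, Bool.or_eq_false_iff] at hy
      exact h2 y hy.2.1
  have fr0 : (scan x P).Frame s (s.setReg x 0) :=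
    fr _ (fun y h1 _ _ => by simp [h1]) fun y _ => rfl
  simp only [scan, wp_block_cons, wp_const, Int.cast_zero]
  refine wp_mono (wp_frame (hP 0 (Nat.zero_le _) _ fr0 (by simp))) fun s1 ⟨⟨h35, hΨ⟩, hf1⟩ => ?_
  have hs1 : (scan x P).Frame s s1 := fr0.trans
    ⟨fun y hy => hf1.1 y (by
        simp only [scan, block, modReg, Bool.or_eq_false_iff] at hy; exact hy.2.1),
      fun y hy => hf1.2 y (by
        simp only [scan, block, modArr, Bool.or_eq_false_iff] at hy; exact hy.2.1)⟩
  have hfr : ∀ st, (block [.op .sub 57 57 35, .op .add x x 6, P]).Frame s1 st →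
      (scan x P).Frame s st := fun st hst => hs1.trans
    ⟨fun y hy => hst.1 y (by
        simp only [scan, block, modReg, Bool.or_eq_false_iff] at hy ⊢; exact hy.2.2.1),
      fun y hy => hst.2 y (by
        simp only [scan, block, modArr, Bool.or_eq_false_iff] at hy ⊢; exact hy.2.2.1)⟩
  have s6 : s1.reg 6 = 1 := by rw [hf1.1 6 m3]; simp [m5.symm, h6]
  have hbm6 : (block [.op .sub 57 57 35, .op .add x x 6, P]).modReg 6 = false := by
    simp [block, modReg, m3, m5.symm]
  -- At index i the register still holds the weights from i to n - 1 plus the offset. As the offset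
  -- is below the weight at n, the loop stops exactly there.
  refine wp_loop (fun r st => ∃ i, i + r = n ∧ st.reg x = i ∧ st.reg 35 = v i ∧ Ψ i st ∧
    st.reg 57 = (∑ y ∈ Finset.Ico i n, v y + rest : ℕ)) n hn ⟨0, by simp, ?_, h35, hΨ, ?_⟩ ?_ ?_
  · rw [hf1.1 x m1]; simp
  · rw [hf1.1 57 m2]
    simp only [Store.setReg_reg, m4.symm, if_false, h57, Finset.range_eq_Ico]
  · rintro r st hst ⟨i, hi, hx, h35, -, h57⟩
    have hlt : i < n := by omega
    rw [Finset.sum_eq_sum_Ico_succ_bot hlt] at h57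
    have st6 : st.reg 6 = 1 := by rw [hst.1 6 hbm6, s6]
    have e57 : st.reg 57 - st.reg 35 = (∑ y ∈ Finset.Ico (i + 1) n, v y + rest : ℕ) := by
      rw [h57, h35]; push_cast; ring
    refine ⟨?_, ?_⟩
    · simp only [Test.Holds, h35, h57]
      exact_mod_cast (by omega : v i ≤ v i + ∑ y ∈ Finset.Ico (i + 1) n, v y + rest)
    · simp only [wp_block_cons, wp_sub, wp_add]
      refine wp_mono (wp_frame (hP (i + 1) (by omega) _ ?_ ?_)) fun s2 ⟨⟨q1, q2⟩, hf2⟩ => ?_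
      · refine (hfr st hst).trans ⟨fun y hy => ?_, fun _ _ => rfl⟩
        simp only [scan, block, modReg, Bool.or_eq_false_iff, beq_eq_false_iff_ne] at hy
        simp [hy.1, hy.2.2.1.1]
      · simp [hx, st6, m4]
      · refine ⟨i + 1, by omega, ?_, q1, q2, ?_⟩
        · rw [hf2.1 x m1]; simp [hx, st6, m4]
        · rw [hf2.1 57 m2, ← e57]; simp [m4.symm]
  · rintro st hst ⟨i, hi, hx, h35, hΨ', h57⟩
    obtain rfl : i = n := by omega
    simp only [Finset.Ico_self, Finset.sum_empty, zero_add] at h57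
    refine ⟨?_, hΦ st (hfr st hst) hx h57 hΨ'⟩
    simp only [Test.Holds, h35, h57, not_le]
    exact_mod_cast hrest

end Prog

/-- Finds one component of the vector with the rank in register `57`. -/
def stepProg : Prog := block [
  scan 34 wtProg,
  .op .div 65 57 37, .floor 65 65, .op .mul 66 65 37, .op .sub 57 57 66,
  .op .sub 31 31 36, .op .sub 30 30 14, .op .sub 30 30 36,
  .op .sub 66 34 10, .op .mul 66 66 33, .op .add 66 66 65, .load 67 3 32, .op .add 66 66 67,
  .store 11 32 66]

/-- One level of the recursion of `enc` is undone: the scan finds `c t`, division by the number of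
shorter vectors finds `u t`, the remainder is the shorter rank, and the key and the cell address are
reduced accordingly. -/
theorem stepProg_spec {I : Input} {G : ℝ} {Q : ℕ} (hb : I.SizeBound G Q)
    {s : Store} (h : I.Env s) {a j : ℕ → ℤ} (hj : I.Coords a j) {i t : ℕ} (hi : i < I.m)
    (ht : t < I.d) {c u : ℕ → ℕ} (hcu : ∀ t < I.d, c t < I.C ∧ u t < I.scale i)
    (hx : key (I.ballKey j i) c (t + 1) < I.X)
    (h3 : s.arr 3 (i * I.d + t) = a (i * I.d + t))
    (h4 : s.arr 4 (i * I.d + t) = j (i * I.d + t))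
    (h9 : ∀ x < I.X, s.arr 9 (I.addr i t x) = I.cell j i t x)
    (h30 : s.reg 30 = I.addr i (t + 1) (key (I.ballKey j i) c (t + 1)))
    (h31 : s.reg 31 = key (I.ballKey j i) c (t + 1))
    (h32 : s.reg 32 = (i * I.d + t : ℕ)) (h33 : s.reg 33 = I.scale i)
    (h57 : s.reg 57 = enc I.C (I.scale i) (I.ballKey j i) c u (t + 1)) :
    stepProg.wp G Q (fun s' => s'.reg 30 = I.addr i t (key (I.ballKey j i) c t) ∧
      s'.reg 31 = key (I.ballKey j i) c t ∧
      s'.reg 57 = enc I.C (I.scale i) (I.ballKey j i) c u t ∧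
      ∀ e, s'.arr 11 e = if e = i * I.d + t then (I.point a i c u t : ℝ) else s.arr 11 e) s := by
  have hct := hcu t ht
  have hCQ : c t ≤ Q := hct.1.le.trans hb.C
  have hrest := enc_succ_lt (κ := I.ballKey j i) fun t' (ht' : t' < t + 1) =>
    hcu t' (by omega)
  have henc := enc_lt (κ := I.ballKey j i) fun t' (ht' : t' < t) => hcu t' (by omega)
  have hks := key_succ (κ := I.ballKey j i) c t
  refine wp_seq (Φ := fun s' => s'.reg 34 = c t ∧ s'.reg 57 = (u t *
      cnt I.C (I.scale i) (I.ballKey j i) t (key (I.ballKey j i) c t) +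
      enc I.C (I.scale i) (I.ballKey j i) c u t : ℕ) ∧
      s'.reg 36 = I.ballKey j i t (c t) ∧ s'.reg 37 = I.cell j i t (key (I.ballKey j i) c t)) ?_ ?_
  · refine wp_scan (v := wt I.C (I.scale i) (I.ballKey j i) t (key (I.ballKey j i) c (t + 1)))
      (Ψ := fun n s' => s'.reg 36 = I.ballKey j i t n ∧
        (I.ballKey j i t n ≤ key (I.ballKey j i) c (t + 1) → s'.reg 37 =
          I.cell j i t (key (I.ballKey j i) c (t + 1) - I.ballKey j i t n))) hCQ hrest
      (by decide) h.one ?_ ?_ ?_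
    · rw [h57, enc]
    · intro n hn st hf hn'
      refine wtProg_spec (x := key (I.ballKey j i) c (t + 1)) hb (h.frame hf (by decide)) hj hi ht
        (hn.trans_lt hct.1) ?_ ?_ ?_ ?_ ?_ ?_ hn'
      · rw [hf.2 4 rfl, h4]
      · intro x' hx'
        rw [hf.2 9 rfl, h9 x' (hx'.trans_lt hx)]
      · rw [hf.1 30 rfl, h30]
      · rw [hf.1 31 rfl, h31]
      · rw [hf.1 32 rfl, h32]
      · rw [hf.1 33 rfl, h33]
    · intro st hf q1 q2 q3
      refine ⟨q1, q2, q3.1, ?_⟩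
      rw [q3.2 (by omega), hks, Nat.add_sub_cancel]
  · rintro st ⟨q34, q57, q36, q37⟩ hf
    have hst := h.frame hf (by decide)
    have q30 : st.reg 30 = _ := (hf.1 30 rfl).trans h30
    have q31 : st.reg 31 = _ := (hf.1 31 rfl).trans h31
    have q32 : st.reg 32 = _ := (hf.1 32 rfl).trans h32
    have q33 : st.reg 33 = _ := (hf.1 33 rfl).trans h33
    have q3 : st.arr 3 (i * I.d + t) = _ := (congrFun (hf.2 3 rfl) _).trans h3
    have q11 : st.arr 11 = s.arr 11 := hf.2 11 rfl
    set n0 := cnt I.C (I.scale i) (I.ballKey j i) t (key (I.ballKey j i) c t) with hn0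
    set e0 := enc I.C (I.scale i) (I.ballKey j i) c u t with he0
    have hpos : 0 < n0 := by omega
    have q37' : st.reg 37 = n0 := q37
    have hdiv : (u t * n0 + e0) / n0 = u t := by
      rw [Nat.mul_comm, Nat.mul_add_div hpos, Nat.div_eq_of_lt henc, add_zero]
    have hn1 : (1 : ℝ) ≤ n0 := by exact_mod_cast hpos
    have hn2 : (n0 : ℝ) ≤ G := hb.cnt _ i hi t ht.le _
    simp only [wp_block_cons, wp_block_nil, wp_div, wp_floor, wp_mul, wp_sub, wp_add, wp_load,
      wp_store, Store.setReg_reg, Store.setReg_arr, Nat.reduceEqDiff, if_false, if_true]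
    simp only [q30, q31, q32, q33, q34, q36, q37', q57, hst.X, hst.Z, floor_div_natCast, hdiv,
      Nat.floor_natCast, q3]
    refine ⟨by simpa using hn1, by simpa using hn2, by simpa using hb.scale i hi, ?_, ?_, ?_, ?_⟩
    · simp only [Store.setArr_reg, Store.setReg_reg, Nat.reduceEqDiff, if_false, if_true,
        Input.addr, hks]
      push_cast; ring
    · simp only [Store.setArr_reg, Store.setReg_reg, Nat.reduceEqDiff, if_false, if_true, hks]
      push_cast; ring
    · simp only [Store.setArr_reg, Store.setReg_reg, Nat.reduceEqDiff, if_false, if_true]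
      push_cast; ring
    · intro e
      simp only [Store.setArr_arr, Store.setReg_arr, q11, Input.point, true_and]
      push_cast
      rfl

/-- Computes the point with the rank in register `57`. -/
def decodeProg : Prog := block [
  scan 31 topProg,
  .op .add 30 46 31, .op .mul 60 43 0, .op .add 60 60 0,
  forLoop 61 0 (block [.op .sub 32 60 61, .op .sub 32 32 6, stepProg])]

/-- A first scan over acceptable keys isolates the key and the rank within it; then coordinates are
peeled off from the last to the first, which is why the invariant after n rounds speaks of `I.d -
n`. -/
theorem decodeProg_spec {I : Input} {G : ℝ} {Q : ℕ} (hb : I.SizeBound G Q)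
    {s : Store} (h : I.Env s) {a j : ℕ → ℤ} (hj : I.Coords a j) {i : ℕ} (hi : i < I.m)
    {c u : ℕ → ℕ} (hcu : I.BallAdm j i c u)
    (h3 : ∀ e < I.m * I.d, s.arr 3 e = a e) (h4 : ∀ e < I.m * I.d, s.arr 4 e = j e)
    (h9 : ∀ t ≤ I.d, ∀ x < I.X, s.arr 9 (I.addr i t x) = I.cell j i t x)
    (h33 : s.reg 33 = I.scale i) (h43 : s.reg 43 = i) (h46 : s.reg 46 = I.addr i I.d 0)
    (h47 : s.reg 47 = I.thresh j i) (h48 : s.reg 48 = I.slope i)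
    (h57 : s.reg 57 = rank I.C (I.scale i) (I.ballKey j i) I.d (I.acc j i) c u) :
    decodeProg.wp G Q (fun s' => ∀ t < I.d, s'.arr 11 (i * I.d + t) = I.point a i c u t) s := by
  refine wp_seq (Φ := fun s' => s'.reg 31 = key (I.ballKey j i) c I.d ∧
    s'.reg 57 = enc I.C (I.scale i) (I.ballKey j i) c u I.d) ?_ ?_
  · refine wp_scan (v := topWt I.C (I.scale i) (I.ballKey j i) I.d (I.acc j i))
      (Ψ := fun _ _ => True) (hcu.key_lt.le.trans hb.X) hcu.enc_lt_topWt (by decide) h.one ?_ ?_ ?_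
    · rw [h57, rank]
    · intro n hn st hf hn'
      refine wp_mono (topProg_spec (j := j) (i := i) (x := n) hb (h.frame hf (by decide))
        ?_ hn' ?_ ?_ ?_) fun _ h => ⟨h, trivial⟩
      · rw [hf.2 9 rfl, h9 I.d le_rfl n (hn.trans_lt hcu.key_lt)]
      · rw [hf.1 46 rfl, h46]
      · rw [hf.1 47 rfl, h47]
      · rw [hf.1 48 rfl, h48]
    · intro st hf q1 q2 _
      exact ⟨q1, q2⟩
  · rintro st ⟨q31, q57⟩ hf
    have hst := h.frame hf (by decide)
    have q46 : st.reg 46 = _ := (hf.1 46 rfl).trans h46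
    have q43 : st.reg 43 = _ := (hf.1 43 rfl).trans h43
    have q33 : st.reg 33 = _ := (hf.1 33 rfl).trans h33
    simp only [wp_block_cons, wp_mul, wp_add, Store.setReg_reg, Nat.reduceEqDiff,
      if_false, if_true, q31, q46, q43, hst.d]
    refine ⟨by simpa using hb.natCast hb.d, ?_⟩
    refine wp_forLoop (n := I.d) (fun n s' =>
      s'.reg 30 = I.addr i (I.d - n) (key (I.ballKey j i) c (I.d - n)) ∧
      s'.reg 31 = key (I.ballKey j i) c (I.d - n) ∧
      s'.reg 57 = enc I.C (I.scale i) (I.ballKey j i) c u (I.d - n) ∧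
      ∀ t < I.d, I.d - n ≤ t → s'.arr 11 (i * I.d + t) = I.point a i c u t)
      (by simp [hst.d]) (by simp [hst.one]) hb.d (by decide) ?_ ?_ ?_
    · refine ⟨?_, ?_, ?_, fun t ht ht' => by omega⟩
      · simp [Input.addr]
      · simp [q31]
      · simp [q57]
    · rintro n hn s' hn' hf' ⟨i1, i2, i3, i4⟩
      obtain ⟨t, ht⟩ : ∃ t, I.d - n = t + 1 := ⟨I.d - n - 1, by omega⟩
      have ht' : I.d - (n + 1) = t := by omega
      have htd : t < I.d := by omega
      have hs' : I.Env s' := Input.Env.frame (by simpa using hst) hf' (by decide)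
      have q60 : s'.reg 60 = (i : ℝ) * I.d + I.d := by rw [hf'.1 60 rfl]; simp
      have q33' : s'.reg 33 = I.scale i := by rw [hf'.1 33 rfl]; simp [q33]
      have hidx : (i : ℝ) * I.d + I.d - n - 1 = (i * I.d + t : ℕ) := by
        have : (I.d : ℝ) = t + 1 + n := by
          have : I.d = t + 1 + n := by omega
          exact_mod_cast this
        push_cast
        linarith
      have hlt := Input.idx_lt (I := I) ⟨i, hi⟩ htd
      rw [ht] at i1 i2 i3 i4
      simp only [wp_block_cons, wp_sub, Store.setReg_reg, Nat.reduceEqDiff,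
        if_false, if_true, q60, hn', hs'.one, hidx, ht']
      have hkx : key (I.ballKey j i) c (t + 1) < I.X := by
        refine lt_of_le_of_lt ?_ hcu.key_lt
        exact Finset.sum_le_sum_of_subset (Finset.range_mono (by omega))
      refine wp_mono (stepProg_spec hb (by simpa using hs') hj hi htd hcu.lt hkx ?_ ?_ ?_ ?_ ?_ ?_ ?_
        ?_) ?_
      · simp only [Store.setReg_arr]
        rw [hf'.2 3 rfl]
        simp only [Store.setReg_arr]
        rw [hf.2 3 rfl, h3 _ hlt]
      · simp only [Store.setReg_arr]
        rw [hf'.2 4 rfl]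
        simp only [Store.setReg_arr]
        rw [hf.2 4 rfl, h4 _ hlt]
      · intro x hx
        simp only [Store.setReg_arr]
        rw [hf'.2 9 rfl]
        simp only [Store.setReg_arr]
        rw [hf.2 9 rfl, h9 t htd.le x hx]
      · simpa using i1
      · simpa using i2
      · simp
      · simpa using q33'
      · simpa using i3
      · rintro s'' ⟨o1, o2, o3, o4⟩
        refine ⟨by simpa using o1, by simpa using o2, by simpa using o3, fun t' ht' htt' => ?_⟩
        simp only [Store.setReg_arr, o4]
        by_cases htt : t' = t
        · rw [htt, if_pos rfl]
        · rw [if_neg (by omega), i4 t' ht' (by omega)]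
    · rintro s' - - ⟨-, -, -, i4⟩ t ht
      exact i4 t ht (by omega)

/-- Determines the balls that contain the sampled point. -/
def memberProg : Prog := block [
  .op .mul 68 43 0, .op .mul 87 84 1,
  forLoop 69 1 (block [.const 70 0, .op .mul 71 69 0,
    forLoop 72 0 (block [.op .add 73 68 72, .load 73 11 73, .op .add 74 71 72, .load 74 1 74,
      .op .sub 73 73 74, .op .mul 73 73 73, .op .add 70 70 73]),
    .load 75 0 69, .op .mul 75 75 75, .op .add 76 87 69, .const 77 0,
    .ite (.le 70 75) (.const 77 1) .skip, .store 12 76 77]),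
  .op .add 76 87 43, .load 77 12 76, .ite (.lt 77 6) .skip (.store 13 84 56)]

open Classical in
-- Squared distances to the original real centers are compared with squared radii, so membership is
-- exact even for rescaled balls. The weight in array 13 is set only if the point lies in its own
-- ball; otherwise the zero written beforehand remains.
theorem memberProg_spec {I : Input} {G : ℝ} {Q : ℕ} (hI : I.Valid) (hb : I.SizeBound G Q)
    {s : Store} (h : I.Env s) {a j : ℕ → ℤ} (hj : I.Coords a j) (i : Fin I.m) {e : ℕ}
    {c u : ℕ → ℕ} (hcu : ∀ t < I.d, c t < I.C ∧ u t < I.scale i)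
    (h0 : s.arr 0 = I.store.arr 0) (h1 : s.arr 1 = I.store.arr 1)
    (h11 : ∀ t < I.d, s.arr 11 (i * I.d + t) = I.point a i c u t)
    (h43 : s.reg 43 = (i : ℕ)) (h84 : s.reg 84 = e) :
    memberProg.wp G Q (fun s' =>
      (∀ i' : Fin I.m, s'.arr 12 (e * I.m + i') =
        if (fun t : Fin I.d => I.point a i c u t) ∈ I.ball i' then 1 else 0) ∧
      (∀ A < e * I.m, s'.arr 12 A = s.arr 12 A) ∧
      ∀ A, s'.arr 13 A = if A = e ∧ (fun t : Fin I.d => I.point a i c u t) ∈ I.ball i then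
        s.reg 56 else s.arr 13 A) s := by
  set y : Fin I.d → ℤ := fun t : Fin I.d => I.point a i c u t with hy
  simp only [memberProg, wp_block_cons, wp_mul, Store.setReg_reg, Nat.reduceEqDiff,
    if_false, h43, h84, h.d, h.m]
  refine ⟨by simpa using hb.natCast hb.d, by simpa using hb.natCast hb.m, ?_⟩
  refine wp_forLoop (n := I.m) (fun n s' =>
      (∀ i' : Fin I.m, (i' : ℕ) < n → s'.arr 12 (e * I.m + i') =
        if y ∈ I.ball i' then 1 else 0) ∧
      ∀ A < e * I.m, s'.arr 12 A = s.arr 12 A) (by simp [h.m]) (by simp [h.one]) hb.m (by decide)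
    (by simp) ?_ ?_
  · rintro n hn s' hn' hf ⟨i1, i2⟩
    have h' : I.Env s' := Input.Env.frame (by simpa using h) hf (by decide)
    have e68 : s'.reg 68 = (i : ℕ) * I.d := by rw [hf.1 68 rfl]; simp
    have e87 : s'.reg 87 = (e : ℝ) * I.m := by rw [hf.1 87 rfl]; simp
    have e1 : ∀ A, s'.arr 1 A = I.p A := fun A => by rw [hf.2 1 rfl]; simp [h1]; rfl
    have e0 : ∀ A, s'.arr 0 A = I.r A := fun A => by rw [hf.2 0 rfl]; simp [h0]; rfl
    have e11 : ∀ t < I.d, s'.arr 11 (i * I.d + t) = I.point a i c u t := fun t ht => by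
      rw [hf.2 11 rfl]; simp [h11 t ht]
    simp only [wp_block_cons, wp_const, wp_mul, Store.setReg_reg, Nat.reduceEqDiff, if_false,
      hn', h'.d]
    refine ⟨by simpa using hb.natCast hb.d, ?_⟩
    refine wp_forLoop (n := I.d) (fun q st => st.reg 70 =
        ∑ t ∈ Finset.range q, ((I.point a i c u t : ℝ) - I.p (n * I.d + t)) ^ 2)
      (by simp [h'.d]) (by simp [h'.one]) hb.d (by decide) (by simp) ?_ ?_
    · intro t ht st ht' hf' hinv
      have f68 : st.reg 68 = (i : ℕ) * I.d := by rw [hf'.1 68 rfl]; simp [e68]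
      have f71 : st.reg 71 = (n : ℝ) * I.d := by rw [hf'.1 71 rfl]; simp
      have f11 : st.arr 11 (i * I.d + t) = I.point a i c u t := by
        rw [hf'.2 11 rfl]; simp [e11 t ht]
      have f1 : st.arr 1 (n * I.d + t) = I.p (n * I.d + t) := by
        rw [hf'.2 1 rfl]; simp [e1]
      have g1 : ⌊((i : ℕ) : ℝ) * I.d + t⌋₊ = i * I.d + t := by
        exact_mod_cast Nat.floor_natCast ((i : ℕ) * I.d + t)
      have g2 : ⌊(n : ℝ) * I.d + t⌋₊ = n * I.d + t := by
        exact_mod_cast Nat.floor_natCast (n * I.d + t)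
      have hdiff := hb.diff a j hj i i.2 n hn t ht c u (hcu t ht).1 (hcu t ht).2
      simp only [wp_block_cons, wp_block_nil, wp_add, wp_sub, wp_mul, wp_load, Store.setReg_reg,
        Store.setReg_arr, Nat.reduceEqDiff, if_false, if_true, ht', f68, f71, g1, g2, f11, f1]
      refine ⟨hdiff, ?_⟩
      rw [hinv, Finset.sum_range_succ]
      ring
    · intro st _ hf' hinv
      have f87 : st.reg 87 = (e : ℝ) * I.m := by rw [hf'.1 87 rfl]; simp [e87]
      have f69 : st.reg 69 = n := by rw [hf'.1 69 rfl]; simp [hn']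
      have f0 : st.arr 0 n = I.r n := by rw [hf'.2 0 rfl]; simp [e0]
      have f12 : st.arr 12 = s'.arr 12 := by rw [hf'.2 12 rfl]; simp
      have g1 : ⌊(e : ℝ) * I.m + n⌋₊ = e * I.m + n := by
        exact_mod_cast Nat.floor_natCast (e * I.m + n)
      have hsum : ∑ t ∈ Finset.range I.d, ((I.point a i c u t : ℝ) - I.p (n * I.d + t)) ^ 2 ≤
          I.r n * I.r n ↔ y ∈ I.ball ⟨n, hn⟩ := by
        rw [Input.ball, mem_latticeBall_iff_sum (hI.radius_pos _).le, ← Input.r_eq, sq (I.r _),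
          ← Fin.sum_univ_eq_sum_range fun t => ((I.point a i c u t : ℝ) - I.p (n * I.d + t)) ^ 2]
        simp only [← Input.p_eq, hy]
      have hfin : ∀ v : ℝ, (v = if y ∈ I.ball ⟨n, hn⟩ then 1 else 0) →
          (∀ i' : Fin I.m, (i' : ℕ) < n + 1 →
            (if e * I.m + (i' : ℕ) = e * I.m + n then v else s'.arr 12 (e * I.m + i')) =
              if y ∈ I.ball i' then 1 else 0) ∧
          ∀ A < e * I.m, (if A = e * I.m + n then v else s'.arr 12 A) = s.arr 12 A := by
        refine fun v hv => ⟨fun i' hi' => ?_, fun A hA => ?_⟩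
        · rcases Nat.lt_succ_iff_lt_or_eq.1 hi' with hi' | hi'
          · rw [if_neg (by omega), i1 i' hi']
          · obtain rfl : i' = ⟨n, hn⟩ := Fin.ext hi'
            rw [if_pos rfl, hv]
        · rw [if_neg (by omega), i2 A hA]
      simp only [wp_block_cons, wp_block_nil, wp_add, wp_mul, wp_load, wp_const, wp_ite, wp_store,
        wp_skip, Store.setReg_reg, Store.setReg_arr, Store.setArr_arr, Nat.reduceEqDiff, if_false,
        if_true, Test.Holds, f69, Nat.floor_natCast, f0, f87, g1, f12, true_and, hinv, hsum]
      refine ⟨hb.r n hn, fun hm => hfin _ (by simp [hm]), fun hm => hfin _ (by simp [hm])⟩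
  · rintro s' - hf ⟨i1, i2⟩
    have h' : I.Env s' := Input.Env.frame (by simpa using h) hf (by decide)
    have e87 : s'.reg 87 = (e : ℝ) * I.m := by rw [hf.1 87 rfl]; simp
    have e43 : s'.reg 43 = (i : ℕ) := by rw [hf.1 43 rfl]; simp [h43]
    have e84 : s'.reg 84 = e := by rw [hf.1 84 rfl]; simp [h84]
    have e56 : s'.reg 56 = s.reg 56 := by rw [hf.1 56 rfl]; simp
    have e13 : s'.arr 13 = s.arr 13 := by rw [hf.2 13 rfl]; simp
    have g1 : ⌊(e : ℝ) * I.m + (i : ℕ)⌋₊ = e * I.m + i := by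
      exact_mod_cast Nat.floor_natCast (e * I.m + (i : ℕ))
    simp only [wp_block_cons, wp_block_nil, wp_add, wp_load, wp_ite, wp_store,
      wp_skip, Store.setReg_reg, Store.setReg_arr, Store.setArr_arr, Nat.reduceEqDiff, if_false,
      if_true, Test.Holds, e43, e87, e84, e56, g1, i1 i i.2, h'.one, Nat.floor_natCast, e13,
      true_and, false_and]
    refine ⟨fun hlt => ⟨fun i' => i1 i' i'.2, i2, fun A => ?_⟩,
      fun hlt => ⟨fun i' => i1 i' i'.2, i2, fun A => ?_⟩⟩
    · have hm : y ∉ I.ball i := fun hm => by simp [hm] at hlt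
      simp [hm]
    · have hm : y ∈ I.ball i := by
        by_contra hm
        simp [hm] at hlt
      simp [hm]

/-- Draws the digits of the random number. -/
def digitProg : Prog := forLoop 53 17 (block [
  .op .div 54 19 18, .floor 54 54, .op .mul 55 54 18, .op .sub 55 19 55, .store 14 53 55,
  .copy 19 54])

/-- Digits in base `prodSize`, least significant first; as the number is uniform below a power of
the base, they are independent and uniform. -/
theorem digitProg_spec {I : Input} {G : ℝ} {Q : ℕ} (hb : I.SizeBound G Q)
    {s : Store} (h : I.Env s) {j : ℕ → ℤ} {v : ℕ} (h17 : s.reg 17 = I.samples)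
    (h18 : s.reg 18 = I.prodSize j) (h19 : s.reg 19 = v) :
    digitProg.wp G Q (fun s' => ∀ τ < I.samples, s'.arr 14 τ =
      (v / I.prodSize j ^ τ % I.prodSize j : ℕ)) s := by
  have hM : 0 < I.prodSize j := Finset.prod_pos fun i _ => by omega
  have hM1 : (1 : ℝ) ≤ I.prodSize j := by exact_mod_cast hM
  refine wp_forLoop (n := I.samples) (fun n s' => s'.reg 19 = (v / I.prodSize j ^ n : ℕ) ∧
    ∀ τ < n, s'.arr 14 τ = (v / I.prodSize j ^ τ % I.prodSize j : ℕ)) h17 h.one hb.samples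
    (by decide) (by simp [h19]) ?_ fun s' _ _ h => h.2
  rintro n hn s' hn' hf ⟨i1, i2⟩
  have e18 : s'.reg 18 = I.prodSize j := by rw [hf.1 18 rfl, h18]
  simp only [wp_block_cons, wp_block_nil, wp_div, wp_floor, wp_mul, wp_sub, wp_store, wp_copy,
    Store.setReg_reg, Store.setReg_arr, Store.setArr_reg, Store.setArr_arr, Nat.reduceEqDiff,
    if_false, if_true, i1, e18, floor_div_natCast, sub_div_mul_natCast, hn', Nat.floor_natCast]
  refine ⟨by simpa using hM1, by simpa using hb.prodSize j, ?_, fun τ hτ => ?_⟩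
  · rw [Nat.div_div_eq_div_mul, ← pow_succ]
  · rcases Nat.lt_succ_iff_lt_or_eq.1 hτ with hτ | rfl
    · simpa [hτ.ne] using i2 τ hτ
    · simp

/-- Draws the sample points. -/
def sampleProg : Prog := block [
  .op .mul 83 17 1,
  forLoop 84 83 (block [
    .op .div 53 84 1, .floor 53 53, .op .mul 85 53 1, .op .sub 43 84 85, .load 55 14 53,
    .load 56 10 43, .const 86 0, .store 13 84 86,
    .ite (.lt 56 6) .skip (block [
      .op .div 57 55 56, .floor 57 57, .op .mul 57 57 56, .op .sub 57 55 57,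
      .op .mul 46 43 29, .op .add 46 46 0, .op .mul 46 46 14, .load 47 6 43, .load 48 7 43,
      .load 33 5 43, decodeProg, memberProg])])]

/-- What the preparation phase leaves in the memory. -/
structure Input.Prepared (I : Input) (a j : ℕ → ℤ) (s : Store) : Prop where
  env : I.Env s
  coords : I.Coords a j
  arr0 : s.arr 0 = I.store.arr 0
  arr1 : s.arr 1 = I.store.arr 1
  arr2 : s.arr 2 = fun _ => 0
  arr3 : ∀ e < I.m * I.d, s.arr 3 e = a e
  arr4 : ∀ e < I.m * I.d, s.arr 4 e = j e
  arr5 : ∀ i < I.m, s.arr 5 i = I.scale i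
  arr6 : ∀ i < I.m, s.arr 6 i = I.thresh j i
  arr7 : ∀ i < I.m, s.arr 7 i = I.slope i
  arr9 : ∀ i < I.m, ∀ t ≤ I.d, ∀ x < I.X, s.arr 9 (I.addr i t x) = I.cell j i t x
  arr10 : ∀ i < I.m, s.arr 10 i = I.size j i
  reg17 : s.reg 17 = I.samples
  reg18 : s.reg 18 = I.prodSize j

theorem Input.Prepared.frame {I : Input} {a j : ℕ → ℤ} {P : Prog} {s s' : Store}
    (h : I.Prepared a j s) (hf : P.Frame s s')
    (hP : ∀ x ∈ [0, 1, 2, 3, 6, 7, 8, 9, 10, 11, 12, 13, 14, 15, 16, 29, 40, 51],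
      P.modReg x = false) (hP' : P.modReg 17 = false ∧ P.modReg 18 = false)
    (hA : ∀ x ∈ [0, 1, 2, 3, 4, 5, 6, 7, 9, 10], P.modArr x = false) : I.Prepared a j s' := by
  have key : ∀ x ∈ [0, 1, 2, 3, 4, 5, 6, 7, 9, 10], s'.arr x = s.arr x :=
    fun x hx => hf.2 x (hA x hx)
  simp only [List.forall_mem_cons] at key
  obtain ⟨k0, k1, k2, k3, k4, k5, k6, k7, k9, k10, -⟩ := key
  constructor
  exacts [h.env.frame hf hP, h.coords, k0.trans h.arr0, k1.trans h.arr1, k2.trans h.arr2,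
    k3 ▸ h.arr3, k4 ▸ h.arr4, k5 ▸ h.arr5, k6 ▸ h.arr6, k7 ▸ h.arr7, k9 ▸ h.arr9, k10 ▸ h.arr10,
    (hf.1 17 hP'.1).trans h.reg17, (hf.1 18 hP'.2).trans h.reg18]

/-- The point of ball `i` that is drawn with the random number `v`. -/
def Input.samplePoint (I : Input) (a j : ℕ → ℤ) (cu : ℕ → ℕ → (ℕ → ℕ) × (ℕ → ℕ)) (i v : ℕ) :
    Fin I.d → ℤ :=
  fun t => I.point a i (cu i (v % I.size j i)).1 (cu i (v % I.size j i)).2 t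

open Classical in
/-- The weight of a sample point: the size of the superset if the point lies in the ball, but in
no ball of `S`. -/
def Input.sampleWt (I : Input) (a j : ℕ → ℤ) (cu : ℕ → ℕ → (ℕ → ℕ) × (ℕ → ℕ))
    (S : Finset (Fin I.m)) (i : Fin I.m) (v : ℕ) : ℕ :=
  if 0 < I.size j i ∧ I.samplePoint a j cu i v ∈ I.ball i \ ⋃ i' ∈ S, I.ball i' then
    I.size j i else 0

open Classical in
-- Sample τ of ball i has index τ m + i, and all balls share the digit v τ, reduced modulo their own
-- sizes. Nothing is known about the membership row of a ball with empty superset, since no point is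
-- drawn for it; its weight is 0.
theorem sampleProg_spec {I : Input} {G : ℝ} {Q : ℕ} (hI : I.Valid) (hb : I.SizeBound G Q)
    {s : Store} {a j : ℕ → ℤ} (h : I.Prepared a j s) {cu : ℕ → ℕ → (ℕ → ℕ) × (ℕ → ℕ)}
    (hcu : ∀ i, ∀ R < I.size j i, I.BallAdm j i (cu i R).1 (cu i R).2 ∧
      rank I.C (I.scale i) (I.ballKey j i) I.d (I.acc j i) (cu i R).1 (cu i R).2 = R)
    {v : ℕ → ℕ} (h14 : ∀ τ < I.samples, s.arr 14 τ = v τ) :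
    sampleProg.wp G Q (fun s' => s'.reg 83 = (I.samples * I.m : ℕ) ∧
      ∀ τ < I.samples, ∀ i : Fin I.m,
        (0 < I.size j i → ∀ i' : Fin I.m, s'.arr 12 ((τ * I.m + i) * I.m + i') =
          if I.samplePoint a j cu i (v τ) ∈ I.ball i' then 1 else 0) ∧
        s'.arr 13 (τ * I.m + i) = I.sampleWt a j cu ∅ i (v τ)) s := by
  simp only [sampleProg, wp_block_cons, wp_mul, h.env.m, h.reg17]
  refine ⟨by simpa using hb.natCast hb.m, ?_⟩
  have he := h.env
  refine wp_forLoop (n := I.samples * I.m) (fun n s' =>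
      ∀ τ < I.samples, ∀ i : Fin I.m, τ * I.m + i < n →
        (0 < I.size j i → ∀ i' : Fin I.m, s'.arr 12 ((τ * I.m + i) * I.m + i') =
          if I.samplePoint a j cu i (v τ) ∈ I.ball i' then 1 else 0) ∧
        s'.arr 13 (τ * I.m + i) = I.sampleWt a j cu ∅ i (v τ)) (by simp) (by simp [he.one])
    hb.samples_mul (by decide) (by simp) ?_ ?_
  · rintro n hn s' hn' hf i1
    have hm : 0 < I.m := by
      rcases Nat.eq_zero_or_pos I.m with h0 | h0
      · simp [h0] at hn
      · exact h0
    have hτ : n / I.m < I.samples := Nat.div_lt_of_lt_mul (by rwa [Nat.mul_comm])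
    obtain ⟨τ, hτe⟩ : ∃ τ, τ = n / I.m := ⟨_, rfl⟩
    obtain ⟨i, hie⟩ : ∃ i : Fin I.m, (i : ℕ) = n % I.m := ⟨⟨_, Nat.mod_lt _ hm⟩, rfl⟩
    have hni : τ * I.m + i = n := by rw [hτe, hie, Nat.mul_comm, Nat.div_add_mod]
    rw [← hτe] at hτ
    have huniq : ∀ τ' (i' : Fin I.m), τ' * I.m + i' = n → τ' = τ ∧ i' = i := by
      intro τ' i' hq
      constructor
      · rw [hτe, ← hq, Nat.mul_comm, Nat.mul_add_div hm, Nat.div_eq_of_lt i'.2, add_zero]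
      · apply Fin.ext
        rw [hie, ← hq, Nat.mul_comm, Nat.mul_add_mod, Nat.mod_eq_of_lt i'.2]
    have h0 : I.Prepared a j (s.setReg 83 ((I.samples : ℝ) * I.m)) :=
      ⟨by simpa using he, h.coords, h.arr0, h.arr1, h.arr2, h.arr3, h.arr4, h.arr5, h.arr6,
        h.arr7, h.arr9, h.arr10, h.reg17, h.reg18⟩
    have h' : I.Prepared a j s' := h0.frame hf (by decide) (by decide) (by decide)
    have e14 : s'.arr 14 τ = v τ := by rw [hf.2 14 rfl]; exact h14 τ hτ
    have hm1 : (1 : ℝ) ≤ I.m := by exact_mod_cast hm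
    have hmod : (n : ℝ) - (τ : ℝ) * I.m = (i : ℕ) := by
      rw [← hni]; push_cast; ring
    have hsz : (I.size j i : ℝ) ≤ G := hb.size j i i.2
    simp only [wp_block_cons, wp_block_nil, wp_div, wp_floor, wp_mul, wp_sub, wp_add, wp_load,
      wp_const, wp_store, wp_ite, wp_skip, Store.setReg_reg, Store.setReg_arr, Store.setArr_reg,
      Store.setArr_arr, Nat.reduceEqDiff, if_false, if_true, Test.Holds, hn', h'.env.m,
      floor_div_natCast, ← hτe, hmod, Nat.floor_natCast, e14, h'.arr10 i i.2, h'.env.one,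
      h'.env.d_succ, h'.env.d, h'.env.X, h'.arr6 i i.2, h'.arr7 i i.2, h'.arr5 i i.2,
      sub_div_mul_natCast, false_and, true_and]
    refine ⟨by simpa using hm1, by simpa using hb.natCast hb.m, fun hlt => ?_, fun hlt => ?_⟩
    · have hs0 : I.size j i = 0 := by
        have : I.size j i < 1 := by exact_mod_cast hlt
        omega
      intro τ' hτ' i' hlt'
      rcases Nat.lt_succ_iff_lt_or_eq.1 hlt' with hl | hl
      · have := i1 τ' hτ' i' hl
        exact ⟨this.1, by simpa [hl.ne] using this.2⟩
      · obtain ⟨rfl, rfl⟩ := huniq τ' i' hl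
        refine ⟨fun h => by omega, ?_⟩
        simp [hl, Input.sampleWt, hs0]
    · have hs1 : (1 : ℝ) ≤ I.size j i := not_lt.1 hlt
      have hs0 : 0 < I.size j i := by exact_mod_cast hs1
      have hR := hcu i (v τ % I.size j i) (Nat.mod_lt _ hs0)
      refine ⟨by simpa using hs1, by simpa using hsz, by
        simpa [abs_of_nonneg, add_nonneg] using hb.natCast hb.d_succ,
        by simpa using hb.natCast hb.X, ?_⟩
      refine wp_mono (wp_frame (decodeProg_spec (i := i) hb ?_ h'.coords i.2 hR.1 ?_ ?_ ?_ ?_ ?_ ?_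
        ?_ ?_ ?_)) ?_
      · simpa using h'.env
      · exact h'.arr3
      · exact h'.arr4
      · exact h'.arr9 i i.2
      · simp
      · simp
      · simp [Input.addr]
      · simp
      · simp
      · simp [hR.2]
      · rintro st ⟨h11, hf'⟩
        refine wp_mono (memberProg_spec hI hb (Input.Env.frame (by simpa using h'.env) hf'
          (by decide)) h'.coords i (e := n) (c := (cu i (v τ % I.size j i)).1)
          (u := (cu i (v τ % I.size j i)).2) hR.1.lt ?_ ?_ h11 ?_ ?_) ?_
        · rw [hf'.2 0 rfl]; exact h'.arr0
        · rw [hf'.2 1 rfl]; exact h'.arr1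
        · rw [hf'.1 43 rfl]; simp
        · rw [hf'.1 84 rfl]; simp [hn']
        · rintro st' ⟨o1, o2, o3⟩
          have q12 : st.arr 12 = s'.arr 12 := by
            rw [hf'.2 12 rfl]
            funext A
            simp
          have q13 : ∀ A, st.arr 13 A = if A = n then 0 else s'.arr 13 A := by
            rw [hf'.2 13 rfl]; simp
          have q56 : st.reg 56 = I.size j i := by rw [hf'.1 56 rfl]; simp
          intro τ' hτ' i' hlt'
          rcases Nat.lt_succ_iff_lt_or_eq.1 hlt' with hl | hl
          · have := i1 τ' hτ' i' hl
            refine ⟨fun hsz i'' => ?_, ?_⟩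
            · rw [o2, q12, this.1 hsz]
              have := i''.2
              nlinarith
            · rw [o3, if_neg (by omega), q13, if_neg hl.ne, this.2]
          · obtain ⟨rfl, rfl⟩ := huniq τ' i' hl
            refine ⟨fun _ i'' => ?_, ?_⟩
            · rw [hl]
              exact o1 i''
            · rw [o3, hl, q13, q56]
              simp [Input.sampleWt, hs0, Nat.cast_ite]
              rfl
  · intro s' _ hf hinv
    refine ⟨?_, fun τ hτ i => hinv τ hτ i ?_⟩
    · rw [hf.1 83 rfl]; simp
    · have := i.2
      nlinarith

/-! ### The greedy phase of the program -/

/-- Finds the unselected ball with the largest gain. -/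
def bestProg : Prog := block [.const 77 (-1), .const 78 0,
  forLoop 69 1 (block [.load 79 2 69,
    .ite (.lt 79 6) (block [.const 80 0,
      forLoop 53 17 (block [.op .mul 81 53 1, .op .add 81 81 69, .load 81 13 81,
        .op .add 80 80 81]),
      .ite (.lt 77 80) (block [.copy 77 80, .copy 78 69]) .skip]) .skip])]

/-- Removes the sample points that lie in the selected ball. -/
def removeProg : Prog := forLoop 82 83 (block [.op .mul 84 82 1, .op .add 84 84 78,
  .load 84 12 84, .ite (.lt 84 6) .skip (block [.const 85 0, .store 13 82 85])])

/-- Selects the balls. -/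
def greedyProg : Prog := forLoop 76 2 (block [bestProg, .store 2 78 6, removeProg])

theorem bestProg_spec {I : Input} {G : ℝ} {Q : ℕ} (hb : I.SizeBound G Q) {s : Store}
    (h : I.Env s) (h17 : s.reg 17 = I.samples) {S : Finset (Fin I.m)} (hS : S.card < I.m)
    [DecidablePred (· ∈ S)] {w : ℕ → Fin I.m → ℕ}
    (h2 : ∀ i : Fin I.m, s.arr 2 i = if i ∈ S then 1 else 0)
    (h13 : ∀ τ < I.samples, ∀ i : Fin I.m, s.arr 13 (τ * I.m + i) = w τ i) :
    bestProg.wp G Q (fun s' => ∃ b ∉ S, s'.reg 78 = (b : ℕ) ∧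
      ∀ i ∉ S, ∑ τ ∈ Finset.range I.samples, w τ i ≤ ∑ τ ∈ Finset.range I.samples, w τ b) s := by
  simp only [bestProg, wp_block_cons, wp_const]
  -- The initial value -1 is below every gain, so the first unselected ball is always taken, even
  -- with gain 0. The left alternative says that no unselected ball has been met yet.
  refine wp_forLoop (n := I.m) (fun n s' =>
    (s'.reg 77 = -1 ∧ ∀ i : Fin I.m, (i : ℕ) < n → i ∈ S) ∨ ∃ b ∉ S, s'.reg 78 = (b : ℕ) ∧
      s'.reg 77 = (∑ τ ∈ Finset.range I.samples, w τ b : ℕ) ∧ ∀ i ∉ S, (i : ℕ) < n →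
      ∑ τ ∈ Finset.range I.samples, w τ i ≤ ∑ τ ∈ Finset.range I.samples, w τ b)
    (by simp [h.m]) (by simp [h.one]) hb.m (by decide) (by simp) ?_ ?_
  · rintro n hn s' hn' hf hinv
    have h' : I.Env s' := Input.Env.frame (by simpa using h) hf (by decide)
    obtain ⟨i, rfl⟩ : ∃ i : Fin I.m, (i : ℕ) = n := ⟨⟨n, hn⟩, rfl⟩
    have e2 : s'.arr 2 i = if i ∈ S then 1 else 0 := by rw [hf.2 2 rfl]; exact h2 i
    have hlast : ∀ j : Fin I.m, (j : ℕ) < i + 1 → (j : ℕ) < i ∨ j = i := fun j hj =>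
      (Nat.lt_succ_iff_lt_or_eq.1 hj).imp_right Fin.ext
    simp only [wp_block_cons, wp_block_nil, wp_load, wp_ite, wp_skip, Store.setReg_reg,
      Test.Holds, hn', Nat.floor_natCast, e2, h'.one, if_true, if_false,
      Nat.reduceEqDiff]
    refine ⟨fun hlt => ?_, fun hlt => ?_⟩
    · have hi : i ∉ S := by
        intro hi
        simp [hi] at hlt
      simp only [wp_const]
      refine wp_forLoop (n := I.samples) (fun q st =>
        st.reg 80 = (∑ τ ∈ Finset.range q, w τ i : ℕ)) ?_ (by simp [h'.one]) hb.samples (by decide)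
        (by simp) ?_ ?_
      · simp only [Store.setReg_reg, Nat.reduceEqDiff, if_false]
        rw [hf.1 17 rfl]
        simp [h17]
      · intro τ hτ st hτ' hf' hq
        have st1 : st.reg 1 = I.m := by rw [hf'.1 1 rfl]; simp [h'.m]
        have st69 : st.reg 69 = (i : ℕ) := by rw [hf'.1 69 rfl]; simp [hn']
        have st13 : st.arr 13 (τ * I.m + i) = w τ i := by
          rw [hf'.2 13 rfl]
          simp only [Store.setReg_arr]
          rw [hf.2 13 rfl]
          exact h13 τ hτ i
        have g1 : ⌊(τ : ℝ) * I.m + (i : ℕ)⌋₊ = τ * I.m + i := by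
          exact_mod_cast Nat.floor_natCast (τ * I.m + (i : ℕ))
        simp only [wp_block_cons, wp_block_nil, wp_mul, wp_add, wp_load, Store.setReg_reg,
          Store.setReg_arr, Nat.reduceEqDiff, if_false, if_true, hτ', st1, st69, g1, st13, hq]
        refine ⟨by simpa using hb.natCast hb.m, ?_⟩
        rw [Finset.sum_range_succ]
        push_cast
        ring
      · intro st _ hf' hq
        have st69 : st.reg 69 = (i : ℕ) := by rw [hf'.1 69 rfl]; simp [hn']
        have st77 : st.reg 77 = s'.reg 77 := by rw [hf'.1 77 rfl]; simp
        have st78 : st.reg 78 = s'.reg 78 := by rw [hf'.1 78 rfl]; simp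
        simp only [wp_block_cons, wp_block_nil, wp_ite, wp_skip, wp_copy, Store.setReg_reg,
          Test.Holds, Nat.reduceEqDiff, if_false, if_true, hq, st69, st77, st78]
        refine ⟨fun hc => Or.inr ⟨i, hi, rfl, rfl, fun i' hi' hlt' => ?_⟩, fun hc => ?_⟩
        · rcases hlast i' hlt' with hl | rfl
          · rcases hinv with ⟨-, hall⟩ | ⟨b, -, -, hb77, hmax⟩
            · exact absurd (hall i' hl) hi'
            · rw [hb77] at hc
              exact (hmax i' hi' hl).trans (by exact_mod_cast hc.le)
          · exact le_rfl
        · rcases hinv with ⟨hm1, -⟩ | ⟨b, hbS, hb78, hb77, hmax⟩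
          · rw [hm1] at hc
            exact absurd (lt_of_lt_of_le (by norm_num) (Nat.cast_nonneg _)) hc
          · refine Or.inr ⟨b, hbS, hb78, hb77, fun i' hi' hlt' => ?_⟩
            rcases hlast i' hlt' with hl | rfl
            · exact hmax i' hi' hl
            · rw [hb77] at hc
              exact_mod_cast not_lt.1 hc
    · have hi : i ∈ S := by
        by_contra hi
        simp [hi] at hlt
      rcases hinv with ⟨hm1, hall⟩ | ⟨b, hbS, hb78, hb77, hmax⟩
      · exact Or.inl ⟨hm1, fun j hj => (hlast j hj).elim (hall j) fun e => e ▸ hi⟩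
      · exact Or.inr ⟨b, hbS, hb78, hb77, fun j hj hlt' =>
          (hlast j hlt').elim (hmax j hj) fun e => absurd (e ▸ hi) hj⟩
  · rintro s' - - (⟨-, hall⟩ | ⟨b, hbS, hb78, -, hmax⟩)
    · have : S = Finset.univ := Finset.eq_univ_of_forall fun i => hall i i.2
      simp [this] at hS
    · exact ⟨b, hbS, hb78, fun i hi => hmax i hi i.2⟩

theorem removeProg_spec {I : Input} {G : ℝ} {Q : ℕ} (hb : I.SizeBound G Q) {s : Store}
    (h : I.Env s) (h83 : s.reg 83 = (I.samples * I.m : ℕ)) {b : Fin I.m}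
    (h78 : s.reg 78 = (b : ℕ)) :
    removeProg.wp G Q (fun s' => ∀ e < I.samples * I.m,
      s'.arr 13 e = if s.arr 12 (e * I.m + b) < 1 then s.arr 13 e else 0) s := by
  refine wp_forLoop (n := I.samples * I.m) (fun n s' => ∀ e, s'.arr 13 e =
    if e < n then if s.arr 12 (e * I.m + b) < 1 then s.arr 13 e else 0 else s.arr 13 e) h83 h.one
    hb.samples_mul (by decide) (by simp) ?_ ?_
  · intro n hn s' hn' hf hinv
    have h' : I.Env s' := h.frame hf (by decide)
    have e78 : s'.reg 78 = (b : ℕ) := by rw [hf.1 78 rfl, h78]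
    have e12 : s'.arr 12 = s.arr 12 := hf.2 12 rfl
    have g1 : ⌊(n : ℝ) * I.m + (b : ℕ)⌋₊ = n * I.m + b := by
      exact_mod_cast Nat.floor_natCast (n * I.m + (b : ℕ))
    simp only [wp_block_cons, wp_block_nil, wp_mul, wp_add, wp_load, wp_const, wp_store, wp_ite,
      wp_skip, Store.setReg_reg, Store.setReg_arr, Store.setArr_arr, Test.Holds, Nat.reduceEqDiff,
      if_false, if_true, hn', h'.m, e78, e12, g1, h'.one, Nat.floor_natCast, true_and, hinv]
    refine ⟨by simpa using hb.natCast hb.m, fun hc e => ?_, fun hc e => ?_⟩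
    · rcases lt_trichotomy e n with he | rfl | he
      · simp [he, he.trans (Nat.lt_succ_self n)]
      · simp [hc]
      · simp [show ¬ e < n by omega, show ¬ e < n + 1 by omega]
    · rcases lt_trichotomy e n with he | rfl | he
      · simp [he, he.ne, he.trans (Nat.lt_succ_self n)]
      · simp [hc]
      · simp [he.ne', show ¬ e < n by omega, show ¬ e < n + 1 by omega]
  · intro s' _ _ hinv e he
    rw [hinv, if_pos he]

open Classical in
-- Hence the weights for the enlarged selection arise by deleting the samples that lie in the new
-- ball; gains need not be recomputed from the geometry.
theorem sampleWt_insert {I : Input} {a j : ℕ → ℤ} {cu : ℕ → ℕ → (ℕ → ℕ) × (ℕ → ℕ)}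
    (S : Finset (Fin I.m)) (b i : Fin I.m) (v : ℕ) :
    I.sampleWt a j cu (insert b S) i v =
      if I.samplePoint a j cu i v ∈ I.ball b then 0 else I.sampleWt a j cu S i v := by
  by_cases hm : I.samplePoint a j cu i v ∈ I.ball b
  · simp [Input.sampleWt, hm]
  · simp [Input.sampleWt, hm]

open Classical in
theorem greedyProg_spec {I : Input} {G : ℝ} {Q : ℕ} (hI : I.Valid) (hb : I.SizeBound G Q)
    {s : Store} (h : I.Env s) (h17 : s.reg 17 = I.samples)
    (h83 : s.reg 83 = (I.samples * I.m : ℕ)) (h2 : s.arr 2 = fun _ => 0)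
    {a j : ℕ → ℤ} {cu : ℕ → ℕ → (ℕ → ℕ) × (ℕ → ℕ)} {v : ℕ → ℕ}
    (h1213 : ∀ τ < I.samples, ∀ i : Fin I.m,
        (0 < I.size j i → ∀ i' : Fin I.m, s.arr 12 ((τ * I.m + i) * I.m + i') =
          if I.samplePoint a j cu i (v τ) ∈ I.ball i' then 1 else 0) ∧
        s.arr 13 (τ * I.m + i) = I.sampleWt a j cu ∅ i (v τ)) :
    greedyProg.wp G Q (fun s' => ∃ S : Finset (Fin I.m),
      GreedyRun (fun S i => ((∑ τ ∈ Finset.range I.samples,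
        I.sampleWt a j cu S i (v τ) : ℕ) : ℝ)) I.k S ∧
      ∀ i : Fin I.m, s'.arr 2 i = if i ∈ S then 1 else 0) s := by
  refine wp_forLoop (n := I.k) (fun n s' => ∃ S : Finset (Fin I.m),
      GreedyRun (fun S i => ((∑ τ ∈ Finset.range I.samples,
        I.sampleWt a j cu S i (v τ) : ℕ) : ℝ)) n S ∧
      (∀ i : Fin I.m, s'.arr 2 i = if i ∈ S then 1 else 0) ∧
      ∀ τ < I.samples, ∀ i : Fin I.m, s'.arr 13 (τ * I.m + i) = I.sampleWt a j cu S i (v τ))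
    h.k h.one hb.k (by decide) ?_ ?_ ?_
  · exact ⟨∅, .zero, by simp [h2], fun τ hτ i => (h1213 τ hτ i).2⟩
  · rintro n hn s' hn' hf ⟨S, hS, i2, i13⟩
    have h' : I.Env s' := h.frame hf (by decide)
    have hcard : S.card < I.m := by
      rw [hS.card_eq]
      exact hn.trans_le hI.k_le
    simp only [wp_block_cons]
    refine wp_mono (wp_frame (bestProg_spec hb h' (by rw [hf.1 17 rfl, h17]) hcard i2 i13)) ?_
    rintro st ⟨⟨b, hbS, h78, hmax⟩, hf'⟩
    have hst : I.Env st := h'.frame hf' (by decide)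
    simp only [wp_block_cons, wp_store, h78, Nat.floor_natCast, hst.one]
    refine wp_mono (wp_frame (removeProg_spec (b := b) hb (by simpa using hst) ?_
      (by simpa using h78))) ?_
    · rw [Store.setArr_reg, hf'.1 83 rfl, hf.1 83 rfl, h83]
    · rintro st' ⟨o13, hf''⟩
      refine ⟨insert b S, hS.succ hbS fun i hi => by exact_mod_cast hmax i hi, fun i => ?_,
        fun τ hτ i => ?_⟩
      · rw [Store.setReg_arr, hf''.2 2 rfl, Store.setArr_arr, hf'.2 2 rfl, i2]
        by_cases hib : i = b
        · simp [hib]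
        · simp [hib, Fin.ext_iff.not.1 hib]
      · have hlt : τ * I.m + i < I.samples * I.m := by
          have := i.2
          nlinarith
        have e13 : st.arr 13 = s'.arr 13 := hf'.2 13 rfl
        have e12 : st.arr 12 = s.arr 12 := (hf'.2 12 rfl).trans (hf.2 12 rfl)
        rw [Store.setReg_arr, o13 _ hlt, sampleWt_insert]
        simp only [Store.setArr_arr, Nat.reduceEqDiff, false_and, if_false, e13, e12, i13 τ hτ i]
        -- For an empty superset the membership row is unspecified, but the weight is 0 whether or
        -- not it is deleted.
        by_cases hsz : 0 < I.size j i
        · rw [(h1213 τ hτ i).1 hsz b]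
          by_cases hm : I.samplePoint a j cu i (v τ) ∈ I.ball b
          · simp [hm]
          · simp [hm]
        · simp [Input.sampleWt, hsz]
  · rintro s' - - ⟨S, hS, i2, -⟩
    exact ⟨S, hS, i2⟩

/-! ### The program -/

/-- Everything that precedes the random choice. -/
def prepareProg : Prog :=
  block [paramProg, countProg, coordProg, scaleProg, cellProg, sizeProg]

/-- Everything that follows the random choice. -/
def selectProg : Prog := block [digitProg, sampleProg, greedyProg]

theorem prepareProg_spec {I : Input} {G : ℝ} {Q : ℕ} (hI : I.Valid) (hb : I.SizeBound G Q) :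
    prepareProg.wp G Q (fun s => ∃ a j, I.Prepared a j s ∧
      s.reg 19 = (I.prodSize j ^ I.samples : ℕ)) I.store := by
  simp only [prepareProg, wp_block_cons]
  refine wp_mono (paramProg_spec hb) fun s1 ⟨h1, h5, harr⟩ => ?_
  simp only [wp_block_cons]
  refine wp_mono (wp_frame (countProg_spec hI hb h1 h5)) fun s2 ⟨h17, f2⟩ => ?_
  have a2 : ∀ x, s2.arr x = I.store.arr x := fun x => (f2.2 x rfl).trans (congrFun harr x)
  have h2 := h1.frame f2 (by decide)
  simp only [wp_block_cons]
  refine wp_mono (wp_frame (coordProg_spec hI hb h2 (a2 1))) fun s3 ⟨⟨a, j, hc, h34⟩, f3⟩ => ?_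
  have h3 := h2.frame f3 (by decide)
  have a3 : ∀ x, x ≠ 3 → x ≠ 4 → s3.arr x = I.store.arr x := fun x hx hx' => by
    refine (f3.2 x ?_).trans (a2 x)
    simp [coordProg, forLoop, block, modArr, hx, hx']
  simp only [wp_block_cons]
  refine wp_mono (wp_frame (scaleProg_spec hI hb h3 (a3 0 (by decide) (by decide)) hc
    fun e he => (h34 e he).2)) fun s4 ⟨h567, f4⟩ => ?_
  have h4 := h3.frame f4 (by decide)
  simp only [wp_block_cons]
  refine wp_mono (wp_frame (cellProg_spec (j := j) hb h4 hc (fun e he => ?_)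
    fun i hi => (h567 i hi).1)) fun s5 ⟨h9, f5⟩ => ?_
  · rw [f4.2 4 rfl, (h34 e he).2]
  have h5 := h4.frame f5 (by decide)
  have q17 : s5.reg 17 = I.samples := by rw [f5.1 17 rfl, f4.1 17 rfl, f3.1 17 rfl, h17]
  simp only [wp_block_cons]
  refine wp_mono (wp_frame (sizeProg_spec (j := j) hb h5 (fun i hi => ?_) (fun i hi => ?_) h9 q17))
    fun s6 ⟨⟨h10, h18, h19⟩, f6⟩ => ?_
  · rw [f5.2 6 rfl, (h567 i hi).2.1]
  · rw [f5.2 7 rfl, (h567 i hi).2.2]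
  · refine ⟨a, j, ⟨h5.frame f6 (by decide), hc, ?_, ?_, ?_, fun e he => ?_, fun e he => ?_,
      fun i hi => ?_, fun i hi => ?_, fun i hi => ?_, fun i hi t ht x hx => ?_, h10, ?_, h18⟩, h19⟩
    · rw [f6.2 0 rfl, f5.2 0 rfl, f4.2 0 rfl, a3 0 (by decide) (by decide)]
    · rw [f6.2 1 rfl, f5.2 1 rfl, f4.2 1 rfl, a3 1 (by decide) (by decide)]
    · rw [f6.2 2 rfl, f5.2 2 rfl, f4.2 2 rfl, a3 2 (by decide) (by decide)]
      rfl
    · rw [f6.2 3 rfl, f5.2 3 rfl, f4.2 3 rfl, (h34 e he).1]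
    · rw [f6.2 4 rfl, f5.2 4 rfl, f4.2 4 rfl, (h34 e he).2]
    · rw [f6.2 5 rfl, f5.2 5 rfl, (h567 i hi).1]
    · rw [f6.2 6 rfl, f5.2 6 rfl, (h567 i hi).2.1]
    · rw [f6.2 7 rfl, f5.2 7 rfl, (h567 i hi).2.2]
    · rw [f6.2 9 rfl, h9 i hi t ht x hx]
    · rw [f6.1 17 rfl, q17]

open Classical in
theorem selectProg_spec {I : Input} {G : ℝ} {Q : ℕ} (hI : I.Valid) (hb : I.SizeBound G Q)
    {s : Store} {a j : ℕ → ℤ} (h : I.Prepared a j s) {cu : ℕ → ℕ → (ℕ → ℕ) × (ℕ → ℕ)}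
    (hcu : ∀ i, ∀ R < I.size j i, I.BallAdm j i (cu i R).1 (cu i R).2 ∧
      rank I.C (I.scale i) (I.ballKey j i) I.d (I.acc j i) (cu i R).1 (cu i R).2 = R)
    {v : ℕ} (h19 : s.reg 19 = v) :
    selectProg.wp G Q (fun s' => ∃ S : Finset (Fin I.m),
      GreedyRun (fun S i => ((∑ τ ∈ Finset.range I.samples, I.sampleWt a j cu S i
        (v / I.prodSize j ^ τ % I.prodSize j) : ℕ) : ℝ)) I.k S ∧
      ∀ i : Fin I.m, s'.arr 2 i = if i ∈ S then 1 else 0) s := by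
  simp only [selectProg, wp_block_cons]
  refine wp_mono (wp_frame (digitProg_spec hb h.env h.reg17 h.reg18 h19)) fun s1 ⟨h14, f1⟩ => ?_
  have h1 := h.frame f1 (by decide) (by decide) (by decide)
  simp only [wp_block_cons]
  refine wp_mono (wp_frame (sampleProg_spec hI hb h1 hcu h14)) fun s2 ⟨⟨h83, h1213⟩, f2⟩ => ?_
  have h2 := h1.frame f2 (by decide) (by decide) (by decide)
  exact greedyProg_spec hI hb h2.env h2.reg17 h83 h2.arr2 h1213

/-! ### The success probability -/

theorem count_mod {s : ℕ} (p : ℕ → Prop) [DecidablePred p] (q : ℕ) :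
    Nat.count (fun x => p (x % s)) (q * s) = q * Nat.count p s := by
  induction q with
  | zero => simp
  | succ q ih =>
    rw [Nat.succ_mul, Nat.count_add, ih, Nat.succ_mul, add_right_inj,
      Nat.count_eq_card_filter_range, Nat.count_eq_card_filter_range]
    congr 1
    refine Finset.filter_congr fun x hx => ?_
    rw [Nat.mul_comm, Nat.mul_add_mod, Nat.mod_eq_of_lt (Finset.mem_range.1 hx)]

/-- The remainders of 0, …, M - 1 modulo a divisor s take each value equally often. This is why the
base of the digits is a common multiple of the sizes. -/
theorem card_filter_fin_mod {s M : ℕ} (hs : s ∣ M) (p : ℕ → Prop) [DecidablePred p] :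
    (Finset.univ.filter fun x : Fin M => p (x % s)).card * s =
      M * ((Finset.range s).filter p).card := by
  obtain ⟨q, rfl⟩ := hs
  have h1 : (Finset.univ.filter fun x : Fin (s * q) => p (x % s)).card =
      Nat.count (fun x => p (x % s)) (q * s) := by
    rw [Nat.mul_comm q s, Nat.count_eq_card_filter_range, Finset.card_filter, Finset.card_filter]
    exact Fin.sum_univ_eq_sum_range (fun x => if p (x % s) then 1 else 0) (s * q)
  rw [h1, count_mod, Nat.count_eq_card_filter_range]
  ring

/-- The program compares sums of weights, the analysis uses averages; a common nonnegative divisor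
preserves the order. -/
theorem GreedyRun.div {ι : Type*} [DecidableEq ι] {gain : Finset ι → ι → ℝ} {n : ℕ}
    {S : Finset ι} (h : GreedyRun gain n S) {N : ℝ} (hN : 0 ≤ N) :
    GreedyRun (fun S i => gain S i / N) n S := by
  induction h with
  | zero => exact .zero
  | succ _ hi hmax ih => exact ih.succ hi fun i' hi' => div_le_div_of_nonneg_right (hmax i' hi') hN

namespace Input

variable {I : Input}

theorem size_dvd_prodSize {j : ℕ → ℤ} {i : ℕ} (hi : i < I.m) (hs : 0 < I.size j i) :
    I.size j i ∣ I.prodSize j := by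
  have h := Finset.dvd_prod_of_mem (fun i => max (I.size j i) 1) (Finset.mem_range.2 hi)
  rwa [max_eq_left hs] at h

theorem prodSize_pos (j : ℕ → ℤ) : 0 < I.prodSize j :=
  Finset.prod_pos fun i _ => by omega

/-- The failure probability of the sampling, as given by the union bound over all `S` and `i`. -/
theorem union_bound (hI : I.Valid) (hk : 0 < I.k) :
    (Fintype.card (Finset (Fin I.m) × Fin I.m) : ℝ) *
      (2 * Real.exp (-(I.samples * ((1 / (100 * (I.k : ℝ) ^ 2)) ^ 2 / 2)))) ≤ I.failure := by
  have hk' : (0 : ℝ) < I.k := by exact_mod_cast hk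
  -- With η = 1/(100 k²) one has η²/2 = 1/(20000 k⁴), which explains the constant 20000 and the
  -- power k⁴ in `samples`.
  have he : (I.samples * ((1 / (100 * (I.k : ℝ) ^ 2)) ^ 2 / 2) : ℝ) =
      (2 * I.m + 1 + I.bits : ℕ) := by
    rw [samples]
    push_cast
    field_simp
    ring
  have h2 : (2 : ℝ) ≤ Real.exp 1 := by
    have := Real.add_one_le_exp 1
    linarith
  have h3 : (2 : ℝ) ^ (2 * I.m + 1 + I.bits) ≤ Real.exp ((2 * I.m + 1 + I.bits : ℕ) : ℝ) := by
    rw [← Real.exp_one_pow]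
    exact pow_le_pow_left₀ (by norm_num) h2 _
  have h4 : (I.m : ℝ) ≤ 2 ^ I.m := by exact_mod_cast (Nat.lt_two_pow_self).le
  have h5 := one_le_failure_mul_two_pow hI
  rw [he, Real.exp_neg, Fintype.card_prod, Fintype.card_finset, Fintype.card_fin]
  push_cast
  rw [← mul_assoc, ← div_eq_mul_inv, div_le_iff₀ (Real.exp_pos _)]
  push_cast at h3
  -- Of the exponent 2 m + 1 + bits, one m pays for the choice of S, one for the choice of i by m ≤
  -- 2^m, the 1 for the two-sided estimate, and the bits for 1/γ.
  calc (2 : ℝ) ^ I.m * I.m * 2 ≤ 2 ^ I.m * 2 ^ I.m * 2 * 1 := by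
        rw [mul_one]; gcongr
    _ ≤ 2 ^ I.m * 2 ^ I.m * 2 * (I.failure * 2 ^ I.bits) := by gcongr
    _ = I.failure * 2 ^ (2 * I.m + 1 + I.bits) := by ring
    _ ≤ _ := by have := hI.failure_pos; gcongr

variable {a j : ℕ → ℤ} {cu : ℕ → ℕ → (ℕ → ℕ) × (ℕ → ℕ)}

open Classical in
theorem card_filter_samplePoint (h : I.Coords a j) (hI : I.Valid) (i : Fin I.m)
    (hcu : ∀ R < I.size j i, I.BallAdm j i (cu i R).1 (cu i R).2 ∧
      rank I.C (I.scale i) (I.ballKey j i) I.d (I.acc j i) (cu i R).1 (cu i R).2 = R)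
    {B : Set (Fin I.d → ℤ)} (hB : B ⊆ I.ball i) (hs : 0 < I.size j i) :
    ((Finset.univ.filter fun x : Fin (I.prodSize j) => I.samplePoint a j cu i x ∈ B).card : ℝ) /
      I.prodSize j = B.ncard / I.size j i := by
  have h1 := card_filter_fin_mod (size_dvd_prodSize i.2 hs)
    fun R => (fun t : Fin I.d => I.point a i (cu i R).1 (cu i R).2 t) ∈ B
  rw [card_filter_decode h hI i hcu hB] at h1
  have h2 : (0 : ℝ) < I.prodSize j := by exact_mod_cast prodSize_pos j
  have h3 : (0 : ℝ) < I.size j i := by exact_mod_cast hs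
  rw [div_eq_div_iff h2.ne' h3.ne', mul_comm (B.ncard : ℝ)]
  exact_mod_cast h1

open Classical in
/-- If the samples are representative, then the estimated gains are close to the true ones. -/
theorem abs_gain_sub_le (h : I.Coords a j) (hI : I.Valid)
    (hcu : ∀ i, ∀ R < I.size j i, I.BallAdm j i (cu i R).1 (cu i R).2 ∧
      rank I.C (I.scale i) (I.ballKey j i) I.d (I.acc j i) (cu i R).1 (cu i R).2 = R)
    {N : ℕ} (hN : 0 < N) {η : ℝ} (ω : Fin N → Fin (I.prodSize j)) (S : Finset (Fin I.m))
    (i : Fin I.m) {U : Set (Fin I.d → ℤ)} (hU : U = I.ball i \ ⋃ i' ∈ S, I.ball i')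
    (hω : |((Finset.univ.filter fun τ => I.samplePoint a j cu i (ω τ) ∈ U).card : ℝ) -
      N * ((Finset.univ.filter fun x : Fin (I.prodSize j) => I.samplePoint a j cu i x ∈ U).card /
        I.prodSize j)| ≤ η * N) :
    |((∑ τ, I.sampleWt a j cu S i (ω τ) : ℕ) : ℝ) / N - U.ncard| ≤ η * I.size j i := by
  have hUsub : U ⊆ I.ball i := hU ▸ Set.sdiff_subset
  have hN' : (0 : ℝ) < N := by exact_mod_cast hN
  rcases Nat.eq_zero_or_pos (I.size j i) with hs | hs
  · have h1 : U.ncard = 0 := by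
      have h2 := (Set.ncard_le_ncard hUsub (ball_finite i)).trans (ncard_ball_le_size h hI i)
      omega
    simp [sampleWt, hs, h1]
  · have h3 : (0 : ℝ) < I.size j i := by exact_mod_cast hs
    rw [card_filter_samplePoint h hI i (hcu i) hUsub hs] at hω
    have h4 : ∑ τ, I.sampleWt a j cu S i (ω τ) =
        (Finset.univ.filter fun τ => I.samplePoint a j cu i (ω τ) ∈ U).card * I.size j i := by
      simp only [sampleWt, hs, true_and, ← hU]
      rw [← Finset.sum_filter, Finset.sum_const, smul_eq_mul]
    have h5 : ((∑ τ, I.sampleWt a j cu S i (ω τ) : ℕ) : ℝ) / N - U.ncard =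
        I.size j i / N * ((Finset.univ.filter fun τ => I.samplePoint a j cu i (ω τ) ∈ U).card -
          N * (U.ncard / I.size j i)) := by
      rw [h4]
      push_cast
      field_simp
    rw [h5, abs_mul, abs_of_pos (by positivity)]
    calc (I.size j i / N : ℝ) * _ ≤ I.size j i / N * (η * N) := by gcongr
      _ = η * I.size j i := by field_simp

theorem coverage_eq (S : Finset (Fin I.m)) : I.coverage S = cover I.ball S := rfl

/-- The selection is approximately optimal if the estimated gains are close to the true ones. -/
theorem isApprox_of_greedyRun (h : I.Coords a j) (hI : I.Valid)
    {gain : Finset (Fin I.m) → Fin I.m → ℝ}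
    (hg : ∀ S i, 0 < I.k → |gain S i - (I.ball i \ ⋃ i' ∈ S, I.ball i').ncard| ≤
      1 / (100 * (I.k : ℝ) ^ 2) * I.size j i) {S : Finset (Fin I.m)}
    (hS : GreedyRun gain I.k S) : I.IsApprox (1 - 1 / Real.exp 1) S := by
  refine ⟨hS.card_eq, fun J hJ => ?_⟩
  simp only [coverage_eq]
  rcases Nat.eq_zero_or_pos I.k with hk | hk
  · obtain rfl : J = ∅ := Finset.card_eq_zero.1 (hJ.trans hk)
    simp [cover]
  · obtain ⟨J₀, hJ₀, hmax⟩ := (Finset.univ.powersetCard I.k).exists_max_image (cover I.ball)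
      ⟨J, Finset.mem_powersetCard.2 ⟨Finset.subset_univ _, hJ⟩⟩
    have hJ₀' := (Finset.mem_powersetCard.1 hJ₀).2
    have hmax' : ∀ J : Finset (Fin I.m), J.card = I.k → cover I.ball J ≤ cover I.ball J₀ :=
      fun J hJ => hmax J (Finset.mem_powersetCard.2 ⟨Finset.subset_univ _, hJ⟩)
    -- As 1 ≤ k ≤ m, any single ball extends to a selection of k balls. This converts errors
    -- relative to a ball into errors relative to the optimum.
    have hball : ∀ i, (I.ball i).ncard ≤ cover I.ball J₀ := by
      intro i
      obtain ⟨T, hT1, -, hT2⟩ := Finset.exists_subsuperset_card_eq (Finset.subset_univ {i})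
        (by simpa using Nat.succ_le_of_lt hk)
        (by simpa using hI.k_le)
      refine le_trans ?_ (hmax' T hT2)
      refine Set.ncard_le_ncard (fun x hx => ?_) (finite_cover ball_finite T)
      exact Set.mem_biUnion (Finset.singleton_subset_iff.1 hT1) hx
    have key := hS.approx ball_finite hk hJ₀' fun S i => (hg S i hk).trans ?_
    · refine le_trans ?_ key
      have h1 : 0 ≤ 1 - 1 / Real.exp 1 := by
        rw [sub_nonneg, div_le_one (Real.exp_pos _)]
        exact Real.one_le_exp zero_le_one
      have h2 : (cover I.ball J : ℝ) ≤ cover I.ball J₀ := by exact_mod_cast hmax' J hJ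
      gcongr
    · have h3 := size_le h hI i
      have h4 : ((I.ball i).ncard : ℝ) ≤ cover I.ball J₀ := by exact_mod_cast hball i
      calc 1 / (100 * (I.k : ℝ) ^ 2) * I.size j i
          ≤ 1 / (100 * (I.k : ℝ) ^ 2) * (3 * cover I.ball J₀) := by
            gcongr
            linarith
        _ = _ := by ring

/-- Digit expansion is a bijection between numbers below M^N and sample sequences, so the proportion
of good sequences is the proportion of good numbers. Goodness covers all pairs (S, i), hence every
greedy run on such a number succeeds. -/
theorem exists_good_numbers (h : I.Coords a j) (hI : I.Valid)
    (hcu : ∀ i, ∀ R < I.size j i, I.BallAdm j i (cu i R).1 (cu i R).2 ∧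
      rank I.C (I.scale i) (I.ballKey j i) I.d (I.acc j i) (cu i R).1 (cu i R).2 = R) :
    ∃ V : Finset (Fin (I.prodSize j ^ I.samples)),
      (1 - I.failure) * (I.prodSize j ^ I.samples : ℕ) ≤ V.card ∧
      ∀ v ∈ V, ∀ S, GreedyRun (fun S i => ((∑ τ ∈ Finset.range I.samples,
        I.sampleWt a j cu S i (v / I.prodSize j ^ τ % I.prodSize j) : ℕ) : ℝ)) I.k S →
        I.IsApprox (1 - 1 / Real.exp 1) S := by
  classical
  -- For k = 0 no samples are taken, and the empty selection is trivially optimal.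
  rcases Nat.eq_zero_or_pos I.k with hk | hk
  · refine ⟨Finset.univ, ?_, fun v _ S hS => isApprox_of_greedyRun h hI (fun _ _ h => by omega) hS⟩
    rw [Finset.card_univ, Fintype.card_fin]
    have := hI.failure_pos
    exact mul_le_of_le_one_left (Nat.cast_nonneg _) (by linarith)
  · obtain ⟨V, hV, hgood⟩ := exists_good_samples (prodSize_pos j)
      (fun (q : Finset (Fin I.m) × Fin I.m) x => I.samplePoint a j cu q.2 x ∈
        I.ball q.2 \ ⋃ i' ∈ q.1, I.ball i') (by positivity) (union_bound hI hk)
    refine ⟨V.map finFunctionFinEquiv.toEmbedding, ?_, fun v hv S hS => ?_⟩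
    · rw [Finset.card_map]
      exact_mod_cast hV
    · obtain ⟨ω, hω, rfl⟩ := Finset.mem_map.1 hv
      have hN : 0 < I.samples := by
        rw [samples]
        positivity
      refine isApprox_of_greedyRun h hI (fun S i _ => ?_) (hS.div (Nat.cast_nonneg I.samples))
      have hdig : ∀ τ : Fin I.samples, (finFunctionFinEquiv ω : ℕ) / I.prodSize j ^ (τ : ℕ) %
          I.prodSize j = ω τ := by
        intro τ
        have := congrFun (finFunctionFinEquiv.symm_apply_apply ω) τ
        exact congrArg Fin.val this
      have hsum : ∑ τ ∈ Finset.range I.samples, I.sampleWt a j cu S i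
          ((finFunctionFinEquiv ω : ℕ) / I.prodSize j ^ τ % I.prodSize j) =
          ∑ τ, I.sampleWt a j cu S i (ω τ) := by
        rw [← Fin.sum_univ_eq_sum_range fun τ => I.sampleWt a j cu S i
          ((finFunctionFinEquiv ω : ℕ) / I.prodSize j ^ τ % I.prodSize j)]
        exact Finset.sum_congr rfl fun τ _ => by rw [hdig]
      have := abs_gain_sub_le h hI hcu hN ω S i rfl (by convert hgood ω hω (S, i))
      rw [← hsum] at this
      exact this

end Input

/-! ### The size of the numbers -/

namespace Input

variable {I : Input}

/-- Everything is bounded by pure powers of q; numerical constants are absorbed by 8 q^n ≤ q^(n+1),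
at the price of generous exponents. -/
theorem parameters_le {q : ℕ} (hq : 20000 ≤ q) (hd : I.d ≤ q) (hL : I.L ≤ q) (hLam : I.Lam ≤ q) :
    I.E ≤ q ^ 4 ∧ I.F ≤ q ^ 6 ∧ I.Z ≤ q ^ 7 ∧ I.C ≤ q ^ 8 ∧ I.W ≤ q ^ 16 ∧ I.O ≤ q ^ 8 ∧
      I.X ≤ q ^ 26 := by
  have h1 : ∀ n, 1 ≤ q ^ n := fun n => Nat.one_le_pow _ _ (by omega)
  have h8 : ∀ n, 8 * q ^ n ≤ q ^ (n + 1) := fun n => by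
    rw [pow_succ, mul_comm]
    gcongr
    omega
  have hE : I.E ≤ q ^ 4 := calc
    I.E ≤ q * (q ^ 2 + q * q) := by rw [E]; gcongr; exact h1 2
    _ = 2 * q ^ 3 := by ring
    _ ≤ q ^ 4 := le_trans (by gcongr; norm_num) (h8 3)
  have hF : I.F ≤ q ^ 6 := calc
    I.F ≤ 8 * (q * q ^ 4) := by rw [F]; gcongr
    _ = 8 * q ^ 5 := by ring
    _ ≤ q ^ 6 := h8 5
  have hZ : I.Z ≤ q ^ 7 := calc
    I.Z ≤ 8 * q ^ 6 := by rw [Z]; gcongr; norm_num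
    _ ≤ q ^ 7 := h8 6
  have hC : I.C ≤ q ^ 8 := calc
    I.C ≤ 2 * q ^ 7 + q ^ 7 := by rw [C]; gcongr; exact h1 7
    _ = 3 * q ^ 7 := by ring
    _ ≤ q ^ 8 := le_trans (by gcongr; norm_num) (h8 7)
  have hW : I.W ≤ q ^ 16 := calc
    I.W ≤ q * (q ^ 7) ^ 2 + q ^ 15 := by rw [W]; gcongr; exact h1 15
    _ = 2 * q ^ 15 := by ring
    _ ≤ q ^ 16 := le_trans (by gcongr; norm_num) (h8 15)
  have hO : I.O ≤ q ^ 8 := calc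
    I.O ≤ q ^ 7 * q := by rw [O]; gcongr
    _ = q ^ 8 := by ring
  have hX : I.X ≤ q ^ 26 := calc
    I.X ≤ q * ((q ^ 7) ^ 2 * q ^ 10 + 2 * q ^ 16 * q ^ 8) + q ^ 25 := by
        rw [X]; gcongr
        · exact (Nat.pow_le_pow_left hZ 2).trans (Nat.le_mul_of_pos_right _ (h1 10))
        · exact h1 25
    _ = 4 * q ^ 25 := by ring
    _ ≤ q ^ 26 := le_trans (by gcongr; norm_num) (h8 25)
  exact ⟨hE, hF, hZ, hC, hW, hO, hX⟩

theorem abs_radius_add_le (i : Fin I.m) : |I.radius i| + ∑ t, |I.center i t| ≤ I.magnitude :=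
  Finset.single_le_sum (f := fun i => |I.radius i| + ∑ t, |I.center i t|)
    (fun i _ => by positivity) (Finset.mem_univ i)

theorem magnitude_nonneg : 0 ≤ I.magnitude := Finset.sum_nonneg fun i _ => by positivity

theorem abs_r_le {i : ℕ} (hi : i < I.m) : |I.r i| ≤ I.magnitude := by
  have h1 := abs_radius_add_le (I := I) ⟨i, hi⟩
  have h2 : 0 ≤ ∑ t, |I.center ⟨i, hi⟩ t| := by positivity
  have h3 := r_eq (I := I) ⟨i, hi⟩
  change I.r i = _ at h3
  rw [h3]
  linarith

theorem abs_p_le {i t : ℕ} (hi : i < I.m) (ht : t < I.d) : |I.p (i * I.d + t)| ≤ I.magnitude := by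
  have h1 := abs_radius_add_le (I := I) ⟨i, hi⟩
  have h2 := Finset.single_le_sum (f := fun t => |I.center ⟨i, hi⟩ t|)
    (fun i _ => by positivity) (Finset.mem_univ ⟨t, ht⟩)
  have h3 := p_eq (I := I) ⟨i, hi⟩ ⟨t, ht⟩
  change I.p (i * I.d + t) = _ at h3
  have h4 := abs_nonneg (I.radius ⟨i, hi⟩)
  rw [h3]
  linarith

theorem scale_le (hI : I.Valid) {i : ℕ} (hi : i < I.m) : (I.scale i : ℝ) ≤ 2 + I.magnitude := by
  have h0 := magnitude_nonneg (I := I)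
  by_cases h : I.r i < I.F
  · rw [scale, if_pos h]
    push_cast
    linarith
  · have hF : (1 : ℝ) ≤ I.F := by exact_mod_cast F_pos hI.d_pos
    have h1 := (two_mul_scale_mul_E_le hI.d_pos h).1
    have h2 := (le_abs_self _).trans (abs_r_le hi)
    have h3 : (0 : ℝ) ≤ I.scale i := by positivity
    nlinarith

/-- The C copies of 2 + magnitude come from the rescaled coordinate, the 3 from the remainder and
the two center coordinates, and L Λ from writing `a` as p - jλ. -/
theorem abs_point_sub_le (hI : I.Valid) {a j : ℕ → ℤ} (h : I.Coords a j) {i i' t : ℕ}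
    (hi : i < I.m) (hi' : i' < I.m) (ht : t < I.d) {c u : ℕ → ℕ} (hc : c t < I.C)
    (hu : u t < I.scale i) : |(I.point a i c u t : ℝ) - I.p (i' * I.d + t)| ≤
      (I.C + 3) * (2 + I.magnitude) + I.L * I.Lam := by
  have hlt := idx_lt (I := I) ⟨i, hi⟩ ht
  have h1 := scale_le hI hi
  have h2 := abs_p_le hi ht
  have h3 := abs_p_le hi' ht
  have h4 : (a (i * I.d + t) : ℝ) = I.p (i * I.d + t) - j (i * I.d + t) * I.lam := by
    rw [h.eq _ hlt]; ring
  have h5 : |(j (i * I.d + t) : ℝ) * I.lam| ≤ I.L * I.Lam := by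
    rw [abs_mul]
    have h6 : |(j (i * I.d + t) : ℝ)| ≤ I.L := by exact_mod_cast h.abs_le _ hlt
    exact mul_le_mul h6 abs_lam_le (abs_nonneg _) (by positivity)
  have h7 : |((c t : ℝ) - I.Z) * I.scale i| ≤ I.C * (2 + I.magnitude) := by
    rw [abs_mul]
    have h8 : |(c t : ℝ) - I.Z| ≤ I.C := by
      have e1 : (c t : ℝ) ≤ I.C := by exact_mod_cast hc.le
      have e2 : (I.Z : ℝ) ≤ I.C := by
        have : I.Z ≤ I.C := by rw [C]; omega
        exact_mod_cast this
      have e3 : (0 : ℝ) ≤ c t := by positivity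
      have e4 : (0 : ℝ) ≤ I.Z := by positivity
      rw [abs_le]
      constructor <;> linarith
    rw [abs_of_nonneg (Nat.cast_nonneg' (I.scale i) : (0 : ℝ) ≤ I.scale i)]
    exact mul_le_mul h8 h1 (by positivity) (by positivity)
  have h9 : |(u t : ℝ)| ≤ 2 + I.magnitude := by
    rw [abs_of_nonneg (by positivity)]
    have : (u t : ℝ) ≤ I.scale i := by exact_mod_cast hu.le
    linarith
  have h10 : (I.point a i c u t : ℝ) - I.p (i' * I.d + t) = ((c t : ℝ) - I.Z) * I.scale i + u t +
      (I.p (i * I.d + t) - j (i * I.d + t) * I.lam) - I.p (i' * I.d + t) := by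
    rw [← h4, point]
    push_cast
    ring
  rw [h10]
  rw [abs_le] at h2 h3 h5 h7 h9 ⊢
  constructor <;> linarith [h2.1, h2.2, h3.1, h3.2, h5.1, h5.2, h7.1, h7.2, h9.1, h9.2]

/-- With M = 2 + magnitude and Q = q^40, a superset has at most X (C s)^d ≤ M^(3 Q²) points and the
product over the balls is at most M^(3 Q³). This product is the dominant quantity, and the exponent
Q⁴ of G accommodates it. -/
theorem sizeBound (hI : I.Valid) {q : ℕ} (hq : 20000 ≤ q) (hd : I.d ≤ q) (hm : I.m ≤ q)
    (hk : I.k ≤ q) (hL : I.L ≤ q) (hLam : I.Lam ≤ q) (hbits : I.bits ≤ q) (hl : |I.l| ≤ q) :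
    I.SizeBound ((2 + I.magnitude) ^ (q ^ 40) ^ 4) (q ^ 40) := by
  obtain ⟨hE, hF, hZ, hC, hW, hO, hX⟩ := parameters_le hq hd hL hLam
  have h1 : ∀ n, 1 ≤ q ^ n := fun n => Nat.one_le_pow _ _ (by omega)
  have hQ : ∀ {n a : ℕ}, n ≤ q ^ a → a ≤ 40 → n ≤ q ^ 40 := fun h h' =>
    h.trans (Nat.pow_le_pow_right (by omega) h')
  have h8 : ∀ n, 8 * q ^ n ≤ q ^ (n + 1) := fun n => by
    rw [pow_succ, mul_comm]
    gcongr
    omega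
  have hq1 : ∀ {n : ℕ}, n ≤ q → n ≤ q ^ 1 := fun h => by simpa using h
  have hd1 : I.d + 1 ≤ q ^ 2 := calc
    I.d + 1 ≤ q ^ 1 + q ^ 1 := by gcongr; exacts [hq1 hd, h1 1]
    _ = 2 * q ^ 1 := by ring
    _ ≤ q ^ 2 := le_trans (by gcongr; norm_num) (h8 1)
  have hsamples : I.samples ≤ q ^ 7 := calc
    I.samples ≤ q * q ^ 4 * (2 * q ^ 1 + q ^ 1 + q ^ 1) := by
        rw [samples]; gcongr; exacts [hq1 hm, h1 1, hq1 hbits]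
    _ = q ^ 5 * (4 * q ^ 1) := by ring
    _ ≤ q ^ 5 * q ^ 2 := by gcongr; exact le_trans (by gcongr; norm_num) (h8 1)
    _ = q ^ 7 := by ring
  have hcells : I.m * (I.d + 1) * I.X ≤ q ^ 29 := calc
    I.m * (I.d + 1) * I.X ≤ q * q ^ 2 * q ^ 26 := by gcongr
    _ = q ^ 29 := by ring
  have hmd : I.m * I.d ≤ q ^ 2 := by rw [sq]; gcongr
  have h2L : 2 * I.L + 1 ≤ q ^ 2 := calc
    2 * I.L + 1 ≤ 2 * q ^ 1 + q ^ 1 := by gcongr; exacts [hq1 hL, h1 1]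
    _ = 3 * q ^ 1 := by ring
    _ ≤ q ^ 2 := le_trans (by gcongr; norm_num) (h8 1)
  have h2F : 2 * I.F + I.E ≤ q ^ 7 := calc
    2 * I.F + I.E ≤ 2 * q ^ 6 + q ^ 6 := by
        gcongr; exact hE.trans (Nat.pow_le_pow_right (by omega) (by norm_num))
    _ = 3 * q ^ 6 := by ring
    _ ≤ q ^ 7 := le_trans (by gcongr; norm_num) (h8 6)
  have hsm : I.samples * I.m ≤ q ^ 8 := calc
    I.samples * I.m ≤ q ^ 7 * q := by gcongr
    _ = q ^ 8 := by ring
  have hLL : I.L * I.Lam ≤ q ^ 2 := by rw [sq]; gcongr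
  have hC3 : I.C + 3 ≤ q ^ 9 := calc
    I.C + 3 ≤ q ^ 8 + 3 * q ^ 8 := by gcongr; have := h1 8; omega
    _ = 4 * q ^ 8 := by ring
    _ ≤ q ^ 9 := le_trans (by gcongr; norm_num) (h8 8)
  have h2q : 2 * q ≤ q ^ 2 := by rw [sq]; gcongr; omega
  -- The power is made opaque so that later steps do not unfold it.
  obtain ⟨Q, hQe⟩ : ∃ Q, q ^ 40 = Q := ⟨_, rfl⟩
  obtain ⟨M, hM⟩ : ∃ M, 2 + I.magnitude = M := ⟨_, rfl⟩
  have hmag := magnitude_nonneg (I := I)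
  have hM2 : 2 ≤ M := by linarith
  have hM1 : 1 ≤ M := by linarith
  rw [hQe, hM]
  rw [hQe] at hQ
  have hQ8 : 20000 ≤ Q := hQ (hq1 hq |> le_trans (by simp)) (by norm_num)
  have hnat : ∀ n : ℕ, (n : ℝ) ≤ M ^ n := fun n => calc
    (n : ℝ) ≤ 2 ^ n := by exact_mod_cast (Nat.lt_two_pow_self).le
    _ ≤ M ^ n := by gcongr
  have hmono : ∀ {x : ℝ} {n : ℕ}, x ≤ M ^ n → n ≤ Q ^ 4 → x ≤ M ^ Q ^ 4 := fun h h' =>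
    h.trans (pow_le_pow_right₀ hM1 h')
  have hpow : ∀ {a b : ℕ}, a ≤ 3 → b ≤ 4 → Q ^ a + b * Q ^ a ≤ Q ^ 4 := by
    intro a b ha hb
    calc Q ^ a + b * Q ^ a ≤ Q ^ 3 + 4 * Q ^ 3 := by gcongr <;> omega
      _ = 5 * Q ^ 3 := by ring
      _ ≤ Q * Q ^ 3 := by gcongr; omega
      _ = Q ^ 4 := by ring
  have hQG : (Q : ℝ) ≤ M ^ Q ^ 4 := hmono (hnat Q) (by simpa using Nat.le_self_pow (by norm_num) Q)
  have hMG : M ≤ M ^ Q ^ 4 := le_self_pow₀ hM1 (by positivity)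
  have hCs : ∀ i < I.m, ((I.C * I.scale i : ℕ) : ℝ) ≤ M ^ (2 * Q) := by
    intro i hi
    have e1 : (I.C : ℝ) ≤ Q := by exact_mod_cast hQ hC (by norm_num)
    have e2 := scale_le hI hi
    rw [hM] at e2
    push_cast
    calc (I.C : ℝ) * I.scale i ≤ M ^ Q * M ^ Q := by
          gcongr
          · exact e1.trans (hnat Q)
          · exact e2.trans (le_self_pow₀ hM1 (by omega))
      _ = M ^ (2 * Q) := by ring
  have hCs1 : ∀ i < I.m, 1 ≤ I.C * I.scale i := fun i hi =>
    Nat.mul_pos (by rw [C]; omega) (one_le_scale i hI.d_pos)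
  have hCst : ∀ i < I.m, ∀ t ≤ I.d, (((I.C * I.scale i) ^ t : ℕ) : ℝ) ≤ M ^ (2 * Q ^ 2) := by
    intro i hi t ht
    have e1 : t ≤ Q := ht.trans (hQ (hq1 hd) (by norm_num))
    calc (((I.C * I.scale i) ^ t : ℕ) : ℝ) ≤ ((I.C * I.scale i : ℕ) : ℝ) ^ Q := by
          push_cast
          exact_mod_cast Nat.pow_le_pow_right (hCs1 i hi) e1
      _ ≤ (M ^ (2 * Q)) ^ Q := by gcongr; exact hCs i hi
      _ = M ^ (2 * Q ^ 2) := by ring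
  have hsize : ∀ j, ∀ i < I.m, (I.size j i : ℝ) ≤ M ^ (3 * Q ^ 2) := by
    intro j i hi
    have e1 : (I.X : ℝ) ≤ M ^ Q ^ 2 := calc
      (I.X : ℝ) ≤ Q := by exact_mod_cast hQ hX (by norm_num)
      _ ≤ M ^ Q := hnat Q
      _ ≤ M ^ Q ^ 2 := pow_le_pow_right₀ hM1 (Nat.le_self_pow (by norm_num) Q)
    calc (I.size j i : ℝ) ≤ ((I.X * (I.C * I.scale i) ^ I.d : ℕ) : ℝ) := by
          exact_mod_cast total_le
      _ = I.X * (((I.C * I.scale i) ^ I.d : ℕ) : ℝ) := by push_cast; ring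
      _ ≤ M ^ Q ^ 2 * M ^ (2 * Q ^ 2) := by gcongr; exact hCst i hi I.d le_rfl
      _ = M ^ (3 * Q ^ 2) := by ring
  have hprod : ∀ j, (I.prodSize j : ℝ) ≤ M ^ (3 * Q ^ 3) := by
    intro j
    have e1 : I.m ≤ Q := hQ (hq1 hm) (by norm_num)
    rw [prodSize]
    push_cast
    calc ∏ i ∈ Finset.range I.m, max (I.size j i : ℝ) 1
        ≤ ∏ i ∈ Finset.range I.m, M ^ (3 * Q ^ 2) := Finset.prod_le_prod (fun i _ => by positivity)
          fun i hi => max_le (hsize j i (Finset.mem_range.1 hi)) (one_le_pow₀ hM1)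
      _ = (M ^ (3 * Q ^ 2)) ^ I.m := by rw [Finset.prod_const, Finset.card_range]
      _ ≤ (M ^ (3 * Q ^ 2)) ^ Q := pow_le_pow_right₀ (one_le_pow₀ hM1) e1
      _ = M ^ (3 * Q ^ 3) := by ring
  have hlamQ : 2 * |I.lam| ≤ Q := calc
    2 * |I.lam| ≤ 2 * q := by
        gcongr
        exact abs_lam_le.trans (by exact_mod_cast hLam)
    _ ≤ Q := by exact_mod_cast hQ h2q (by norm_num)
  have hdiff : ((I.C : ℝ) + 3) * M + I.L * I.Lam ≤ M ^ Q ^ 4 := by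
    have e1 : (I.C : ℝ) + 3 ≤ Q := by exact_mod_cast hQ hC3 (by norm_num)
    have e2 : (I.L : ℝ) * I.Lam ≤ Q := by exact_mod_cast hQ hLL (by norm_num)
    calc ((I.C : ℝ) + 3) * M + I.L * I.Lam ≤ Q * M + Q * M := by
          have : (Q : ℝ) ≤ Q * M := le_mul_of_one_le_right (by positivity) hM1
          exact add_le_add (mul_le_mul_of_nonneg_right e1 (by linarith)) (e2.trans this)
      _ = 2 * Q * M := by ring
      _ ≤ M * M ^ Q * M := by gcongr; exact hnat Q
      _ = M ^ (Q + 2) := by ring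
      _ ≤ M ^ Q ^ 4 := pow_le_pow_right₀ hM1 (by
          have := hpow (a := 1) (b := 4) (by norm_num) le_rfl
          simp only [pow_one] at this
          omega)
  constructor
  case Q_le => exact hQG
  case const_le => exact hQ8
  case two_F => exact hQ h2F (by norm_num)
  case bits => exact hQ (hq1 hbits) (by norm_num)
  case r => exact fun i hi => (abs_r_le hi).trans (by linarith)
  case lam_add_lam =>
    rw [← two_mul, abs_mul, abs_two]
    exact hlamQ.trans hQG
  case samples => exact hQ hsamples (by norm_num)
  case samples_mul => exact hQ hsm (by norm_num)
  case scale => exact fun i hi => (scale_le hI hi).trans (by linarith)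
  case size =>
    exact fun j i hi => hmono (hsize j i hi)
      (le_trans (by omega) (hpow (a := 2) (b := 4) (by norm_num) le_rfl))
  case prodSize =>
    exact fun j => hmono (hprod j)
      (le_trans (by omega) (hpow (a := 3) (b := 4) le_rfl le_rfl))
  case cnt =>
    intro κ i hi t ht x
    refine hmono (le_trans ?_ (hCst i hi t ht))
      (le_trans (by omega) (hpow (a := 2) (b := 4) (by norm_num) le_rfl))
    exact_mod_cast cnt_le t x
  case diff =>
    intro a j haj i hi i' hi' t ht c u hc hu
    have := abs_point_sub_le hI haj hi hi' ht hc hu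
    rw [hM] at this
    exact this.trans hdiff
  case d => exact hQ (hq1 hd) (by norm_num)
  case m => exact hQ (hq1 hm) (by norm_num)
  case k => exact hQ (hq1 hk) (by norm_num)
  case L => exact hQ (hq1 hL) (by norm_num)
  case Lam => exact hQ (hq1 hLam) (by norm_num)
  case E => exact hQ hE (by norm_num)
  case F => exact hQ hF (by norm_num)
  case Z => exact hQ hZ (by norm_num)
  case C => exact hQ hC (by norm_num)
  case W => exact hQ hW (by norm_num)
  case O => exact hQ hO (by norm_num)
  case X => exact hQ hX (by norm_num)
  case md => exact hQ hmd (by norm_num)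
  case two_L => exact hQ h2L (by norm_num)
  case d_succ => exact hQ hd1 (by norm_num)
  case cells => exact hQ hcells (by norm_num)
  case lam =>
    have := abs_nonneg I.lam
    linarith
  case l =>
    have : (q : ℝ) ≤ Q := by exact_mod_cast hQ (hq1 le_rfl) (by norm_num)
    exact hl.trans (this.trans hQG)

end Input
/-! ### The main theorem -/

/-- The approximation algorithm for maximum coverage with balls. -/
def coverProg : Prog := .seq prepareProg (.seq (.rand 19 19) selectProg)

theorem output_eq {I : Input} {c : Config} {S : Finset (Fin I.m)} [DecidablePred (· ∈ S)]
    (h : ∀ i : Fin I.m, c.mem.arr 2 i = if i ∈ S then 1 else 0) : c.output I = S := by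
  ext i
  simp [Config.output, h]

/-- The final factor G bounds the initial memory; every step of the two halves contributes at most
one more. -/
theorem coverProg_spec {I : Input} {G : ℝ} {Q : ℕ} (hI : I.Valid) (hb : I.SizeBound G Q)
    (hs : I.store.Bounded G) :
    ∃ n ≤ prepareProg.cost Q + selectProg.cost Q + 3,
      (∀ c ∈ (coverProg.run I n).support, c.todo = []) ∧
      ENNReal.ofReal (1 - I.failure) ≤ (coverProg.run I n).toOuterMeasure
        {c | c.todo = [] ∧ I.IsApprox (1 - 1 / Real.exp 1) (c.output I)} ∧
      ∀ n', ∀ c ∈ (coverProg.run I n').support,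
        c.mem.Bounded (G ^ (prepareProg.cost Q + selectProg.cost Q + 3) * G) := by
  classical
  have hG := hb.natCast hb.const_le
  have hP : prepareProg.constBound ≤ 20000 := by decide +kernel
  have hR : selectProg.constBound ≤ 20000 := by decide +kernel
  refine runFrom_seq_rand_seq (Good := fun s => I.IsApprox (1 - 1 / Real.exp 1)
      ((⟨[], s⟩ : Config).output I)) ?_ ?_ ?_ ?_ hs (prepareProg_spec hI hb) ?_
  · norm_num at hG; linarith
  · norm_num at hG; linarith
  · exact (Nat.cast_le.2 hP).trans hG
  · exact (Nat.cast_le.2 hR).trans hG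
  · rintro s ⟨a, j, hp, h19⟩
    choose cu hcu using fun i => Input.exists_decode (I := I) j i
    obtain ⟨V, hV, hgood⟩ := Input.exists_good_numbers hp.coords hI hcu
    -- The prepared state does not refer to register 19, so overwriting it with the random number is
    -- harmless; the frame of an assignment to that register expresses this.
    have hp' : ∀ v : ℕ, I.Prepared a j (s.setReg 19 (v : ℝ)) := fun v => by
      refine hp.frame (P := .const 19 0) ⟨fun x hx => ?_, fun x _ => rfl⟩ (by decide) (by decide)
        (by decide)
      have : x ≠ 19 := by
        rintro rfl
        exact Bool.noConfusion hx
      simp [this]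
    refine ⟨_, Nat.pow_pos (Input.prodSize_pos j), h19, _, fun v _ => selectProg_spec (v := v) hI hb
      (hp' v) hcu (by simp), V, ?_, hV⟩
    · rintro v hv t ⟨S, hS, ht⟩
      have : (⟨[], t⟩ : Config).output I = S := output_eq ht
      rw [this]
      exact hgood v hv S hS

namespace Input

variable {I : Input}

theorem store_bounded (hI : I.Valid) {B : ℝ} (h1 : 1 ≤ B) (hd : (I.d : ℝ) ≤ B)
    (hm : (I.m : ℝ) ≤ B) (hk : (I.k : ℝ) ≤ B) (hlam : |I.lam| ≤ B) (hl : |I.l| ≤ B)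
    (hmag : I.magnitude ≤ B) : I.store.Bounded B := by
  have h0 : |(0 : ℝ)| ≤ B := by rw [abs_zero]; linarith
  refine ⟨fun x => ?_, fun x n => ?_⟩
  · match x with
    | 0 => change |(I.d : ℝ)| ≤ B; simpa using hd
    | 1 => change |(I.m : ℝ)| ≤ B; simpa using hm
    | 2 => change |(I.k : ℝ)| ≤ B; simpa using hk
    | 3 => exact hlam
    | 4 => exact hl
    | 5 =>
      change |I.failure| ≤ B
      rw [abs_of_pos hI.failure_pos]
      exact hI.failure_lt_one.le.trans h1
    | _ + 6 => exact h0
  · match x with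
    | 0 =>
      by_cases hn : n < I.m
      · exact (abs_r_le hn).trans hmag
      · simp only [store, hn, dif_neg, not_false_eq_true]
        exact h0
    | 1 =>
      by_cases hn : n / I.d < I.m ∧ n % I.d < I.d
      · have := abs_p_le hn.1 hn.2
        rw [Nat.mul_comm, Nat.div_add_mod] at this
        exact this.trans hmag
      · simp only [store, hn, dif_neg, not_false_eq_true]
        exact h0
    | _ + 2 => exact h0

theorem log_nonneg (hI : I.Valid) : 0 ≤ Real.log (1 / I.failure) :=
  Real.log_nonneg (by
    rw [le_div_iff₀ hI.failure_pos, one_mul]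
    exact hI.failure_lt_one.le)

theorem two_le_param (hI : I.Valid) : 2 ≤ I.param := by
  have h1 : (1 : ℝ) ≤ I.d := by exact_mod_cast hI.d_pos
  have h2 := log_nonneg hI
  have h3 := abs_nonneg I.lam
  have h4 := abs_nonneg I.l
  have h5 : (0 : ℝ) ≤ I.k := by positivity
  have h6 : (0 : ℝ) ≤ I.m := by positivity
  rw [param]
  linarith

/-- A natural number that bounds the parameters of the running time. -/
def paramBound (I : Input) : ℕ := 20000 * ⌈I.param⌉₊ ^ 2

/-- The parameter is at least 2, because d ≥ 1, so it absorbs constants: 80000 ≤ 2^17 becomes 17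
further powers. -/
theorem paramBound_le (hI : I.Valid) : (I.paramBound : ℝ) ≤ I.param ^ 19 := by
  have h1 := two_le_param hI
  have h2 : (⌈I.param⌉₊ : ℝ) ≤ 2 * I.param := by
    have := Nat.ceil_lt_add_one (by linarith : 0 ≤ I.param)
    linarith
  calc (I.paramBound : ℝ) = 20000 * (⌈I.param⌉₊ : ℝ) ^ 2 := by rw [paramBound]; push_cast; ring
    _ ≤ 20000 * (2 * I.param) ^ 2 := by gcongr
    _ = 80000 * I.param ^ 2 := by ring
    _ ≤ 2 ^ 17 * I.param ^ 2 := by gcongr; norm_num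
    _ ≤ I.param ^ 17 * I.param ^ 2 := by gcongr
    _ = I.param ^ 19 := by ring

/-- The square in `paramBound` is needed since `L` and `Lam` are of the order of l² and λ². The
number of bits is at most twice the rounded parameter because log 2 ≥ 1/2. -/
theorem sizeBound_paramBound (hI : I.Valid) :
    I.SizeBound ((2 + I.magnitude) ^ (I.paramBound ^ 40) ^ 4) (I.paramBound ^ 40) := by
  have h1 := two_le_param hI
  have h2 := log_nonneg hI
  have h3 := abs_nonneg I.lam
  have h4 := abs_nonneg I.l
  have h5 : (0 : ℝ) ≤ I.k := by positivity
  have h6 : (0 : ℝ) ≤ I.m := by positivity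
  have h7 : (0 : ℝ) ≤ I.d := by positivity
  obtain ⟨R, hR⟩ : ∃ R, ⌈I.param⌉₊ = R := ⟨_, rfl⟩
  have hle := Nat.le_ceil I.param
  rw [hR] at hle
  have hR2 : 2 ≤ R := by exact_mod_cast h1.trans hle
  have hRq : 20000 * R ≤ I.paramBound := by
    rw [paramBound, hR]
    gcongr
    exact Nat.le_self_pow (by norm_num) R
  have hR2q : 20000 * R ^ 2 ≤ I.paramBound := by rw [paramBound, hR]
  have hcast : ∀ n : ℕ, (n : ℝ) ≤ I.param → n ≤ I.paramBound := fun n hn => by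
    have : n ≤ R := by exact_mod_cast hn.trans hle
    omega
  have hsq : ∀ x : ℝ, |x| ≤ I.param → ⌊x * x⌋₊ ≤ R ^ 2 := fun x hx => by
    refine Nat.floor_le_of_le ?_
    push_cast
    rw [← abs_mul_abs_self, ← sq]
    gcongr
    exact hx.trans hle
  have hparam : I.param = |I.lam| + I.d + |I.l| + I.k + I.m + Real.log (1 / I.failure) + 1 := rfl
  refine sizeBound hI (by omega) (hcast _ (by linarith)) (hcast _ (by linarith))
    (hcast _ (by linarith)) ?_ ?_ ?_ ?_
  · have := hsq I.l (by linarith)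
    rw [L]
    omega
  · have := hsq I.lam (by linarith)
    rw [Lam]
    have : 1 ≤ R ^ 2 := Nat.one_le_pow _ _ (by omega)
    omega
  · have : I.bits ≤ 2 * R := by
      refine Nat.ceil_le.2 ?_
      have h8 : (1 / 2 : ℝ) ≤ Real.log 2 := by
        have := Real.log_two_gt_d9
        linarith
      push_cast
      rw [Real.logb, div_le_iff₀ (by linarith)]
      nlinarith
    omega
  · have h8 : (R : ℝ) ≤ I.paramBound := by exact_mod_cast (by omega : R ≤ I.paramBound)
    linarith

end Input

/-- Here 760 = 19 · 40 converts powers of Q into powers of the parameter. The steps, plus one for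
the initial memory, number at most Q^(c₁ + c₂ + 2); each costs a factor (2 + magnitude)^(Q⁴), so the
total exponent is at most Q^(c₁ + c₂ + 6). -/
theorem coverProg_polynomial : ∃ C : ℕ, ∀ I : Input, I.Valid →
    coverProg.HaltsWithin I (C * I.param ^ C) ∧
    coverProg.NumbersBounded I ((2 + I.magnitude) ^ ((C : ℝ) * I.param ^ C)) ∧
    coverProg.SucceedsWithProb I (I.IsApprox (1 - 1 / Real.exp 1)) (1 - I.failure) := by
  obtain ⟨c₁, hc₁⟩ := cost_le_pow prepareProg
  obtain ⟨c₂, hc₂⟩ := cost_le_pow selectProg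
  refine ⟨760 * (c₁ + c₂ + 6), fun I hI => ?_⟩
  have hb := Input.sizeBound_paramBound hI
  have hp := Input.two_le_param hI
  have hmag := Input.magnitude_nonneg (I := I)
  have hM1 : 1 ≤ 2 + I.magnitude := by linarith
  have hparam := Input.paramBound_le hI
  obtain ⟨Q, hQe⟩ : ∃ Q, I.paramBound ^ 40 = Q := ⟨_, rfl⟩
  rw [hQe] at hb
  have hQ := hb.const_le
  obtain ⟨T, hT⟩ : ∃ T, prepareProg.cost Q + selectProg.cost Q + 3 = T := ⟨_, rfl⟩
  have hTQ : T + 1 ≤ Q ^ (c₁ + c₂ + 2) := by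
    have a1 : Q ^ c₁ ≤ Q ^ (c₁ + c₂) := Nat.pow_le_pow_right (by omega) (by omega)
    have a2 : Q ^ c₂ ≤ Q ^ (c₁ + c₂) := Nat.pow_le_pow_right (by omega) (by omega)
    have a3 : 1 ≤ Q ^ (c₁ + c₂) := Nat.one_le_pow _ _ (by omega)
    have a4 := hc₁ Q (by omega)
    have a5 := hc₂ Q (by omega)
    calc T + 1 ≤ 6 * Q ^ (c₁ + c₂) := by omega
      _ ≤ Q ^ 2 * Q ^ (c₁ + c₂) := by gcongr; nlinarith
      _ = Q ^ (c₁ + c₂ + 2) := by ring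
  have hQp : (Q : ℝ) ≤ I.param ^ 760 := calc
    (Q : ℝ) = (I.paramBound : ℝ) ^ 40 := by rw [← hQe]; push_cast; rfl
    _ ≤ (I.param ^ 19) ^ 40 := by gcongr
    _ = I.param ^ 760 := by rw [← pow_mul]
  have hfin : ((Q ^ (c₁ + c₂ + 6) : ℕ) : ℝ) ≤ ((760 * (c₁ + c₂ + 6) : ℕ) : ℝ) *
      I.param ^ (760 * (c₁ + c₂ + 6)) := calc
    ((Q ^ (c₁ + c₂ + 6) : ℕ) : ℝ) = (Q : ℝ) ^ (c₁ + c₂ + 6) := by push_cast; rfl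
    _ ≤ (I.param ^ 760) ^ (c₁ + c₂ + 6) := by gcongr
    _ = I.param ^ (760 * (c₁ + c₂ + 6)) := by rw [← pow_mul]
    _ ≤ _ := le_mul_of_one_le_left (by positivity) (by
      have : 1 ≤ 760 * (c₁ + c₂ + 6) := by omega
      exact_mod_cast this)
  have hs : I.store.Bounded ((2 + I.magnitude) ^ Q ^ 4) := by
    refine Input.store_bounded hI (one_le_pow₀ hM1) (hb.natCast hb.d) (hb.natCast hb.m)
      (hb.natCast hb.k) hb.lam hb.l ?_
    have : 2 + I.magnitude ≤ (2 + I.magnitude) ^ Q ^ 4 := le_self_pow₀ hM1 (by positivity)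
    linarith
  obtain ⟨n, hn, h1, h2, h3⟩ := coverProg_spec hI hb hs
  rw [hT] at hn h3
  refine ⟨⟨n, le_trans ?_ hfin, h1⟩, fun n' c hc => ?_, ⟨n, h2⟩⟩
  · have : n ≤ Q ^ (c₁ + c₂ + 6) := hn.trans ((Nat.le_succ T).trans (hTQ.trans
      (Nat.pow_le_pow_right (by omega) (by omega))))
    exact_mod_cast this
  · have hle : ((2 + I.magnitude) ^ Q ^ 4) ^ T * (2 + I.magnitude) ^ Q ^ 4 ≤
        (2 + I.magnitude) ^ (((760 * (c₁ + c₂ + 6) : ℕ) : ℝ) *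
          I.param ^ (760 * (c₁ + c₂ + 6))) := by
      rw [← pow_succ, ← pow_mul, ← Real.rpow_natCast]
      refine Real.rpow_le_rpow_of_exponent_le hM1 (le_trans ?_ hfin)
      have : Q ^ 4 * (T + 1) ≤ Q ^ (c₁ + c₂ + 6) := calc
        Q ^ 4 * (T + 1) ≤ Q ^ 4 * Q ^ (c₁ + c₂ + 2) := by gcongr
        _ = Q ^ (c₁ + c₂ + 6) := by ring
      exact_mod_cast this
    exact ⟨fun x => ((h3 n' c hc).1 x).trans hle, fun x i => ((h3 n' c hc).2 x i).trans hle⟩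

end BallCoverage
end

/-- There is a randomized program which, for every list of `m` balls with centers in
`D(lam, d, l)`, every `k ≤ m` and every failure probability `γ` in `(0, 1)`, always halts after a
number of elementary steps that is polynomial in `|lam|`, `d`, `|l|`, `k`, `m`, `log (1 / γ)`,
and with probability at least `1 - γ` selects `k` of the sets of lattice points of the balls whose
union has at least `1 - 1 / e` times the largest possible size. All numbers that it stores have
at most polynomially many times the length of the numbers of the input. -/
theorem mainTheorem12 :
    ∃ (P : BallCoverage.Prog) (C : ℕ), ∀ I : BallCoverage.Input, I.Valid →
      P.HaltsWithin I (C * I.param ^ C) ∧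
      P.NumbersBounded I ((2 + I.magnitude) ^ ((C : ℝ) * I.param ^ C)) ∧
      P.SucceedsWithProb I (I.IsApprox (1 - 1 / Real.exp 1)) (1 - I.failure) :=
  ⟨BallCoverage.coverProg, BallCoverage.coverProg_polynomial⟩
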